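/- **Setting.** Let $f_1,f_2,k,d,\beta$ be natural numbers with $\beta\ge1$, $k\le d$, and put $n_1=2f_1+k$, $n_2=2f_2+d$, where $f_1<n_1/2$ and $f_2<n_2/3$. A storage system has writers, readers, a first layer $\mathcal L_1$ of $n_1$ servers and a second layer $\mathcal L_2$ of $n_2$ servers. Object values are the files of an exact-repair minimum-bandwidth regenerating code with parameters $(n_1+n_2,k,d)$, $\alpha=d\beta$, over a finite field, in which the helper data sent by a node depend only on its content and on the two nodes involved; its coded elements $c_1,\dots,c_{n_1+n_2}$ are associated with the servers of $\mathcal L_1$ and then of $\mathcal L_2$. Tags are pairs $(z,w)$ of a natural number and a writer, ordered lexicographically; $t_0$ is the initial tag. The LDS algorithm is the following. All messages and server records that belong to a client operation carry the identity of that operation. *Writer $w$.* Query all of $\mathcal L_1$ for tags, await $f_1+k$ responses, let $t$ be their maximum; send $(t_w,v)$ with $t_w=(t.z+1,w)$ to all of $\mathcal L_1$; complete after acknowledgments from $f_1+k$ servers. *Reader.* Query all of $\mathcal L_1$ for committed tags, await $f_1+k$ responses, let $t_{req}$ be their maximum; send $t_{req}$ to all of $\mathcal L_1$ and await responses from $f_1+k$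 servers such that at least one is a (tag, value) pair or at least $k$ servers sent coded elements for a common tag; take the highest tag $t_r$ available in this way, with its (possibly decoded) value; send put-tag $t_r$ to all of $\mathcal L_1$ and complete after acknowledgments from $f_1+k$ servers. *Server of $\mathcal L_1$.* It keeps a list $L$ of pairs (tag, value or $\bot$), initially $\{(t_0,\bot)\}$, a committed tag $t_c$, initially $t_0$, and a set $\Gamma$ of outstanding reads with their requested tags. A tag query is answered by the largest tag in $L$, a committed-tag query by $t_c$. On $(t,v)$ from a writer, it broadcasts $t$ to $\mathcal L_1$, and then adds $(t,v)$ to $L$ if $t>t_c$, and otherwise acknowledges the write. When it consumes a broadcast of $t$, and $t$ occurs in $L$ and at least $f_1+k$ broadcasts of $t$ have been consumed, it acknowledges the write of $t$, and if moreover $t>t_c$, it *commits* $t$: it sets $t_c=t$, sends $(t,v)$ to the outstanding reads with requested tag $\le t$ and removes them from $\Gamma$, replaces every $(t',\cdot)\in L$ with $t'<t$ by $(t',\bot)$, and sends $t$ with the respective coded element of $v$ to every server of $\mathcal L_2$; after $n_2-f_2$ acknowledgments from $\mathcal L_2$ it replaces $(t,v)$ by $(t,\bot)$ in $L$. A data request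 for $t_{req}$ is answered by $(t_{req},v)$ if that is in $L$, else by $(t_c,v)$ if $t_c>t_{req}$ and that is in $L$; else the read is added to $\Gamma$ and helper data are requested from all of $\mathcal L_2$, and after $n_2-f_2$ responses the server, if the read is still in $\Gamma$, regenerates its coded element for the highest tag occurring in at least $d$ responses and sends the tag with this element to the reader, or sends $(\bot,\bot)$ if there is no such tag or it is smaller than $t_{req}$. On put-tag $t$, it removes that read from $\Gamma$, and if $t>t_c$, it commits $t$ as above when $L$ holds a value for $t$; when $L$ holds none, it sets $t_c=t$, adds $(t,\bot)$ to $L$, sends the pair $(\bar t,\bar v)\in L$ with the largest $\bar t<t$ that has a value to the outstanding reads with requested tag $\le\bar t$ and removes these from $\Gamma$, and replaces values of tags below $t$ by $\bot$. In every case it acknowledges to the reader. *Server of $\mathcal L_2$.* It stores one pair (tag, coded element), replaces it by a received pair of higher tag, acknowledges every received pair, and answers a helper request by its tag and the helper data computed from its coded element. *Broadcast.* The initiator sends the message to a fixed set of $f_1+1$ servers of $\mathcal L_1$; each of these, on first reception, forwards it to all of $\mathcal L_1$; each server of $\mathcal L_1$ consumes the message on first reception. Let $\beta^*$ be an execution in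 which every client invokes an operation only when it has none pending, links are reliable, at most $f_1$ servers of $\mathcal L_1$, at most $f_2$ servers of $\mathcal L_2$ and any number of clients crash, local computation takes no time, and every message is delivered within $\tau_1$ on a link between a client and an $\mathcal L_1$ server, within $\tau_2$ on a link between an $\mathcal L_1$ and an $\mathcal L_2$ server, and within $\tau_0$ on a link between two $\mathcal L_1$ servers, unless its destination has crashed by then; here $\tau_0,\tau_1,\tau_2\ge0$. An operation is *successful* if it completes. For a successful write $\pi$ with tag $t$, let $T_e(\pi)$ be the earliest point such that at every later point each non-crashed server of $\mathcal L_1$ has committed tag $\ge t$ and no value with a tag $\le t$ in its list. The *extended write* starts with $\pi$ and ends at the later of the completion of $\pi$ and $T_e(\pi)$. **Statement.** In $\beta^*$: 1. every successful write completes within $4\tau_1+2\tau_0$ of its invocation; 2. for every successful write, $T_e(\pi)$ exists and the extended write completes within $\max(3\tau_1+2\tau_0+2\tau_2,\;4\tau_1+2\tau_0)$; 3. every successful read completes within $\max(6\tau_1+2\tau_2,\;6\tau_1+2\tau_0+\tau_2)$. -/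

import Mathlib

open scoped BigOperators

/-! The LDS (Layered Data Storage) algorithm as a message-passing state machine, its asynchronous
executions with crash failures, and executions with bounded link delays. -/

namespace LDS

/-- Numerical parameters: crash tolerances `f₁`, `f₂` of the two layers and the parameters
`k`, `d`, `β` of the regenerating code. -/
structure Params where
  f₁ : ℕ
  f₂ : ℕ
  k : ℕ
  d : ℕ
  β : ℕ

/-- Number of servers in the first layer, `n₁ = 2 f₁ + k`. -/
abbrev Params.n₁ (P : Params) : ℕ := 2 * P.f₁ + P.k

/-- Number of servers in the second layer, `n₂ = 2 f₂ + d`. -/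
abbrev Params.n₂ (P : Params) : ℕ := 2 * P.f₂ + P.d

/-- The standing assumptions `f₁ < n₁ / 2`, `f₂ < n₂ / 3`, `k ≤ d`, `β ≥ 1`. -/
structure Params.Valid (P : Params) : Prop where
  f₁_lt : 2 * P.f₁ < P.n₁
  f₂_lt : 3 * P.f₂ < P.n₂
  k_le_d : P.k ≤ P.d
  β_pos : 0 < P.β

/-! ### Regenerating codes at the minimum bandwidth point -/

/-- File size `B = ∑_{i < k} (d - i) β` at the minimum bandwidth regenerating point (for `k ≤ d`). -/
def fileSize (k d β : ℕ) : ℕ := ∑ i ∈ Finset.range k, (d - i) * β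

/-- An exact-repair `{(n, k, d)(α = d β, β)}` regenerating code with file size `fileSize k d β`.
Any `k` coded elements determine the file; the helper data for node `j` sent by any `d` other nodes
determine the coded element of `j`.  The helper data sent by `i` for the repair of `j` depend only
on `i`, `j` and the content of `i`, not on the identity of the other helpers. -/
structure MBRCode (n k d β : ℕ) (F : Type*) where
  encode : (Fin (fileSize k d β) → F) → Fin n → (Fin (d * β) → F)
  helper : (i j : Fin n) → (Fin (d * β) → F) → (Fin β → F)
  decodable : ∀ A : Finset (Fin n), A.card = k → ∀ u v,
    (∀ i ∈ A, encode u i = encode v i) → u = v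
  repairable : ∀ (j : Fin n) (A : Finset (Fin n)), A.card = d → j ∉ A → ∀ u v,
    (∀ i ∈ A, helper i j (encode u i) = helper i j (encode v i)) → encode u j = encode v j

open Classical in
/-- Decoding: the file that is consistent with a collection of (node, coded element) pairs. -/
noncomputable def MBRCode.decode {n k d β : ℕ} {F : Type*} [Zero F] (C : MBRCode n k d β F)
    (D : Set (Fin n × (Fin (d * β) → F))) : Fin (fileSize k d β) → F :=
  if h : ∃ v, ∀ p ∈ D, C.encode v p.1 = p.2 then h.choose else 0

open Classical in
/-- Exact repair: the coded element of node `j` that is consistent with a collection of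
(helper node, helper data) pairs. -/
noncomputable def MBRCode.repair {n k d β : ℕ} {F : Type*} [Zero F] (C : MBRCode n k d β F)
    (j : Fin n) (D : Set (Fin n × (Fin β → F))) : Fin (d * β) → F :=
  if h : ∃ v, ∀ p ∈ D, C.helper p.1 j (C.encode v p.1) = p.2 then C.encode h.choose j else 0

/-! ### Tags, values, processes, messages -/

/-- Tags `(z, w)`, ordered lexicographically. -/
abbrev Tag (W : Type*) := ℕ ×ₗ W

/-- Object values are the files of the code. -/
abbrev Value (P : Params) (F : Type*) := Fin (fileSize P.k P.d P.β) → F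

/-- Coded elements, in `F ^ α`. -/
abbrev Coded (P : Params) (F : Type*) := Fin (P.d * P.β) → F

/-- Helper data, in `F ^ β`. -/
abbrev Helper (P : Params) (F : Type*) := Fin P.β → F

/-- Processes: writers, readers, first-layer servers `edge`, second-layer servers `back`. -/
inductive Proc (P : Params) (W R : Type*) where
  | writer (w : W)
  | reader (r : R)
  | edge (j : Fin P.n₁)
  | back (i : Fin P.n₂)

/-- Messages.  The number `q` is the sequence number of the client operation a message belongs to;
together with the client it identifies the operation. -/
inductive Msg (P : Params) (F W R : Type*) where
  | queryTag (q : ℕ)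
  | tagResp (q : ℕ) (t : Tag W)
  | putData (t : Tag W) (v : Value P F)
  | ackWrite (t : Tag W)
  /-- a copy of the broadcast of tag `t` that was invoked by the first-layer server `origin` -/
  | commitTag (origin : Fin P.n₁) (t : Tag W)
  | writeCodeElem (t : Tag W) (c : Coded P F)
  | ackCodeElem (t : Tag W)
  | queryCommTag (q : ℕ)
  | commTagResp (q : ℕ) (t : Tag W)
  | queryData (q : ℕ) (treq : Tag W)
  | dataValue (q : ℕ) (t : Tag W) (v : Value P F)
  | dataCoded (q : ℕ) (t : Tag W) (c : Coded P F)
  /-- the response `(⊥, ⊥)` -/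
  | dataFail (q : ℕ)
  | queryCodeElem (r : R) (q : ℕ)
  | helperElem (r : R) (q : ℕ) (t : Tag W) (h : Helper P F)
  | putTag (q : ℕ) (t : Tag W)
  | ackRead (q : ℕ)

/-- A message in transit on the link from `src` to `dst`. -/
structure Packet (P : Params) (F W R : Type*) where
  src : Proc P W R
  dst : Proc P W R
  msg : Msg P F W R

/-- What a process emits in one action: a set of (destination, message) pairs. -/
abbrev Out (P : Params) (F W R : Type*) := Set (Proc P W R × Msg P F W R)

/-- The fixed data of an instance of the algorithm: the code, the initial tag and value, and the
fixed set of `f₁ + 1` first-layer servers used by the broadcast primitive. -/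
structure System (P : Params) (F W : Type*) where
  code : MBRCode (P.n₁ + P.n₂) P.k P.d P.β F
  t₀ : Tag W
  v₀ : Value P F
  relays : Finset (Fin P.n₁)
  relays_card : relays.card = P.f₁ + 1

section Algorithm

variable {P : Params} {F W R : Type*} [Zero F] [LinearOrder W]

open Classical in
/-- The maximum of a set of tags (`dflt` if there is none). -/
noncomputable def maxTag (dflt : Tag W) (A : Set (Tag W)) : Tag W :=
  if h : ∃ t, IsGreatest A t then h.choose else dflt

/-! ### Writers -/

inductive WPhase (P : Params) (F W : Type*) where
  | idle
  | getTag (v : Value P F) (resp : Set (Fin P.n₁ × Tag W))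
  | putData (t : Tag W) (v : Value P F) (acks : Set (Fin P.n₁))

structure WState (P : Params) (F W : Type*) where
  /-- number of operations invoked so far -/
  ops : ℕ
  phase : WPhase P F W

def WState.invoke (s : WState P F W) (v : Value P F) : WState P F W × Out P F W R :=
  (⟨s.ops + 1, .getTag v ∅⟩, {o | ∃ j, o = (.edge j, .queryTag (s.ops + 1))})

open Classical in
/-- Writer `w` receives a message from the first-layer server `j`. -/
noncomputable def WState.recv (S : System P F W) (w : W) (s : WState P F W) (j : Fin P.n₁) :
    Msg P F W R → WState P F W × Out P F W R
  | .tagResp q t =>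
    match s.phase with
    | .getTag v resp =>
      if q = s.ops then
        let resp' := insert (j, t) resp
        if P.f₁ + P.k ≤ {j' | ∃ t', (j', t') ∈ resp'}.ncard then
          let m := maxTag S.t₀ {t' | ∃ j', (j', t') ∈ resp'}
          let tw : Tag W := toLex ((ofLex m).1 + 1, w)
          (⟨s.ops, .putData tw v ∅⟩, {o | ∃ j', o = (.edge j', .putData tw v)})
        else (⟨s.ops, .getTag v resp'⟩, ∅)
      else (s, ∅)
    | _ => (s, ∅)
  | .ackWrite t =>
    match s.phase with
    | .putData tw v acks =>
      if t = tw then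
        if P.f₁ + P.k ≤ (insert j acks).ncard then (⟨s.ops, .idle⟩, ∅)
        else (⟨s.ops, .putData tw v (insert j acks)⟩, ∅)
      else (s, ∅)
    | _ => (s, ∅)
  | _ => (s, ∅)

/-! ### Readers -/

/-- A response to a get-data request: `(tag, value)`, `(tag, coded element)` or `(⊥, ⊥)`. -/
inductive DataResp (P : Params) (F W : Type*) where
  | value (t : Tag W) (v : Value P F)
  | coded (t : Tag W) (c : Coded P F)
  | fail

inductive RPhase (P : Params) (F W : Type*) where
  | idle
  | getCommTag (resp : Set (Fin P.n₁ × Tag W))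
  | getData (treq : Tag W) (resp : Set (Fin P.n₁ × DataResp P F W))
  | putTag (t : Tag W) (v : Value P F) (acks : Set (Fin P.n₁))

structure RState (P : Params) (F W : Type*) where
  /-- number of operations invoked so far -/
  ops : ℕ
  phase : RPhase P F W

def RState.invoke (s : RState P F W) : RState P F W × Out P F W R :=
  (⟨s.ops + 1, .getCommTag ∅⟩, {o | ∃ j, o = (.edge j, .queryCommTag (s.ops + 1))})

/-- Tags of the (tag, value) pairs available from the get-data responses: those received as such,
and those for which `k` servers sent coded elements. -/
def availableTags (resp : Set (Fin P.n₁ × DataResp P F W)) : Set (Tag W) :=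
  {t | ∃ j v, (j, DataResp.value t v) ∈ resp} ∪
    {t | P.k ≤ {j | ∃ c, (j, DataResp.coded t c) ∈ resp}.ncard}

open Classical in
/-- The value belonging to an available tag. -/
noncomputable def availableValue (S : System P F W) (resp : Set (Fin P.n₁ × DataResp P F W))
    (t : Tag W) : Value P F :=
  if h : ∃ v j, (j, DataResp.value t v) ∈ resp then h.choose
  else S.code.decode {p | ∃ j c, (j, DataResp.coded t c) ∈ resp ∧ p = (Fin.castAdd P.n₂ j, c)}

open Classical in
/-- A get-data response arrives at a reader. -/
noncomputable def RState.recvData (S : System P F W) (s : RState P F W) (j : Fin P.n₁) (q : ℕ)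
    (x : DataResp P F W) : RState P F W × Out P F W R :=
  match s.phase with
  | .getData treq resp =>
    if q = s.ops then
      let resp' := insert (j, x) resp
      if P.f₁ + P.k ≤ {j' | ∃ y, (j', y) ∈ resp'}.ncard ∧ (availableTags resp').Nonempty then
        let t := maxTag S.t₀ (availableTags resp')
        (⟨s.ops, .putTag t (availableValue S resp' t) ∅⟩, {o | ∃ j', o = (.edge j', .putTag q t)})
      else (⟨s.ops, .getData treq resp'⟩, ∅)
    else (s, ∅)
  | _ => (s, ∅)

open Classical in
/-- A reader receives a message from the first-layer server `j`. -/
noncomputable def RState.recv (S : System P F W) (s : RState P F W) (j : Fin P.n₁) :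
    Msg P F W R → RState P F W × Out P F W R
  | .commTagResp q t =>
    match s.phase with
    | .getCommTag resp =>
      if q = s.ops then
        let resp' := insert (j, t) resp
        if P.f₁ + P.k ≤ {j' | ∃ t', (j', t') ∈ resp'}.ncard then
          let treq := maxTag S.t₀ {t' | ∃ j', (j', t') ∈ resp'}
          (⟨s.ops, .getData treq ∅⟩, {o | ∃ j', o = (.edge j', .queryData q treq)})
        else (⟨s.ops, .getCommTag resp'⟩, ∅)
      else (s, ∅)
    | _ => (s, ∅)
  | .dataValue q t v => s.recvData S j q (.value t v)
  | .dataCoded q t c => s.recvData S j q (.coded t c)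
  | .dataFail q => s.recvData S j q .fail
  | .ackRead q =>
    match s.phase with
    | .putTag t v acks =>
      if q = s.ops then
        if P.f₁ + P.k ≤ (insert j acks).ncard then (⟨s.ops, .idle⟩, ∅)
        else (⟨s.ops, .putTag t v (insert j acks)⟩, ∅)
      else (s, ∅)
    | _ => (s, ∅)
  | _ => (s, ∅)

/-! ### First-layer servers -/

/-- State of a first-layer server.  `none` in the second component of an entry of `L` is `⊥`. -/
structure EdgeState (P : Params) (F W R : Type*) where
  L : Set (Tag W × Option (Value P F))
  /-- outstanding reads: reader, sequence number of its operation, requested tag -/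
  Γ : Set (R × ℕ × Tag W)
  /-- committed tag -/
  tc : Tag W
  commitCounter : Tag W → ℕ
  readCounter : R × ℕ → ℕ
  writeCounter : Tag W → ℕ
  /-- helper responses per read operation, each labelled with the second-layer server it is from -/
  K : R × ℕ → Set (Fin P.n₂ × Tag W × Helper P F)
  /-- broadcasts (origin, tag) received so far -/
  seen : Set (Fin P.n₁ × Tag W)

/-- Replace every pair `(t, *)` with `t < tc` by `(t, ⊥)`. -/
def collect (tc : Tag W) (L : Set (Tag W × Option (Value P F))) :
    Set (Tag W × Option (Value P F)) :=
  {p | p ∈ L ∧ tc ≤ p.1} ∪ {p | p.2 = none ∧ p.1 < tc ∧ ∃ x, (p.1, x) ∈ L}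

/-- Messages `(t, v)`, for the value `v` of `t` in `L`, to the outstanding reads in `Γ` that
requested a tag at most `t`. -/
def serve (L : Set (Tag W × Option (Value P F))) (Γ : Set (R × ℕ × Tag W)) (t : Tag W) :
    Out P F W R :=
  {o | ∃ r q treq v, (r, q, treq) ∈ Γ ∧ treq ≤ t ∧ (t, some v) ∈ L ∧
    o = (.reader r, .dataValue q t v)}

/-- The messages that initiate write-to-L2 of `(t, v)`, for the value `v` of `t` in `L`. -/
def writeToL2 (S : System P F W) (L : Set (Tag W × Option (Value P F))) (t : Tag W) :
    Out P F W R :=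
  {o | ∃ i v, (t, some v) ∈ L ∧
    o = (.back i, .writeCodeElem t (S.code.encode v (Fin.natAdd P.n₁ i)))}

/-- The acknowledgment to the writer of tag `t`. -/
def ackWriter (t : Tag W) : Out P F W R := {(.writer (ofLex t).2, .ackWrite t)}

/-- get-tag-resp: send the maximum tag in `L`. -/
noncomputable def EdgeState.getTagResp (S : System P F W) (s : EdgeState P F W R) (w : W) (q : ℕ) :
    EdgeState P F W R × Out P F W R :=
  (s, {(.writer w, .tagResp q (maxTag S.t₀ {t | ∃ x, (t, x) ∈ s.L}))})

/-- put-data-resp at server `j`; invoking the broadcast means sending it to the relays. -/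
noncomputable def EdgeState.putDataResp (S : System P F W) (j : Fin P.n₁) (s : EdgeState P F W R)
    (t : Tag W) (v : Value P F) : EdgeState P F W R × Out P F W R :=
  let bcast : Out P F W R := {o | ∃ j' ∈ S.relays, o = (.edge j', .commitTag j t)}
  if s.tc < t then ({ s with L := insert (t, some v) s.L }, bcast)
  else (s, bcast ∪ ackWriter t)

open Classical in
/-- broadcast-resp: a broadcast of tag `t` is consumed. -/
noncomputable def EdgeState.broadcastResp (S : System P F W) (s : EdgeState P F W R) (t : Tag W) :
    EdgeState P F W R × Out P F W R :=
  let cc := Function.update s.commitCounter t (s.commitCounter t + 1)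
  if (∃ x, (t, x) ∈ s.L) ∧ P.f₁ + P.k ≤ cc t then
    if s.tc < t then
      ({ s with
          commitCounter := cc
          tc := t
          Γ := {γ | γ ∈ s.Γ ∧ ¬ γ.2.2 ≤ t}
          L := collect t s.L },
        ackWriter t ∪ serve s.L s.Γ t ∪ writeToL2 S s.L t)
    else ({ s with commitCounter := cc }, ackWriter t)
  else ({ s with commitCounter := cc }, ∅)

open Classical in
/-- A copy of the broadcast `(origin, t)` arrives at server `j`.  Only the first copy counts: a
relay forwards it to the whole first layer, and every server then consumes it. -/
noncomputable def EdgeState.commitTagRecv (S : System P F W) (j : Fin P.n₁)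
    (s : EdgeState P F W R) (origin : Fin P.n₁) (t : Tag W) :
    EdgeState P F W R × Out P F W R :=
  if (origin, t) ∈ s.seen then (s, ∅)
  else
    let fwd : Out P F W R := {o | j ∈ S.relays ∧ ∃ j', o = (.edge j', .commitTag origin t)}
    let x := EdgeState.broadcastResp S { s with seen := insert (origin, t) s.seen } t
    (x.1, fwd ∪ x.2)

open Classical in
/-- write-to-L2-complete. -/
noncomputable def EdgeState.ackCodeElemRecv (s : EdgeState P F W R) (t : Tag W) :
    EdgeState P F W R × Out P F W R :=
  let wc := Function.update s.writeCounter t (s.writeCounter t + 1)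
  if wc t = P.n₂ - P.f₂ then
    ({ s with writeCounter := wc, L := {p | p ∈ s.L ∧ p.1 ≠ t} ∪ {(t, none)} }, ∅)
  else ({ s with writeCounter := wc }, ∅)

/-- get-committed-tag-resp. -/
def EdgeState.getCommTagResp (s : EdgeState P F W R) (r : R) (q : ℕ) :
    EdgeState P F W R × Out P F W R :=
  (s, {(.reader r, .commTagResp q s.tc)})

open Classical in
/-- get-data-resp; in the last case the read is registered and regenerate-from-L2 is initiated. -/
noncomputable def EdgeState.getDataResp (s : EdgeState P F W R) (r : R) (q : ℕ) (treq : Tag W) :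
    EdgeState P F W R × Out P F W R :=
  if ∃ v, (treq, some v) ∈ s.L then
    (s, {o | ∃ v, (treq, some v) ∈ s.L ∧ o = (.reader r, .dataValue q treq v)})
  else if treq < s.tc ∧ ∃ v, (s.tc, some v) ∈ s.L then
    (s, {o | ∃ v, (s.tc, some v) ∈ s.L ∧ o = (.reader r, .dataValue q s.tc v)})
  else
    ({ s with Γ := insert (r, q, treq) s.Γ }, {o | ∃ i, o = (.back i, .queryCodeElem r q)})

/-- Tags that can be regenerated from a set of helper responses: those that occur `d` times. -/
def regenerableTags (K : Set (Fin P.n₂ × Tag W × Helper P F)) : Set (Tag W) :=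
  {t | P.d ≤ {i | ∃ h, (i, t, h) ∈ K}.ncard}

/-- The coded element of server `j` regenerated from the responses in `K` with tag `t`. -/
noncomputable def regenerate (S : System P F W) (j : Fin P.n₁)
    (K : Set (Fin P.n₂ × Tag W × Helper P F)) (t : Tag W) : Coded P F :=
  S.code.repair (Fin.castAdd P.n₂ j) {p | ∃ i h, (i, t, h) ∈ K ∧ p = (Fin.natAdd P.n₁ i, h)}

open Classical in
/-- regenerate-from-L2-complete at server `j`, on a helper response from the second-layer server
`i`.  Nothing is sent to a read that is no longer outstanding. -/
noncomputable def EdgeState.helperElemRecv (S : System P F W) (j : Fin P.n₁)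
    (s : EdgeState P F W R) (i : Fin P.n₂) (r : R) (q : ℕ) (t : Tag W) (h : Helper P F) :
    EdgeState P F W R × Out P F W R :=
  let rc := Function.update s.readCounter (r, q) (s.readCounter (r, q) + 1)
  let Krq := insert (i, t, h) (s.K (r, q))
  if rc (r, q) = P.n₂ - P.f₂ then
    ({ s with readCounter := rc, K := Function.update s.K (r, q) ∅ },
      {o | ∃ treq, (r, q, treq) ∈ s.Γ ∧
        ((∃ t', IsGreatest (regenerableTags Krq) t' ∧ treq ≤ t' ∧
            o = (.reader r, .dataCoded q t' (regenerate S j Krq t'))) ∨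
          ((¬ ∃ t', IsGreatest (regenerableTags Krq) t' ∧ treq ≤ t') ∧
            o = (.reader r, .dataFail q)))})
  else ({ s with readCounter := rc, K := Function.update s.K (r, q) Krq }, ∅)

open Classical in
/-- put-tag-resp. -/
noncomputable def EdgeState.putTagResp (S : System P F W) (s : EdgeState P F W R) (r : R) (q : ℕ)
    (t : Tag W) : EdgeState P F W R × Out P F W R :=
  let Γ₁ : Set (R × ℕ × Tag W) := {γ | γ ∈ s.Γ ∧ ¬ (γ.1 = r ∧ γ.2.1 = q)}
  let ack : Out P F W R := {(.reader r, .ackRead q)}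
  if s.tc < t then
    if ∃ v, (t, some v) ∈ s.L then
      ({ s with
          tc := t
          Γ := {γ | γ ∈ Γ₁ ∧ ¬ γ.2.2 ≤ t}
          L := collect t s.L },
        serve s.L Γ₁ t ∪ writeToL2 S s.L t ∪ ack)
    else
      let older : Set (Tag W) := {t' | t' < t ∧ ∃ v, (t', some v) ∈ s.L}
      ({ s with
          tc := t
          Γ := {γ | γ ∈ Γ₁ ∧ ¬ ∃ t', IsGreatest older t' ∧ γ.2.2 ≤ t'}
          L := collect t (insert (t, none) s.L) },
        {o | ∃ t', IsGreatest older t' ∧ o ∈ serve s.L Γ₁ t'} ∪ ack)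
  else ({ s with Γ := Γ₁ }, ack)

/-- First-layer server `j` receives a message. -/
noncomputable def EdgeState.recv (S : System P F W) (j : Fin P.n₁) (s : EdgeState P F W R) :
    Proc P W R → Msg P F W R → EdgeState P F W R × Out P F W R
  | .writer w, .queryTag q => s.getTagResp S w q
  | .writer _, .putData t v => s.putDataResp S j t v
  | .edge _, .commitTag origin t => s.commitTagRecv S j origin t
  | .back _, .ackCodeElem t => s.ackCodeElemRecv t
  | .back i, .helperElem r q t h => s.helperElemRecv S j i r q t h
  | .reader r, .queryCommTag q => s.getCommTagResp r q
  | .reader r, .queryData q treq => s.getDataResp r q treq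
  | .reader r, .putTag q t => s.putTagResp S r q t
  | _, _ => (s, ∅)

/-! ### Second-layer servers -/

/-- State of a second-layer server: one (tag, coded element) pair. -/
structure BackState (P : Params) (F W : Type*) where
  t : Tag W
  c : Coded P F

/-- Second-layer server `i` receives a message from the first-layer server `j`. -/
noncomputable def BackState.recv (S : System P F W) (i : Fin P.n₂) (s : BackState P F W)
    (j : Fin P.n₁) : Msg P F W R → BackState P F W × Out P F W R
  | .writeCodeElem t c => (if s.t < t then ⟨t, c⟩ else s, {(.edge j, .ackCodeElem t)})
  | .queryCodeElem r q =>
    (s, {(.edge j, .helperElem r q s.t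
      (S.code.helper (Fin.natAdd P.n₁ i) (Fin.castAdd P.n₂ j) s.c))})
  | _ => (s, ∅)

/-! ### The whole system -/

structure Config (P : Params) (F W R : Type*) where
  writer : W → WState P F W
  reader : R → RState P F W
  edge : Fin P.n₁ → EdgeState P F W R
  back : Fin P.n₂ → BackState P F W
  crashed : Set (Proc P W R)

def initConfig (S : System P F W) (R : Type*) : Config P F W R where
  writer _ := ⟨0, .idle⟩
  reader _ := ⟨0, .idle⟩
  edge _ :=
    { L := {(S.t₀, none)}
      Γ := ∅
      tc := S.t₀
      commitCounter := fun _ => 0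
      readCounter := fun _ => 0
      writeCounter := fun _ => 0
      K := fun _ => ∅
      seen := ∅ }
  back i := ⟨S.t₀, S.code.encode S.v₀ (Fin.natAdd P.n₁ i)⟩
  crashed := ∅

/-- What can happen in one step.  `deliver m p` delivers the packet `p` that was sent in step `m`;
the receiver acts on it at once. -/
inductive Event (P : Params) (F W R : Type*) where
  | invokeWrite (w : W) (v : Value P F)
  | invokeRead (r : R)
  | deliver (m : ℕ) (p : Packet P F W R)
  | crash (p : Proc P W R)
  | idle

/-- The packets sent by process `p` when it emits `o`. -/
def packets (p : Proc P W R) (o : Out P F W R) : Set (Packet P F W R) :=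
  {x | x.src = p ∧ (x.dst, x.msg) ∈ o}

open Classical in
/-- The configuration after an event, and the packets sent in it. -/
noncomputable def act (S : System P F W) (g : Config P F W R) :
    Event P F W R → Config P F W R × Set (Packet P F W R)
  | .invokeWrite w v =>
    let x := (g.writer w).invoke v
    ({ g with writer := Function.update g.writer w x.1 }, packets (.writer w) x.2)
  | .invokeRead r =>
    let x := (g.reader r).invoke
    ({ g with reader := Function.update g.reader r x.1 }, packets (.reader r) x.2)
  | .deliver _ p =>
    match p.dst, p.src with
    | .writer w, .edge j =>
      let x := (g.writer w).recv S w j p.msg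
      ({ g with writer := Function.update g.writer w x.1 }, packets (.writer w) x.2)
    | .reader r, .edge j =>
      let x := (g.reader r).recv S j p.msg
      ({ g with reader := Function.update g.reader r x.1 }, packets (.reader r) x.2)
    | .edge j, src =>
      let x := (g.edge j).recv S j src p.msg
      ({ g with edge := Function.update g.edge j x.1 }, packets (.edge j) x.2)
    | .back i, .edge j =>
      let x := (g.back i).recv S i j p.msg
      ({ g with back := Function.update g.back i x.1 }, packets (.back i) x.2)
    | _, _ => (g, ∅)
  | .crash p => ({ g with crashed := insert p g.crashed }, ∅)
  | .idle => (g, ∅)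

/-- A well-formed execution with reliable links and crash failures, with the time of every step.
`config n` is the configuration just before step `n`; finite executions are padded with `idle`. -/
structure Execution (S : System P F W) (R : Type*) where
  config : ℕ → Config P F W R
  event : ℕ → Event P F W R
  time : ℕ → ℝ
  config_zero : config 0 = initConfig S R
  config_succ : ∀ n, config (n + 1) = (act S (config n) (event n)).1
  time_mono : Monotone time
  /-- clients are well-formed: they invoke an operation only when no other one is pending -/
  invokeWrite_ok : ∀ n w v, event n = .invokeWrite w v →
    .writer w ∉ (config n).crashed ∧ ((config n).writer w).phase = .idle
  invokeRead_ok : ∀ n r, event n = .invokeRead r →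
    .reader r ∉ (config n).crashed ∧ ((config n).reader r).phase = .idle
  /-- only packets sent before are delivered, to a process that has not crashed -/
  deliver_ok : ∀ n m p, event n = .deliver m p →
    m < n ∧ p ∈ (act S (config m) (event m)).2 ∧ p.dst ∉ (config n).crashed
  /-- each packet is delivered at most once -/
  deliver_once : ∀ n n' m p, event n = .deliver m p → event n' = .deliver m p → n = n'
  /-- a packet to a process that never crashes is delivered -/
  reliable : ∀ m, ∀ p ∈ (act S (config m) (event m)).2,
    (∃ n, event n = .deliver m p) ∨ ∃ n, event n = .crash p.dst

end Algorithm

namespace Execution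

variable {P : Params} {F W : Type*} [Zero F] [LinearOrder W] {S : System P F W} {R : Type*}

/-- The packets sent in step `m`. -/
noncomputable def sent (E : Execution S R) (m : ℕ) : Set (Packet P F W R) :=
  (act S (E.config m) (E.event m)).2

/-- At most `f₁` first-layer and at most `f₂` second-layer servers crash; any number of clients
may crash. -/
def FewCrashes (E : Execution S R) : Prop :=
  {j : Fin P.n₁ | ∃ n, E.event n = .crash (.edge j)}.ncard ≤ P.f₁ ∧
    {i : Fin P.n₂ | ∃ n, E.event n = .crash (.back i)}.ncard ≤ P.f₂

/-- Delay bound of the link between two processes; there is no traffic on the remaining links. -/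
def linkBound (τ₀ τ₁ τ₂ : ℝ) : Proc P W R → Proc P W R → ℝ
  | .edge _, .edge _ => τ₀
  | .edge _, .back _ => τ₂
  | .back _, .edge _ => τ₂
  | _, _ => τ₁

/-- Bounded latency: each packet is delivered within the delay bound of its link, unless its
destination has crashed by then.  Local computation takes no time, since a process acts in the
very step in which a packet is delivered to it. -/
def BoundedLatency (E : Execution S R) (τ₀ τ₁ τ₂ : ℝ) : Prop :=
  ∀ m, ∀ p ∈ E.sent m, ∃ n, E.time n ≤ E.time m + linkBound τ₀ τ₁ τ₂ p.src p.dst ∧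
    (E.event n = .deliver m p ∨ E.event n = .crash p.dst)

/-- Writer `w` invokes a write of `v` in step `i`, and the write completes in step `j`; it used
the tag `t` in its put-data phase. -/
def SuccessfulWrite (E : Execution S R) (i j : ℕ) (w : W) (v : Value P F) (t : Tag W) : Prop :=
  E.event i = .invokeWrite w v ∧ i < j ∧
    (∀ n, i < n → n ≤ j → ((E.config n).writer w).phase ≠ .idle) ∧
    (∃ acks, ((E.config j).writer w).phase = .putData t v acks) ∧
    ((E.config (j + 1)).writer w).phase = .idle

/-- Reader `r` invokes a read in step `i`, and the read completes in step `j`, returning `v`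
with the tag `t`. -/
def SuccessfulRead (E : Execution S R) (i j : ℕ) (r : R) (t : Tag W) (v : Value P F) : Prop :=
  E.event i = .invokeRead r ∧ i < j ∧
    (∀ n, i < n → n ≤ j → ((E.config n).reader r).phase ≠ .idle) ∧
    (∃ acks, ((E.config j).reader r).phase = .putTag t v acks) ∧
    ((E.config (j + 1)).reader r).phase = .idle

/-- At every point after step `e`, each first-layer server that has not crashed has a committed tag
at least `t`, and has no value with a tag at most `t` in its list. -/
def ClearedAfter (E : Execution S R) (t : Tag W) (e : ℕ) : Prop :=
  ∀ n, e < n → ∀ s : Fin P.n₁, .edge s ∉ (E.config n).crashed →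
    t ≤ ((E.config n).edge s).tc ∧
      ∀ t' v, t' ≤ t → (t', some v) ∉ ((E.config n).edge s).L

/-- The extended write of a successful write: it starts in step `i` with the write, and ends at the
later one of the steps `j`, where the write completes, and `e`, the first step after which the
tags up to `t` are cleared from the first layer. -/
def ExtendedWrite (E : Execution S R) (i j e : ℕ) (w : W) (v : Value P F) (t : Tag W) : Prop :=
  E.SuccessfulWrite i j w v t ∧ IsLeast {e' | E.ClearedAfter t e'} e

end Execution

end LDS

set_option linter.unusedSectionVars false

/-! Each bound is a sum of lengths of client phases. At least `n₁ - f₁ = f₁ + k` first-layer servers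
never crash, and each phase waits for `f₁ + k` of them. If a phase were still open after its claimed
length, the responses of all live servers would have been delivered and recorded. This contradicts
an invariant saying that the condition for ending a phase fails as long as the phase is open
(`getTag_inv`, `putData_inv`, `reader_inv`).

Writes. The tag query is a round trip, `2τ₁`. The value reaches the servers within `τ₁`. One of the
`f₁ + 1` relays is alive, so each resulting broadcast takes at most `2τ₀`. A server that has
consumed the broadcasts of all live servers and its own has acknowledged the write and committed a
tag at least as high (`committed_of_seen`, `BoundedLatency.committed`). The acknowledgment costs
another `τ₁`. The round trip of write-to-L2 costs `2τ₂`, after which the value is gone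
(`BoundedLatency.cleared`). Two facts support this: no tag is used by two put-data phases
(`putData_unique`, by quorum intersection), so an acknowledgment of a tag belongs to the current
phase; and the counter of second-layer acknowledgments counts distinct servers (`writeCounter_eq`).

Reads. The first and the last phase are round trips. The data phase (`BoundedLatency.getData_le`) is
the core, since answers may be failures or coded elements of different tags. Requests sent at time
`T` are registered by `T + τ₁`, and the helper data for them are computed by `T + τ₁ + τ₂`. Let `t`
be the highest tag committed in the first layer by then. Every tag stored in the second layer or
requested by a reader is dominated by a committed tag (`bounded_tags`), so neither the requested tag
nor any tag in the helper data exceeds `t`. The first commit of `t` rests on `f₁ + k` broadcasts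
(`first_commit`). Hence `k` live servers received its value before, and each commits a tag at least
`t` within another `2τ₀` (`BoundedLatency.spread`).

Such a server may have a committed tag below `t` when the request arrives. Then it serves the
outstanding read with a value when its committed tag reaches or passes `t`
(`GetData.served_of_commit`). Otherwise its committed tag is `t`. If it has no value to send, then
`n₂ - f₂` second-layer servers have acknowledged `t`; they share `n₂ - 2f₂ = d` servers with its
helpers, so it regenerates an element for exactly `t` (`GetData.exists_coded`). So the reader gets a
value, or `k` coded elements for the common tag `t`. -/

namespace LDS

/-! ### Local transitions and invariants of a first-layer server. -/

section EdgeLocal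

variable {P : Params} {F W R : Type*} [Zero F] [LinearOrder W]

theorem maxTag_mem_or (d : Tag W) (A : Set (Tag W)) : maxTag d A ∈ A ∨ maxTag d A = d := by
  unfold maxTag
  split_ifs with h
  · exact Or.inl h.choose_spec.1
  · exact Or.inr rfl

theorem le_maxTag (d : Tag W) {A : Set (Tag W)} (hA : A.Finite) {t : Tag W} (ht : t ∈ A) :
    t ≤ maxTag d A := by
  obtain ⟨b, hb, hmax⟩ := hA.exists_maximal ⟨t, ht⟩
  have h : ∃ t, IsGreatest A t := by
    refine ⟨b, hb, fun x hx => ?_⟩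
    rcases le_total x b with h | h
    · exact h
    · exact hmax hx h
  unfold maxTag
  rw [dif_pos h]
  exact h.choose_spec.2 ht

theorem collect_tag {tc : Tag W} {L : Set (Tag W × Option (Value P F))} {t : Tag W} :
    (∃ x, (t, x) ∈ collect tc L) ↔ ∃ x, (t, x) ∈ L := by
  constructor
  · rintro ⟨x, h | h⟩
    · exact ⟨x, h.1⟩
    · exact h.2.2
  · rintro ⟨x, h⟩
    rcases le_or_gt tc t with h' | h'
    · exact ⟨x, Or.inl ⟨h, h'⟩⟩
    · exact ⟨none, Or.inr ⟨rfl, h', x, h⟩⟩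

theorem collect_some {tc : Tag W} {L : Set (Tag W × Option (Value P F))} {t : Tag W}
    {v : Value P F} : (t, some v) ∈ collect tc L ↔ (t, some v) ∈ L ∧ tc ≤ t := by
  simp [collect]

theorem collect_none {tc : Tag W} {L : Set (Tag W × Option (Value P F))} {t : Tag W}
    (h : (t, none) ∈ collect tc L) : (t, none) ∈ L ∨ t < tc := by
  rcases h with h | h
  · exact Or.inl h.1
  · exact Or.inr h.2.1

open Classical in
/-- The transitions of a first-layer server, with the conditional actions resolved. -/
inductive EdgeTrans (S : System P F W) (j : Fin P.n₁) (e : EdgeState P F W R) :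
    Proc P W R → Msg P F W R → EdgeState P F W R → Out P F W R → Prop
  | skip (src msg) : EdgeTrans S j e src msg e ∅
  | queryTag (w : W) (q : ℕ) : EdgeTrans S j e (.writer w) (.queryTag q) e
      {(.writer w, .tagResp q (maxTag S.t₀ {t | ∃ x, (t, x) ∈ e.L}))}
  | putDataNew (w : W) (t : Tag W) (v : Value P F) (h : e.tc < t) :
      EdgeTrans S j e (.writer w) (.putData t v) { e with L := insert (t, some v) e.L }
        {o | ∃ j' ∈ S.relays, o = (.edge j', .commitTag j t)}
  | putDataOld (w : W) (t : Tag W) (v : Value P F) (h : t ≤ e.tc) :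
      EdgeTrans S j e (.writer w) (.putData t v) e
        ({o | ∃ j' ∈ S.relays, o = (.edge j', .commitTag j t)} ∪ ackWriter t)
  | bcastSeen (o' origin : Fin P.n₁) (t : Tag W) (h : (origin, t) ∈ e.seen) :
      EdgeTrans S j e (.edge o') (.commitTag origin t) e ∅
  | bcastCount (o' origin : Fin P.n₁) (t : Tag W) (h : (origin, t) ∉ e.seen)
      (hc : ¬ ((∃ x, (t, x) ∈ e.L) ∧ P.f₁ + P.k ≤ e.commitCounter t + 1)) :
      EdgeTrans S j e (.edge o') (.commitTag origin t)
        { e with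
          seen := insert (origin, t) e.seen
          commitCounter := Function.update e.commitCounter t (e.commitCounter t + 1) }
        {o | j ∈ S.relays ∧ ∃ j', o = (.edge j', .commitTag origin t)}
  | bcastAck (o' origin : Fin P.n₁) (t : Tag W) (h : (origin, t) ∉ e.seen)
      (hL : ∃ x, (t, x) ∈ e.L) (hc : P.f₁ + P.k ≤ e.commitCounter t + 1) (ht : t ≤ e.tc) :
      EdgeTrans S j e (.edge o') (.commitTag origin t)
        { e with
          seen := insert (origin, t) e.seen
          commitCounter := Function.update e.commitCounter t (e.commitCounter t + 1) }
        ({o | j ∈ S.relays ∧ ∃ j', o = (.edge j', .commitTag origin t)} ∪ ackWriter t)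
  | bcastCommit (o' origin : Fin P.n₁) (t : Tag W) (h : (origin, t) ∉ e.seen)
      (hL : ∃ x, (t, x) ∈ e.L) (hc : P.f₁ + P.k ≤ e.commitCounter t + 1) (ht : e.tc < t) :
      EdgeTrans S j e (.edge o') (.commitTag origin t)
        { e with
          seen := insert (origin, t) e.seen
          commitCounter := Function.update e.commitCounter t (e.commitCounter t + 1)
          tc := t
          Γ := {γ | γ ∈ e.Γ ∧ ¬ γ.2.2 ≤ t}
          L := collect t e.L }
        ({o | j ∈ S.relays ∧ ∃ j', o = (.edge j', .commitTag origin t)} ∪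
          (ackWriter t ∪ serve e.L e.Γ t ∪ writeToL2 S e.L t))
  | ackCodeDone (i : Fin P.n₂) (t : Tag W) (h : e.writeCounter t + 1 = P.n₂ - P.f₂) :
      EdgeTrans S j e (.back i) (.ackCodeElem t)
        { e with
          writeCounter := Function.update e.writeCounter t (e.writeCounter t + 1)
          L := {p | p ∈ e.L ∧ p.1 ≠ t} ∪ {(t, none)} } ∅
  | ackCodeCount (i : Fin P.n₂) (t : Tag W) (h : e.writeCounter t + 1 ≠ P.n₂ - P.f₂) :
      EdgeTrans S j e (.back i) (.ackCodeElem t)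
        { e with writeCounter := Function.update e.writeCounter t (e.writeCounter t + 1) } ∅
  | helperDone (i : Fin P.n₂) (r : R) (q : ℕ) (t : Tag W) (h : Helper P F)
      (hc : e.readCounter (r, q) + 1 = P.n₂ - P.f₂) :
      EdgeTrans S j e (.back i) (.helperElem r q t h)
        { e with
          readCounter := Function.update e.readCounter (r, q) (e.readCounter (r, q) + 1)
          K := Function.update e.K (r, q) ∅ }
        {o | ∃ treq, (r, q, treq) ∈ e.Γ ∧
          ((∃ t', IsGreatest (regenerableTags (insert (i, t, h) (e.K (r, q)))) t' ∧ treq ≤ t' ∧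
              o = (.reader r, .dataCoded q t'
                (regenerate S j (insert (i, t, h) (e.K (r, q))) t'))) ∨
            ((¬ ∃ t', IsGreatest (regenerableTags (insert (i, t, h) (e.K (r, q)))) t' ∧
                treq ≤ t') ∧
              o = (.reader r, .dataFail q)))}
  | helperCount (i : Fin P.n₂) (r : R) (q : ℕ) (t : Tag W) (h : Helper P F)
      (hc : e.readCounter (r, q) + 1 ≠ P.n₂ - P.f₂) :
      EdgeTrans S j e (.back i) (.helperElem r q t h)
        { e with
          readCounter := Function.update e.readCounter (r, q) (e.readCounter (r, q) + 1)
          K := Function.update e.K (r, q) (insert (i, t, h) (e.K (r, q))) } ∅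
  | queryCommTag (r : R) (q : ℕ) : EdgeTrans S j e (.reader r) (.queryCommTag q) e
      {(.reader r, .commTagResp q e.tc)}
  | queryDataReq (r : R) (q : ℕ) (treq : Tag W) (h : ∃ v, (treq, some v) ∈ e.L) :
      EdgeTrans S j e (.reader r) (.queryData q treq) e
        {o | ∃ v, (treq, some v) ∈ e.L ∧ o = (.reader r, .dataValue q treq v)}
  | queryDataComm (r : R) (q : ℕ) (treq : Tag W) (h : treq < e.tc)
      (hv : ∃ v, (e.tc, some v) ∈ e.L) :
      EdgeTrans S j e (.reader r) (.queryData q treq) e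
        {o | ∃ v, (e.tc, some v) ∈ e.L ∧ o = (.reader r, .dataValue q e.tc v)}
  | queryDataRegister (r : R) (q : ℕ) (treq : Tag W) (h : ¬ ∃ v, (treq, some v) ∈ e.L)
      (hv : ¬ (treq < e.tc ∧ ∃ v, (e.tc, some v) ∈ e.L)) :
      EdgeTrans S j e (.reader r) (.queryData q treq)
        { e with Γ := insert (r, q, treq) e.Γ } {o | ∃ i, o = (.back i, .queryCodeElem r q)}
  | putTagValue (r : R) (q : ℕ) (t : Tag W) (h : e.tc < t) (hv : ∃ v, (t, some v) ∈ e.L) :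
      EdgeTrans S j e (.reader r) (.putTag q t)
        { e with
          tc := t
          Γ := {γ | (γ ∈ e.Γ ∧ ¬ (γ.1 = r ∧ γ.2.1 = q)) ∧ ¬ γ.2.2 ≤ t}
          L := collect t e.L }
        (serve e.L {γ | γ ∈ e.Γ ∧ ¬ (γ.1 = r ∧ γ.2.1 = q)} t ∪ writeToL2 S e.L t ∪
          {(.reader r, .ackRead q)})
  | putTagNone (r : R) (q : ℕ) (t : Tag W) (h : e.tc < t) (hv : ¬ ∃ v, (t, some v) ∈ e.L) :
      EdgeTrans S j e (.reader r) (.putTag q t)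
        { e with
          tc := t
          Γ := {γ | (γ ∈ e.Γ ∧ ¬ (γ.1 = r ∧ γ.2.1 = q)) ∧
            ¬ ∃ t', IsGreatest {t' | t' < t ∧ ∃ v, (t', some v) ∈ e.L} t' ∧ γ.2.2 ≤ t'}
          L := collect t (insert (t, none) e.L) }
        ({o | ∃ t', IsGreatest {t' | t' < t ∧ ∃ v, (t', some v) ∈ e.L} t' ∧
            o ∈ serve e.L {γ | γ ∈ e.Γ ∧ ¬ (γ.1 = r ∧ γ.2.1 = q)} t'} ∪
          {(.reader r, .ackRead q)})
  | putTagOld (r : R) (q : ℕ) (t : Tag W) (h : t ≤ e.tc) :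
      EdgeTrans S j e (.reader r) (.putTag q t)
        { e with Γ := {γ | γ ∈ e.Γ ∧ ¬ (γ.1 = r ∧ γ.2.1 = q)} } {(.reader r, .ackRead q)}

variable {S : System P F W} {j : Fin P.n₁} {e e' : EdgeState P F W R} {src : Proc P W R}
  {msg : Msg P F W R} {out : Out P F W R}

/-- Allows invariants to be proved by cases on `EdgeTrans` instead of unfolding the handlers. Since
`skip` accepts every message, the relation only over-approximates the handler; facts that require a
particular reaction unfold `EdgeState.recv` directly. -/
theorem edgeTrans_recv (S : System P F W) (j : Fin P.n₁) (e : EdgeState P F W R)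
    (src : Proc P W R) (msg : Msg P F W R) :
    EdgeTrans S j e src msg (e.recv S j src msg).1 (e.recv S j src msg).2 := by
  unfold EdgeState.recv
  split
  · exact .queryTag _ _
  · unfold EdgeState.putDataResp
    split_ifs with h
    · exact .putDataNew _ _ _ h
    · exact .putDataOld _ _ _ (not_lt.1 h)
  · unfold EdgeState.commitTagRecv
    split_ifs with h
    · exact .bcastSeen _ _ _ h
    · simp only [EdgeState.broadcastResp, Function.update_self]
      split_ifs with h1 h2
      · exact .bcastCommit _ _ _ h h1.1 (by simpa using h1.2) h2
      · exact .bcastAck _ _ _ h h1.1 (by simpa using h1.2) (not_lt.1 h2)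
      · simpa using EdgeTrans.bcastCount _ _ _ h (by simpa using h1)
  · simp only [EdgeState.ackCodeElemRecv, Function.update_self]
    split_ifs with h
    · exact .ackCodeDone _ _ h
    · exact .ackCodeCount _ _ h
  · simp only [EdgeState.helperElemRecv, Function.update_self]
    split_ifs with h
    · exact .helperDone _ _ _ _ _ h
    · exact .helperCount _ _ _ _ _ h
  · exact .queryCommTag _ _
  · simp only [EdgeState.getDataResp]
    split_ifs with h1 h2
    · exact .queryDataReq _ _ _ h1
    · exact .queryDataComm _ _ _ h2.1 h2.2
    · exact .queryDataRegister _ _ _ h1 h2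
  · simp only [EdgeState.putTagResp]
    split_ifs with h1 h2
    · exact .putTagValue _ _ _ h1 h2
    · exact .putTagNone _ _ _ h1 h2
    · exact .putTagOld _ _ _ (not_lt.1 h1)
  · exact .skip _ _

namespace EdgeTrans

theorem tc_le (h : EdgeTrans S j e src msg e' out) : e.tc ≤ e'.tc := by
  cases h <;> first | exact le_rfl | exact le_of_lt ‹_›

/-- Garbage collection and write-to-L2 completion replace values by `⊥` but keep the tags. Quorum
arguments about lists depend on this. -/
theorem tag_mem (h : EdgeTrans S j e src msg e' out) {t : Tag W} (ht : ∃ x, (t, x) ∈ e.L) :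
    ∃ x, (t, x) ∈ e'.L := by
  cases h <;> (try simp only [collect_tag]) <;> try exact ht
  · exact ht.imp fun x hx => Or.inr hx
  · rename_i t' _
    obtain ⟨x, h⟩ := ht
    by_cases ht : t = t'
    · exact ⟨none, Or.inr (by simp [ht])⟩
    · exact ⟨x, Or.inl ⟨h, ht⟩⟩
  · exact ht.imp fun x hx => Or.inr hx

theorem seen_subset (h : EdgeTrans S j e src msg e' out) : e.seen ⊆ e'.seen := by
  cases h <;> first | exact subset_rfl | exact Set.subset_insert _ _

end EdgeTrans

/-- The local invariants of first-layer servers. -/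
structure EdgeState.Inv (S : System P F W) (e : EdgeState P F W R) : Prop where
  finite : {t | ∃ x, (t, x) ∈ e.L}.Finite
  tc_mem : ∃ x, (e.tc, x) ∈ e.L
  tc_le_of_some : ∀ t v, (t, some v) ∈ e.L → e.tc ≤ t
  counter_eq : ∀ t, e.commitCounter t = {o | (o, t) ∈ e.seen}.ncard
  init_le : S.t₀ ≤ e.tc

/-- Duplicates are filtered by `seen`, so each counted broadcast has a new origin. The counter is
therefore a number of distinct servers. -/
theorem counter_insert {seen : Set (Fin P.n₁ × Tag W)} {cc : Tag W → ℕ}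
    (hc : ∀ t, cc t = {o | (o, t) ∈ seen}.ncard) {o : Fin P.n₁} {t : Tag W}
    (h : (o, t) ∉ seen) (t' : Tag W) :
    open Classical in
    Function.update cc t (cc t + 1) t' = {o' | (o', t') ∈ insert (o, t) seen}.ncard := by
  by_cases ht : t' = t
  · subst ht
    have : {o' | (o', t') ∈ insert (o, t') seen} = insert o {o' | (o', t') ∈ seen} := by
      ext; simp
    rw [this, Set.ncard_insert_of_notMem (by simpa using h) (Set.toFinite _),
      Function.update_self, hc]
  · rw [Function.update_of_ne ht, hc]
    congr 1
    ext; simp [ht]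

/-- For `tc_le_of_some`: put-data inserts only values above the committed tag, and every step that
raises the committed tag passes the list through `collect`. -/
theorem EdgeTrans.inv (h : EdgeTrans S j e src msg e' out) (hI : e.Inv S) : e'.Inv S := by
  have hle : S.t₀ ≤ e'.tc := hI.init_le.trans h.tc_le
  obtain ⟨h1, h2, h3, h4, h5⟩ := hI
  cases h
  case putDataNew w t v h =>
    refine ⟨(h1.union (Set.finite_singleton t)).subset ?_, ?_, ?_, h4, hle⟩
    · rintro t' ⟨x, h | h⟩
      · exact Or.inr (Prod.mk.inj h).1
      · exact Or.inl ⟨x, h⟩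
    · exact h2.imp fun x h => Or.inr h
    · rintro t' v' (h | h)
      · obtain ⟨rfl, -⟩ := Prod.mk.inj h
        exact le_of_lt ‹_›
      · exact h3 _ _ h
  case bcastCount o' origin t h hc => exact ⟨h1, h2, h3, counter_insert h4 h, hle⟩
  case bcastAck o' origin t h hL hc ht => exact ⟨h1, h2, h3, counter_insert h4 h, hle⟩
  case bcastCommit o' origin t h hL hc ht =>
    refine ⟨?_, ?_, ?_, counter_insert h4 h, hle⟩
    · simpa only [collect_tag] using h1
    · simpa only [collect_tag] using hL
    · intro t v h
      exact (collect_some.1 h).2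
  case ackCodeDone i t h =>
    refine ⟨(h1.union (Set.finite_singleton t)).subset ?_, ?_, ?_, h4, hle⟩
    · rintro t' ⟨x, h | h⟩
      · exact Or.inl ⟨x, h.1⟩
      · exact Or.inr (Prod.mk.inj h).1
    · obtain ⟨x, h⟩ := h2
      by_cases ht : e.tc = t
      · exact ⟨none, Or.inr (by simp [ht])⟩
      · exact ⟨x, Or.inl ⟨h, ht⟩⟩
    · rintro t' v' (h | h)
      · exact h3 _ _ h.1
      · simp at h
  case putTagValue r q t h hv =>
    refine ⟨?_, ?_, ?_, h4, hle⟩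
    · simpa only [collect_tag] using h1
    · simp only [collect_tag]
      exact ⟨_, hv.choose_spec⟩
    · intro t v h
      exact (collect_some.1 h).2
  case putTagNone r q t h hv =>
    refine ⟨?_, ?_, ?_, h4, hle⟩
    · simp only [collect_tag]
      refine (h1.union (Set.finite_singleton t)).subset ?_
      rintro t' ⟨x, h | h⟩
      · exact Or.inr (Prod.mk.inj h).1
      · exact Or.inl ⟨x, h⟩
    · simp only [collect_tag]
      exact ⟨none, Or.inl rfl⟩
    · intro t v h
      exact (collect_some.1 h).2
  all_goals exact ⟨h1, h2, h3, h4, hle⟩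

end EdgeLocal
end LDS

namespace LDS

/-! ### Local transitions of clients and second-layer servers. -/

section ClientLocal

variable {P : Params} {F W R : Type*} [Zero F] [LinearOrder W]

/-- The message that carries a get-data response of operation `q`. -/
def respMsg (q : ℕ) : DataResp P F W → Msg P F W R
  | .value t v => .dataValue q t v
  | .coded t c => .dataCoded q t c
  | .fail => .dataFail q

/-- The transitions of a writer on the receipt of a message. -/
inductive WTrans (S : System P F W) (w : W) (s : WState P F W) (j : Fin P.n₁) :
    Msg P F W R → WState P F W → Out P F W R → Prop
  | skip (msg) (h1 : ∀ v resp t, s.phase = .getTag v resp → msg ≠ .tagResp s.ops t)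
      (h2 : ∀ t v acks, s.phase = .putData t v acks → msg ≠ .ackWrite t) :
      WTrans S w s j msg s ∅
  | tagMore (v : Value P F) (resp : Set (Fin P.n₁ × Tag W)) (t : Tag W)
      (hs : s.phase = .getTag v resp)
      (h : ¬ P.f₁ + P.k ≤ {j' | ∃ t', (j', t') ∈ insert (j, t) resp}.ncard) :
      WTrans S w s j (.tagResp s.ops t) ⟨s.ops, .getTag v (insert (j, t) resp)⟩ ∅
  | tagDone (v : Value P F) (resp : Set (Fin P.n₁ × Tag W)) (t tw : Tag W)
      (hs : s.phase = .getTag v resp)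
      (h : P.f₁ + P.k ≤ {j' | ∃ t', (j', t') ∈ insert (j, t) resp}.ncard)
      (htw : tw = toLex
        ((ofLex (maxTag S.t₀ {t' | ∃ j', (j', t') ∈ insert (j, t) resp})).1 + 1, w)) :
      WTrans S w s j (.tagResp s.ops t) ⟨s.ops, .putData tw v ∅⟩
        {o | ∃ j', o = (.edge j', .putData tw v)}
  | ackMore (t : Tag W) (v : Value P F) (acks : Set (Fin P.n₁))
      (hs : s.phase = .putData t v acks) (h : ¬ P.f₁ + P.k ≤ (insert j acks).ncard) :
      WTrans S w s j (.ackWrite t) ⟨s.ops, .putData t v (insert j acks)⟩ ∅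
  | ackDone (t : Tag W) (v : Value P F) (acks : Set (Fin P.n₁))
      (hs : s.phase = .putData t v acks) (h : P.f₁ + P.k ≤ (insert j acks).ncard) :
      WTrans S w s j (.ackWrite t) ⟨s.ops, .idle⟩ ∅

theorem wTrans_recv (S : System P F W) (w : W) (s : WState P F W) (j : Fin P.n₁)
    (msg : Msg P F W R) : WTrans S w s j msg (s.recv S w j msg).1 (s.recv S w j msg).2 := by
  obtain ⟨ops, ph⟩ := s
  cases msg <;> cases ph <;> simp only [WState.recv] <;>
    (try exact .skip _ (by simp) (by simp))
  · split_ifs with h1 h2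
    · subst h1
      exact .tagDone _ _ _ _ rfl h2 rfl
    · subst h1
      exact .tagMore _ _ _ rfl h2
    · exact .skip _ (fun _ _ _ _ h => h1 (Msg.tagResp.inj h).1) (by simp)
  · split_ifs with h1 h2
    · subst h1
      exact .ackDone _ _ _ rfl h2
    · subst h1
      exact .ackMore _ _ _ rfl h2
    · refine .skip _ (by simp) ?_
      rintro t v acks h
      cases h
      simpa using h1

/-- The transitions of a reader on the receipt of a message. -/
inductive RTrans (S : System P F W) (s : RState P F W) (j : Fin P.n₁) :
    Msg P F W R → RState P F W → Out P F W R → Prop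
  | skip (msg) (h1 : ∀ resp t, s.phase = .getCommTag resp → msg ≠ .commTagResp s.ops t)
      (h2 : ∀ treq resp x, s.phase = .getData treq resp → msg ≠ respMsg s.ops x)
      (h3 : ∀ t v acks, s.phase = .putTag t v acks → msg ≠ .ackRead s.ops) :
      RTrans S s j msg s ∅
  | tagMore (resp : Set (Fin P.n₁ × Tag W)) (t : Tag W) (hs : s.phase = .getCommTag resp)
      (h : ¬ P.f₁ + P.k ≤ {j' | ∃ t', (j', t') ∈ insert (j, t) resp}.ncard) :
      RTrans S s j (.commTagResp s.ops t) ⟨s.ops, .getCommTag (insert (j, t) resp)⟩ ∅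
  | tagDone (resp : Set (Fin P.n₁ × Tag W)) (t treq : Tag W) (hs : s.phase = .getCommTag resp)
      (h : P.f₁ + P.k ≤ {j' | ∃ t', (j', t') ∈ insert (j, t) resp}.ncard)
      (ht : treq = maxTag S.t₀ {t' | ∃ j', (j', t') ∈ insert (j, t) resp}) :
      RTrans S s j (.commTagResp s.ops t) ⟨s.ops, .getData treq ∅⟩
        {o | ∃ j', o = (.edge j', .queryData s.ops treq)}
  | dataMore (treq : Tag W) (resp : Set (Fin P.n₁ × DataResp P F W)) (x : DataResp P F W)
      (hs : s.phase = .getData treq resp)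
      (h : ¬ (P.f₁ + P.k ≤ {j' | ∃ y, (j', y) ∈ insert (j, x) resp}.ncard ∧
        (availableTags (insert (j, x) resp)).Nonempty)) :
      RTrans S s j (respMsg s.ops x) ⟨s.ops, .getData treq (insert (j, x) resp)⟩ ∅
  | dataDone (treq : Tag W) (resp : Set (Fin P.n₁ × DataResp P F W)) (x : DataResp P F W)
      (t : Tag W) (v : Value P F) (hs : s.phase = .getData treq resp)
      (h : P.f₁ + P.k ≤ {j' | ∃ y, (j', y) ∈ insert (j, x) resp}.ncard ∧
        (availableTags (insert (j, x) resp)).Nonempty)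
      (ht : t = maxTag S.t₀ (availableTags (insert (j, x) resp))) :
      RTrans S s j (respMsg s.ops x) ⟨s.ops, .putTag t v ∅⟩
        {o | ∃ j', o = (.edge j', .putTag s.ops t)}
  | ackMore (t : Tag W) (v : Value P F) (acks : Set (Fin P.n₁))
      (hs : s.phase = .putTag t v acks) (h : ¬ P.f₁ + P.k ≤ (insert j acks).ncard) :
      RTrans S s j (.ackRead s.ops) ⟨s.ops, .putTag t v (insert j acks)⟩ ∅
  | ackDone (t : Tag W) (v : Value P F) (acks : Set (Fin P.n₁))
      (hs : s.phase = .putTag t v acks) (h : P.f₁ + P.k ≤ (insert j acks).ncard) :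
      RTrans S s j (.ackRead s.ops) ⟨s.ops, .idle⟩ ∅

theorem rTrans_recvData (S : System P F W) (s : RState P F W) (j : Fin P.n₁) (q : ℕ)
    (x : DataResp P F W) :
    RTrans S s j (respMsg q x : Msg P F W R) (s.recvData (R := R) S j q x).1
      (s.recvData S j q x).2 := by
  have hskip : (∀ treq resp, s.phase = .getData treq resp → q ≠ s.ops) →
      RTrans S s j (respMsg q x : Msg P F W R) s ∅ := by
    intro h
    refine .skip _ ?_ ?_ ?_
    · intros; cases x <;> simp [respMsg]
    · intro treq resp y hs
      have := h _ _ hs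
      cases x <;> cases y <;> simp [respMsg, this]
    · intros; cases x <;> simp [respMsg]
  obtain ⟨ops, ph⟩ := s
  cases ph <;> simp only [RState.recvData] <;> (try exact hskip (by simp))
  split_ifs with h1 h2
  · subst h1
    exact .dataDone _ _ _ _ _ rfl h2 rfl
  · subst h1
    exact .dataMore _ _ _ rfl h2
  · exact hskip (by simpa using h1)

theorem rTrans_recv (S : System P F W) (s : RState P F W) (j : Fin P.n₁)
    (msg : Msg P F W R) : RTrans S s j msg (s.recv S j msg).1 (s.recv S j msg).2 := by
  cases msg
  case dataValue q t v => exact rTrans_recvData S s j q (.value t v)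
  case dataCoded q t v => exact rTrans_recvData S s j q (.coded t v)
  case dataFail q => exact rTrans_recvData S s j q .fail
  case commTagResp q t =>
    obtain ⟨ops, ph⟩ := s
    have hskip : (∀ resp, ph = .getCommTag resp → q ≠ ops) →
        RTrans S ⟨ops, ph⟩ j (.commTagResp q t : Msg P F W R) ⟨ops, ph⟩ ∅ := by
      intro h
      refine .skip _ ?_ ?_ ?_
      · intro resp t' hs
        simp [h _ hs]
      · intro _ _ x; cases x <;> simp [respMsg]
      · simp
    cases ph <;> simp only [RState.recv] <;> (try exact hskip (by simp))
    split_ifs with h1 h2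
    · subst h1
      exact .tagDone _ _ _ rfl h2 rfl
    · subst h1
      exact .tagMore _ _ rfl h2
    · exact hskip (by simpa using h1)
  case ackRead q =>
    obtain ⟨ops, ph⟩ := s
    have hskip : (∀ t v acks, ph = .putTag t v acks → q ≠ ops) →
        RTrans S ⟨ops, ph⟩ j (.ackRead q : Msg P F W R) ⟨ops, ph⟩ ∅ := by
      intro h
      refine .skip _ ?_ ?_ ?_
      · simp
      · intro _ _ x; cases x <;> simp [respMsg]
      · intro t v acks hs
        simp [h _ _ _ hs]
    cases ph <;> simp only [RState.recv] <;> (try exact hskip (by simp))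
    split_ifs with h1 h2
    · subst h1
      exact .ackDone _ _ _ rfl h2
    · subst h1
      exact .ackMore _ _ _ rfl h2
    · exact hskip (by simpa using h1)
  all_goals
    refine .skip _ (by simp) ?_ (by simp)
    intro _ _ x
    cases x <;> simp [respMsg]

/-- The transitions of a second-layer server. -/
inductive BackTrans (S : System P F W) (i : Fin P.n₂) (b : BackState P F W) (j : Fin P.n₁) :
    Msg P F W R → BackState P F W → Out P F W R → Prop
  | skip (msg) : BackTrans S i b j msg b ∅
  | writeNew (t : Tag W) (c : Coded P F) (h : b.t < t) :
      BackTrans S i b j (.writeCodeElem t c) ⟨t, c⟩ {(.edge j, .ackCodeElem t)}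
  | writeOld (t : Tag W) (c : Coded P F) (h : t ≤ b.t) :
      BackTrans S i b j (.writeCodeElem t c) b {(.edge j, .ackCodeElem t)}
  | query (r : R) (q : ℕ) :
      BackTrans S i b j (.queryCodeElem r q) b {(.edge j, .helperElem r q b.t
        (S.code.helper (Fin.natAdd P.n₁ i) (Fin.castAdd P.n₂ j) b.c))}

theorem backTrans_recv (S : System P F W) (i : Fin P.n₂) (b : BackState P F W) (j : Fin P.n₁)
    (msg : Msg P F W R) : BackTrans S i b j msg (b.recv S i j msg).1 (b.recv S i j msg).2 := by
  cases msg <;> simp only [BackState.recv] <;> (try exact .skip _)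
  · split_ifs with h
    · exact .writeNew _ _ h
    · exact .writeOld _ _ (not_lt.1 h)
  · exact .query _ _

end ClientLocal

/-! ### One step of an execution as seen by a single process. -/

namespace Execution

variable {P : Params} {F W : Type*} [Zero F] [LinearOrder W] {S : System P F W} {R : Type*}
  (E : Execution S R)

/-- An event changes the local state of at most one process, and only that process sends. So an
invariant of a server needs checking only at deliveries to it. The same dichotomy is set up below
for the other kinds of processes, with invocations as an extra case for clients. -/
theorem edge_step (n : ℕ) (s : Fin P.n₁) :
    ((E.config (n + 1)).edge s = (E.config n).edge s ∧ ∀ p ∈ E.sent n, p.src ≠ .edge s) ∨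
    ∃ m src msg out, E.event n = .deliver m ⟨src, .edge s, msg⟩ ∧
      EdgeTrans S s ((E.config n).edge s) src msg ((E.config (n + 1)).edge s) out ∧
      E.sent n = packets (.edge s) out := by
  have hc := E.config_succ n
  unfold sent
  rcases h : E.event n with ⟨w, v⟩ | r | ⟨m, src, dst, msg⟩ | p | _ <;>
    rw [h] at hc <;> simp only [hc]
  · left; simp +contextual [act, packets]
  · left; simp +contextual [act, packets]
  · cases dst with
    | edge s' =>
      by_cases hs : s = s'
      · subst hs
        right
        refine ⟨m, src, msg, (((E.config n).edge s).recv S s src msg).2, rfl, ?_, rfl⟩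
        simp only [act, Function.update_self]
        exact edgeTrans_recv _ _ _ _ _
      · left
        simp +contextual [act, packets, hs, Ne.symm hs]
    | _ => left; cases src <;> simp +contextual [act, packets]
  · left; simp [act]
  · left; simp [act]

theorem back_step (n : ℕ) (i : Fin P.n₂) :
    ((E.config (n + 1)).back i = (E.config n).back i ∧ ∀ p ∈ E.sent n, p.src ≠ .back i) ∨
    ∃ m j msg out, E.event n = .deliver m ⟨.edge j, .back i, msg⟩ ∧
      BackTrans S i ((E.config n).back i) j msg ((E.config (n + 1)).back i) out ∧
      E.sent n = packets (.back i) out := by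
  have hc := E.config_succ n
  unfold sent
  rcases h : E.event n with ⟨w, v⟩ | r | ⟨m, src, dst, msg⟩ | p | _ <;>
    rw [h] at hc <;> simp only [hc]
  · left; simp +contextual [act, packets]
  · left; simp +contextual [act, packets]
  · cases dst with
    | back s' =>
      cases src with
      | edge j =>
        by_cases hs : i = s'
        · subst hs
          right
          refine ⟨m, j, msg, (((E.config n).back i).recv S i j msg).2, rfl, ?_, rfl⟩
          simp only [act, Function.update_self]
          exact backTrans_recv _ _ _ _ _
        · left
          simp +contextual [act, packets, hs, Ne.symm hs]
      | _ => left; simp +contextual [act]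
    | _ => left; cases src <;> simp +contextual [act, packets]
  · left; simp [act]
  · left; simp [act]

theorem writer_step (n : ℕ) (w : W) :
    ((E.config (n + 1)).writer w = (E.config n).writer w ∧ ∀ p ∈ E.sent n, p.src ≠ .writer w) ∨
    (∃ v, E.event n = .invokeWrite w v ∧
      (E.config (n + 1)).writer w = ⟨((E.config n).writer w).ops + 1, .getTag v ∅⟩ ∧
      E.sent n = packets (.writer w)
        {o | ∃ j, o = (.edge j, .queryTag (((E.config n).writer w).ops + 1))}) ∨
    ∃ m j msg out, E.event n = .deliver m ⟨.edge j, .writer w, msg⟩ ∧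
      WTrans S w ((E.config n).writer w) j msg ((E.config (n + 1)).writer w) out ∧
      E.sent n = packets (.writer w) out := by
  have hc := E.config_succ n
  unfold sent
  rcases h : E.event n with ⟨w', v⟩ | r | ⟨m, src, dst, msg⟩ | p | _ <;>
    rw [h] at hc <;> simp only [hc]
  · by_cases hs : w = w'
    · subst hs
      right; left
      exact ⟨v, rfl, by simp [act, WState.invoke], rfl⟩
    · left
      simp +contextual [act, packets, hs, Ne.symm hs]
  · left; simp +contextual [act, packets]
  · cases dst with
    | writer s' =>
      cases src with
      | edge j =>
        by_cases hs : w = s'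
        · subst hs
          right; right
          refine ⟨m, j, msg, (((E.config n).writer w).recv S w j msg).2, rfl, ?_, rfl⟩
          simp only [act, Function.update_self]
          exact wTrans_recv _ _ _ _ _
        · left
          simp +contextual [act, packets, hs, Ne.symm hs]
      | _ => left; simp +contextual [act]
    | _ => left; cases src <;> simp +contextual [act, packets]
  · left; simp [act]
  · left; simp [act]

theorem reader_step (n : ℕ) (r : R) :
    ((E.config (n + 1)).reader r = (E.config n).reader r ∧ ∀ p ∈ E.sent n, p.src ≠ .reader r) ∨
    (E.event n = .invokeRead r ∧
      (E.config (n + 1)).reader r = ⟨((E.config n).reader r).ops + 1, .getCommTag ∅⟩ ∧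
      E.sent n = packets (.reader r)
        {o | ∃ j, o = (.edge j, .queryCommTag (((E.config n).reader r).ops + 1))}) ∨
    ∃ m j msg out, E.event n = .deliver m ⟨.edge j, .reader r, msg⟩ ∧
      RTrans S ((E.config n).reader r) j msg ((E.config (n + 1)).reader r) out ∧
      E.sent n = packets (.reader r) out := by
  have hc := E.config_succ n
  unfold sent
  rcases h : E.event n with ⟨w', v⟩ | r' | ⟨m, src, dst, msg⟩ | p | _ <;>
    rw [h] at hc <;> simp only [hc]
  · left; simp +contextual [act, packets]
  · by_cases hs : r = r'
    · subst hs
      right; left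
      exact ⟨rfl, by simp [act, RState.invoke], rfl⟩
    · left
      simp +contextual [act, packets, hs, Ne.symm hs]
  · cases dst with
    | reader s' =>
      cases src with
      | edge j =>
        by_cases hs : r = s'
        · subst hs
          right; right
          refine ⟨m, j, msg, (((E.config n).reader r).recv S j msg).2, rfl, ?_, rfl⟩
          simp only [act, Function.update_self]
          exact rTrans_recv _ _ _ _
        · left
          simp +contextual [act, packets, hs, Ne.symm hs]
      | _ => left; simp +contextual [act]
    | _ => left; cases src <;> simp +contextual [act, packets]
  · left; simp [act]
  · left; simp [act]

theorem sent_edge {n : ℕ} {s : Fin P.n₁} {dst : Proc P W R} {msg' : Msg P F W R}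
    (h : ⟨.edge s, dst, msg'⟩ ∈ E.sent n) :
    ∃ m src msg out, E.event n = .deliver m ⟨src, .edge s, msg⟩ ∧
      EdgeTrans S s ((E.config n).edge s) src msg ((E.config (n + 1)).edge s) out ∧
      (dst, msg') ∈ out := by
  rcases E.edge_step n s with ⟨-, h'⟩ | ⟨m, src, msg, out, hev, htr, hs⟩
  · exact absurd rfl (h' _ h)
  · rw [hs] at h
    exact ⟨m, src, msg, out, hev, htr, h.2⟩

theorem sent_back {n : ℕ} {i : Fin P.n₂} {dst : Proc P W R} {msg' : Msg P F W R}
    (h : ⟨.back i, dst, msg'⟩ ∈ E.sent n) :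
    ∃ m j msg out, E.event n = .deliver m ⟨.edge j, .back i, msg⟩ ∧
      BackTrans S i ((E.config n).back i) j msg ((E.config (n + 1)).back i) out ∧
      (dst, msg') ∈ out := by
  rcases E.back_step n i with ⟨-, h'⟩ | ⟨m, src, msg, out, hev, htr, hs⟩
  · exact absurd rfl (h' _ h)
  · rw [hs] at h
    exact ⟨m, src, msg, out, hev, htr, h.2⟩

theorem mem_sent_of_deliver {n m : ℕ} {p : Packet P F W R} (h : E.event n = .deliver m p) :
    m < n ∧ p ∈ E.sent m :=
  ⟨(E.deliver_ok n m p h).1, (E.deliver_ok n m p h).2.1⟩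

theorem sent_deliver_edge {n m : ℕ} {s : Fin P.n₁} {src : Proc P W R} {msg : Msg P F W R}
    (h : E.event n = .deliver m ⟨src, .edge s, msg⟩) :
    E.sent n = packets (.edge s) (((E.config n).edge s).recv S s src msg).2 := by
  unfold sent
  rw [h]
  rfl

theorem sent_deliver_back {n m : ℕ} {i : Fin P.n₂} {j : Fin P.n₁} {msg : Msg P F W R}
    (h : E.event n = .deliver m ⟨.edge j, .back i, msg⟩) :
    E.sent n = packets (.back i) (((E.config n).back i).recv S i j msg).2 := by
  unfold sent
  rw [h]
  rfl

theorem edge_deliver {n m : ℕ} {s : Fin P.n₁} {src : Proc P W R} {msg : Msg P F W R}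
    (h : E.event n = .deliver m ⟨src, .edge s, msg⟩) :
    (E.config (n + 1)).edge s = (((E.config n).edge s).recv S s src msg).1 := by
  rw [E.config_succ n, h]
  simp [act]

theorem writer_deliver {n m : ℕ} {w : W} {j : Fin P.n₁} {msg : Msg P F W R}
    (h : E.event n = .deliver m ⟨.edge j, .writer w, msg⟩) :
    (E.config (n + 1)).writer w = (((E.config n).writer w).recv S w j msg).1 := by
  rw [E.config_succ n, h]
  simp [act]

theorem reader_deliver {n m : ℕ} {r : R} {j : Fin P.n₁} {msg : Msg P F W R}
    (h : E.event n = .deliver m ⟨.edge j, .reader r, msg⟩) :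
    (E.config (n + 1)).reader r = (((E.config n).reader r).recv S j msg).1 := by
  rw [E.config_succ n, h]
  simp [act]

/-! ### Crashes and delays -/

theorem crashed_iff (n : ℕ) (p : Proc P W R) :
    p ∈ (E.config n).crashed ↔ ∃ m < n, E.event m = .crash p := by
  induction n with
  | zero => simp [E.config_zero, initConfig]
  | succ n ih =>
    have hc : (E.config (n + 1)).crashed =
        {p | p ∈ (E.config n).crashed ∨ E.event n = .crash p} := by
      rw [E.config_succ n]
      rcases h : E.event n with ⟨w, v⟩ | r | ⟨m, src, dst, msg⟩ | p | _
      · simp [act]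
      · simp [act]
      · cases dst <;> cases src <;> simp [act]
      · ext x
        simp [act, eq_comm, or_comm]
      · simp [act]
    rw [hc, Set.mem_ofPred_eq, ih]
    constructor
    · rintro (⟨m, hm, h⟩ | h)
      · exact ⟨m, by omega, h⟩
      · exact ⟨n, by omega, h⟩
    · rintro ⟨m, hm, h⟩
      rcases Nat.lt_succ_iff_lt_or_eq.1 hm with hm | rfl
      · exact Or.inl ⟨m, hm, h⟩
      · exact Or.inr h

theorem not_crash_of_deliver {n m : ℕ} {p : Packet P F W R} (h : E.event n = .deliver m p)
    {n' : ℕ} (hn : n' ≤ n) : E.event n' ≠ .crash p.dst := by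
  intro h'
  rcases hn.lt_or_eq with hn | rfl
  · exact (E.deliver_ok n m p h).2.2 ((E.crashed_iff _ _).2 ⟨n', hn, h'⟩)
  · rw [h] at h'
    cases h'

variable {E} {τ₀ τ₁ τ₂ : ℝ}

/-- The latency assumption allows a crash in place of a timely delivery. A late delivery would come
after such a crash, but crashed processes receive nothing. -/
theorem BoundedLatency.deliver_le (hτ : E.BoundedLatency τ₀ τ₁ τ₂) {n m : ℕ}
    {p : Packet P F W R} (h : E.event n = .deliver m p) :
    E.time n ≤ E.time m + linkBound τ₀ τ₁ τ₂ p.src p.dst := by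
  obtain ⟨n', hle, h' | h'⟩ := hτ m p (E.mem_sent_of_deliver h).2
  · rwa [E.deliver_once n n' m p h h']
  · by_contra hlt
    push Not at hlt
    have hn : n' < n := by
      by_contra hge
      exact absurd (E.time_mono (not_lt.1 hge)) (not_le.2 (hle.trans_lt hlt))
    exact E.not_crash_of_deliver h hn.le h'

/-- A packet to a process that receives something in a late step `j` is delivered before. -/
theorem BoundedLatency.delivered (hτ : E.BoundedLatency τ₀ τ₁ τ₂) {m j : ℕ}
    {p : Packet P F W R} (hp : p ∈ E.sent m) (hlive : ∀ n < j, E.event n ≠ .crash p.dst)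
    (hj : E.time m + linkBound τ₀ τ₁ τ₂ p.src p.dst < E.time j) :
    ∃ n, m < n ∧ n < j ∧ E.time n ≤ E.time m + linkBound τ₀ τ₁ τ₂ p.src p.dst ∧
      E.event n = .deliver m p := by
  obtain ⟨n, hle, h⟩ := hτ m p hp
  have hn : n < j := by
    by_contra hge
    exact absurd (E.time_mono (not_lt.1 hge)) (not_le.2 (hle.trans_lt hj))
  rcases h with h | h
  · exact ⟨n, (E.mem_sent_of_deliver h).1, hn, hle, h⟩
  · exact absurd h (hlive n hn)

theorem BoundedLatency.delivered_of_live (hτ : E.BoundedLatency τ₀ τ₁ τ₂) {m : ℕ}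
    {p : Packet P F W R} (hp : p ∈ E.sent m) (hlive : ∀ n, E.event n ≠ .crash p.dst) :
    ∃ n, m < n ∧ E.time n ≤ E.time m + linkBound τ₀ τ₁ τ₂ p.src p.dst ∧
      E.event n = .deliver m p := by
  obtain ⟨n, hle, h | h⟩ := hτ m p hp
  · exact ⟨n, (E.mem_sent_of_deliver h).1, hle, h⟩
  · exact absurd h (hlive n)

variable (E)

/-- The first-layer servers that never crash. -/
def liveEdges : Set (Fin P.n₁) := {s | ∀ n, E.event n ≠ .crash (.edge s)}

/-- The second-layer servers that never crash. -/
def liveBacks : Set (Fin P.n₂) := {i | ∀ n, E.event n ≠ .crash (.back i)}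

variable {E}

theorem FewCrashes.edges (hE : E.FewCrashes) : P.n₁ ≤ E.liveEdges.ncard + P.f₁ := by
  have h := Set.ncard_add_ncard_compl E.liveEdges
  have h' : E.liveEdgesᶜ = {j : Fin P.n₁ | ∃ n, E.event n = .crash (.edge j)} := by
    ext; simp [liveEdges]
  rw [h', Nat.card_eq_fintype_card, Fintype.card_fin] at h
  have := hE.1
  omega

theorem FewCrashes.backs (hE : E.FewCrashes) : P.n₂ ≤ E.liveBacks.ncard + P.f₂ := by
  have h := Set.ncard_add_ncard_compl E.liveBacks
  have h' : E.liveBacksᶜ = {j : Fin P.n₂ | ∃ n, E.event n = .crash (.back j)} := by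
    ext; simp [liveBacks]
  rw [h', Nat.card_eq_fintype_card, Fintype.card_fin] at h
  have := hE.2
  omega

/-- There are `f₁ + 1` relays and at most `f₁` crashes. -/
theorem FewCrashes.exists_relay (hE : E.FewCrashes) : ∃ ρ ∈ S.relays, ρ ∈ E.liveEdges := by
  by_contra! h
  have h1 : (S.relays : Set (Fin P.n₁)) ⊆ {j | ∃ n, E.event n = .crash (.edge j)} := by
    intro ρ hρ
    have := h ρ hρ
    simpa [liveEdges] using this
  have h2 := Set.ncard_le_ncard h1 (Set.toFinite _)
  rw [Set.ncard_coe_finset, S.relays_card] at h2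
  have := hE.1
  omega

end Execution
end LDS

/-! ### Invariants and monotone quantities along an execution. -/

namespace LDS
namespace Execution

variable {P : Params} {F W : Type*} [Zero F] [LinearOrder W] {S : System P F W} {R : Type*}
  (E : Execution S R)

theorem edge_inv (n : ℕ) (s : Fin P.n₁) : ((E.config n).edge s).Inv S := by
  induction n with
  | zero =>
    rw [E.config_zero]
    refine ⟨?_, ?_, ?_, ?_, le_rfl⟩
    · refine (Set.finite_singleton S.t₀).subset ?_
      rintro t ⟨x, h⟩
      exact (Prod.mk.inj h).1
    · exact ⟨none, rfl⟩
    · rintro t v h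
      simp [initConfig] at h
    · intro t
      simp [initConfig]
  | succ n ih =>
    rcases E.edge_step n s with ⟨h, -⟩ | ⟨m, src, msg, out, -, h, -⟩
    · rwa [h]
    · exact h.inv ih

theorem tc_mono (s : Fin P.n₁) : Monotone fun n => ((E.config n).edge s).tc := by
  refine monotone_nat_of_le_succ fun n => ?_
  rcases E.edge_step n s with ⟨h, -⟩ | ⟨m, src, msg, out, -, h, -⟩
  · exact (congrArg EdgeState.tc h).ge
  · exact h.tc_le

theorem seen_mono (s : Fin P.n₁) : Monotone fun n => ((E.config n).edge s).seen := by
  refine monotone_nat_of_le_succ fun n => ?_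
  rcases E.edge_step n s with ⟨h, -⟩ | ⟨m, src, msg, out, -, h, -⟩
  · exact (congrArg EdgeState.seen h).ge
  · exact h.seen_subset

theorem tag_mono (s : Fin P.n₁) {m n : ℕ} (hmn : m ≤ n) {t : Tag W}
    (h : ∃ x, (t, x) ∈ ((E.config m).edge s).L) : ∃ x, (t, x) ∈ ((E.config n).edge s).L := by
  induction n, hmn using Nat.le_induction with
  | base => exact h
  | succ n _ ih =>
    rcases E.edge_step n s with ⟨h, -⟩ | ⟨m, src, msg, out, -, h, -⟩
    · rwa [h]
    · exact h.tag_mem ih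

theorem back_mono (i : Fin P.n₂) : Monotone fun n => ((E.config n).back i).t := by
  refine monotone_nat_of_le_succ fun n => ?_
  rcases E.back_step n i with ⟨h, -⟩ | ⟨m, j, msg, out, -, h, -⟩
  · exact (congrArg BackState.t h).ge
  · generalize (E.config (n + 1)).back i = b' at h
    cases h <;> first | exact le_rfl | exact le_of_lt ‹_›

theorem writer_ops_mono (w : W) : Monotone fun n => ((E.config n).writer w).ops := by
  refine monotone_nat_of_le_succ fun n => ?_
  rcases E.writer_step n w with ⟨h, -⟩ | ⟨v, -, h, -⟩ | ⟨m, j, msg, out, -, h, -⟩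
  · exact (congrArg WState.ops h).ge
  · simp only [h]; omega
  · generalize (E.config (n + 1)).writer w = b' at h
    cases h <;> exact le_rfl

theorem reader_ops_mono (r : R) : Monotone fun n => ((E.config n).reader r).ops := by
  refine monotone_nat_of_le_succ fun n => ?_
  rcases E.reader_step n r with ⟨h, -⟩ | ⟨-, h, -⟩ | ⟨m, j, msg, out, -, h, -⟩
  · exact (congrArg RState.ops h).ge
  · simp only [h]; omega
  · generalize (E.config (n + 1)).reader r = b' at h
    cases h <;> exact le_rfl

/-! ### Where messages come from -/

theorem queryTag_sent {n q : ℕ} {w : W} {dst : Proc P W R}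
    (h : ⟨.writer w, dst, .queryTag q⟩ ∈ E.sent n) : ((E.config (n + 1)).writer w).ops = q := by
  rcases E.writer_step n w with ⟨-, h'⟩ | ⟨v, -, h', hs⟩ | ⟨m, j, msg, out, -, h', hs⟩
  · exact absurd rfl (h' _ h)
  · rw [hs] at h
    obtain ⟨-, j, hj⟩ := h
    cases hj
    rw [h']
  · rw [hs] at h
    have h := h.2
    generalize (E.config (n + 1)).writer w = b' at h'
    cases h' <;> simp at h

theorem tagResp_sent {n q : ℕ} {s : Fin P.n₁} {w : W} {t : Tag W}
    (h : ⟨.edge s, .writer w, .tagResp q t⟩ ∈ E.sent n) :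
    (∃ m, E.event n = .deliver m ⟨.writer w, .edge s, .queryTag q⟩) ∧
      t = maxTag S.t₀ {t | ∃ x, (t, x) ∈ ((E.config n).edge s).L} := by
  obtain ⟨m, src, msg, out, hev, htr, ho⟩ := E.sent_edge h
  generalize (E.config (n + 1)).edge s = e' at htr
  cases htr <;> simp [ackWriter, serve, writeToL2] at ho
  obtain ⟨rfl, rfl, rfl⟩ := ho
  exact ⟨⟨m, hev⟩, rfl⟩

/-- The writer sends query `q` when its operation count becomes `q`, and the answer is computed
later. Hence an answer carrying the current number reflects a list no older than the current
operation. -/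
theorem tagResp_origin {n m q : ℕ} {s : Fin P.n₁} {w : W} {t : Tag W}
    (h : E.event n = .deliver m ⟨.edge s, .writer w, .tagResp q t⟩) :
    m < n ∧ q ≤ ((E.config m).writer w).ops ∧
      t = maxTag S.t₀ {t | ∃ x, (t, x) ∈ ((E.config m).edge s).L} := by
  obtain ⟨hmn, hp⟩ := E.mem_sent_of_deliver h
  obtain ⟨⟨l, hl⟩, ht⟩ := E.tagResp_sent hp
  obtain ⟨hlm, hp'⟩ := E.mem_sent_of_deliver hl
  refine ⟨hmn, ?_, ht⟩
  rw [← E.queryTag_sent hp']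
  exact E.writer_ops_mono w hlm

theorem putData_sent {n : ℕ} {w : W} {dst : Proc P W R} {t : Tag W} {v : Value P F}
    (h : ⟨.writer w, dst, .putData t v⟩ ∈ E.sent n) :
    ∃ m j resp t', E.event n =
        .deliver m ⟨.edge j, .writer w, .tagResp ((E.config n).writer w).ops t'⟩ ∧
      ((E.config n).writer w).phase = .getTag v resp ∧
      (E.config (n + 1)).writer w = ⟨((E.config n).writer w).ops, .putData t v ∅⟩ ∧
      P.f₁ + P.k ≤ {j' | ∃ t'', (j', t'') ∈ insert (j, t') resp}.ncard ∧
      t = toLex ((ofLex (maxTag S.t₀ {t'' | ∃ j', (j', t'') ∈ insert (j, t') resp})).1 + 1, w) ∧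
      ∀ s : Fin P.n₁, ⟨.writer w, .edge s, .putData t v⟩ ∈ E.sent n := by
  rcases E.writer_step n w with ⟨-, h'⟩ | ⟨v, -, h', hs⟩ | ⟨m, j, msg, out, hev, h', hs⟩
  · exact absurd rfl (h' _ h)
  · rw [hs] at h
    obtain ⟨-, j, hj⟩ := h
    cases hj
  · rw [hs] at h ⊢
    have h := h.2
    generalize (E.config (n + 1)).writer w = b' at h' ⊢
    cases h' <;> simp at h
    case tagDone v' resp t' tw hph hq htw _ =>
      obtain ⟨-, rfl, rfl⟩ := h
      exact ⟨m, j, resp, t', hev, hph, rfl, hq, htw, fun s => ⟨rfl, s, rfl⟩⟩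

/-- Server `o` receives tag `t` from a writer in step `a`. -/
def RecvPut (o : Fin P.n₁) (t : Tag W) (a : ℕ) : Prop :=
  ∃ l w v, E.event a = .deliver l ⟨.writer w, .edge o, .putData t v⟩

/-- Consumed broadcasts and copies in transit arise from each other, so both claims go through one
induction. Only the put-data handler creates a copy from nothing, and it names its own server as
origin. -/
theorem seen_commit_origin (n : ℕ) :
    (∀ (s o : Fin P.n₁) (t : Tag W), (o, t) ∈ ((E.config n).edge s).seen →
      ∃ a < n, E.RecvPut o t a) ∧
    (∀ m < n, ∀ (s o : Fin P.n₁) (t : Tag W) (dst : Proc P W R),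
      ⟨.edge s, dst, .commitTag o t⟩ ∈ E.sent m → ∃ a < n, E.RecvPut o t a) := by
  induction n with
  | zero =>
    refine ⟨fun s o t h => ?_, fun m hm => absurd hm (Nat.not_lt_zero m)⟩
    rw [E.config_zero] at h
    exact absurd h (Set.notMem_empty _)
  | succ n ih =>
    have aux : ∀ (o : Fin P.n₁) (t : Tag W), (∃ a < n, E.RecvPut o t a) →
      ∃ a < n + 1, E.RecvPut o t a := fun o t ⟨a, ha, h⟩ => ⟨a, by omega, h⟩
    have hdel : ∀ (s s' o : Fin P.n₁) (t : Tag W) (m : ℕ),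
        E.event n = .deliver m ⟨.edge s, .edge s', .commitTag o t⟩ →
        ∃ a < n, E.RecvPut o t a := fun s s' o t m h =>
      ih.2 m (E.mem_sent_of_deliver h).1 _ _ _ _ (E.mem_sent_of_deliver h).2
    constructor
    · intro s o t h
      rcases E.edge_step n s with ⟨h', -⟩ | ⟨m, src, msg, out, hev, htr, -⟩
      · rw [h'] at h
        exact aux _ _ (ih.1 _ _ _ h)
      · generalize (E.config (n + 1)).edge s = e' at htr h
        cases htr <;> try exact aux _ _ (ih.1 _ _ _ h)
        all_goals
          rcases h with h | h
          · cases h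
            exact aux _ _ (hdel _ _ _ _ _ hev)
          · exact aux _ _ (ih.1 _ _ _ h)
    · intro m hm s o t dst h
      rcases Nat.lt_succ_iff_lt_or_eq.1 hm with hm | rfl
      · exact aux _ _ (ih.2 _ hm _ _ _ _ h)
      · obtain ⟨l, src, msg, out, hev, htr, ho⟩ := E.sent_edge h
        generalize (E.config (m + 1)).edge s = e' at htr
        cases htr <;> simp [ackWriter, serve, writeToL2] at ho
        · obtain ⟨j', -, -, rfl, rfl⟩ := ho
          exact ⟨m, by omega, l, _, _, hev⟩
        · obtain ⟨j', -, -, rfl, rfl⟩ := ho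
          exact ⟨m, by omega, l, _, _, hev⟩
        · obtain ⟨-, -, rfl, rfl⟩ := ho
          exact aux _ _ (hdel _ _ _ _ _ hev)
        · obtain ⟨-, -, rfl, rfl⟩ := ho
          exact aux _ _ (hdel _ _ _ _ _ hev)
        · obtain ⟨-, -, rfl, rfl⟩ := ho
          exact aux _ _ (hdel _ _ _ _ _ hev)

theorem exists_recvPut_of_seen {n : ℕ} {s o : Fin P.n₁} {t : Tag W}
    (h : (o, t) ∈ ((E.config n).edge s).seen) : ∃ a < n, E.RecvPut o t a :=
  (E.seen_commit_origin n).1 _ _ _ h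

theorem exists_recvPut_of_commitTag {n m : ℕ} {s s' o : Fin P.n₁} {t : Tag W}
    (h : E.event n = .deliver m ⟨.edge s, .edge s', .commitTag o t⟩) :
    ∃ a < n, E.RecvPut o t a :=
  (E.seen_commit_origin n).2 m (E.mem_sent_of_deliver h).1 _ _ _ _ (E.mem_sent_of_deliver h).2

variable {E} in
/-- Server `s` has a tag at least `t` in its list. -/
def HasGe (s : Fin P.n₁) (t : Tag W) (n : ℕ) : Prop :=
  ∃ t', t ≤ t' ∧ ∃ x, (t', x) ∈ ((E.config n).edge s).L

variable {E} in
theorem HasGe.mono {s : Fin P.n₁} {t : Tag W} {m n : ℕ} (h : E.HasGe s t m) (hmn : m ≤ n) :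
    E.HasGe s t n :=
  h.imp fun _ h => ⟨h.1, E.tag_mono s hmn h.2⟩

/-- A server acknowledges either because the tag is at most its committed tag, which is itself
listed, or because the tag is listed. The trigger is a put-data message or a broadcast that goes
back to one. -/
theorem ackWrite_sent {n : ℕ} {s : Fin P.n₁} {dst : Proc P W R} {t : Tag W}
    (h : ⟨.edge s, dst, .ackWrite t⟩ ∈ E.sent n) :
    dst = .writer (ofLex t).2 ∧ E.HasGe s t n ∧ ∃ o, ∃ a ≤ n, E.RecvPut o t a := by
  obtain ⟨m, src, msg, out, hev, htr, ho⟩ := E.sent_edge h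
  generalize (E.config (n + 1)).edge s = e' at htr
  have hb : ∀ {o' o : Fin P.n₁} {t' : Tag W},
      E.event n = .deliver m ⟨.edge o', .edge s, .commitTag o t'⟩ →
      ∃ o, ∃ a ≤ n, E.RecvPut o t' a := fun h =>
    (E.exists_recvPut_of_commitTag h).elim fun a h => ⟨_, a, h.1.le, h.2⟩
  cases htr <;> simp [ackWriter, serve, writeToL2] at ho
  case putDataOld w t' v h' =>
    obtain ⟨rfl, rfl⟩ := ho
    exact ⟨rfl, ⟨_, h', (E.edge_inv n s).tc_mem⟩, s, n, le_rfl, m, _, _, hev⟩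
  case bcastAck o' origin t' hn hL hc h' =>
    obtain ⟨rfl, rfl⟩ := ho
    exact ⟨rfl, ⟨_, le_rfl, hL⟩, hb hev⟩
  case bcastCommit o' origin t' hn hL hc h' =>
    obtain ⟨rfl, rfl⟩ := ho
    exact ⟨rfl, ⟨_, le_rfl, hL⟩, hb hev⟩

/-! ### Tags of writes are unique -/

/-- The phase ends in the very step that completes a quorum, so an open phase is below it; `0 < P.k`
makes the quorum size positive for the empty initial set. The first and last clauses serve the
uniqueness of tags. -/
theorem getTag_inv (w : W) (n : ℕ) {v : Value P F} {resp : Set (Fin P.n₁ × Tag W)}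
    (h : ((E.config n).writer w).phase = .getTag v resp) :
    resp.Finite ∧ (0 < P.k → {j' | ∃ t', (j', t') ∈ resp}.ncard < P.f₁ + P.k) ∧
      ∀ p ∈ resp, ∃ m < n, ((E.config n).writer w).ops ≤ ((E.config m).writer w).ops ∧
        p.2 = maxTag S.t₀ {t | ∃ x, (t, x) ∈ ((E.config m).edge p.1).L} := by
  induction n generalizing v resp with
  | zero =>
    rw [E.config_zero] at h
    simp [initConfig] at h
  | succ n ih =>
    have aux : ∀ {v resp}, ((E.config n).writer w).phase = .getTag v resp →
        ∀ p ∈ resp, ∃ m < n + 1, ((E.config n).writer w).ops ≤ ((E.config m).writer w).ops ∧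
          p.2 = maxTag S.t₀ {t | ∃ x, (t, x) ∈ ((E.config m).edge p.1).L} := by
      intro v resp h p hp
      obtain ⟨m, hm, h⟩ := (ih h).2.2 p hp
      exact ⟨m, by omega, h⟩
    rcases E.writer_step n w with ⟨h', -⟩ | ⟨v, -, h', hs⟩ | ⟨m, j, msg, out, hev, h', hs⟩
    · rw [h'] at h ⊢
      exact ⟨(ih h).1, (ih h).2.1, aux h⟩
    · rw [h'] at h
      cases h
      simp
      omega
    · generalize (E.config (n + 1)).writer w = b' at h h' ⊢
      cases h'
      case skip => exact ⟨(ih h).1, (ih h).2.1, aux h⟩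
      case tagMore v' resp' t hph hlt =>
        cases h
        refine ⟨(ih hph).1.insert _, fun _ => not_le.1 hlt, ?_⟩
        rintro p (rfl | hp)
        · obtain ⟨h1, h2, h3⟩ := E.tagResp_origin hev
          exact ⟨m, by omega, h2, h3⟩
        · exact aux hph p hp
      all_goals cases h

theorem putData_inv (w : W) (n : ℕ) {t : Tag W} {v : Value P F} {acks : Set (Fin P.n₁)}
    (h : ((E.config n).writer w).phase = .putData t v acks) :
    (0 < P.k → acks.ncard < P.f₁ + P.k) ∧ ∀ j ∈ acks, E.HasGe j t n := by
  induction n generalizing t v acks with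
  | zero =>
    rw [E.config_zero] at h
    simp [initConfig] at h
  | succ n ih =>
    have aux : ∀ {t v acks}, ((E.config n).writer w).phase = .putData t v acks →
        ∀ j ∈ acks, E.HasGe j t (n + 1) :=
      fun h j hj => ((ih h).2 j hj).mono (Nat.le_succ n)
    rcases E.writer_step n w with ⟨h', -⟩ | ⟨v, -, h', hs⟩ | ⟨m, j, msg, out, hev, h', hs⟩
    · rw [h'] at h
      exact ⟨(ih h).1, aux h⟩
    · rw [h'] at h
      cases h
    · generalize (E.config (n + 1)).writer w = b' at h h'
      cases h'
      case skip => exact ⟨(ih h).1, aux h⟩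
      case ackMore t' v' acks' hph hlt =>
        cases h
        refine ⟨fun _ => not_le.1 hlt, ?_⟩
        rintro p (rfl | hp)
        · obtain ⟨h1, h2⟩ := E.mem_sent_of_deliver hev
          exact (E.ackWrite_sent h2).2.1.mono (by omega)
        · exact aux hph p hp
      case tagDone =>
        cases h
        simp
        omega
      all_goals cases h

/-- The last step at which a property still holds. -/
theorem exists_last {p : ℕ → Prop} {a b : ℕ} (hab : a ≤ b) (ha : p a) (hb : ¬ p b) :
    ∃ n, a ≤ n ∧ n < b ∧ (∀ m, a ≤ m → m ≤ n → p m) ∧ ¬ p (n + 1) := by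
  classical
  have hex : ∃ n, a ≤ n ∧ ¬ p n := ⟨b, hab, hb⟩
  have h1 := Nat.find_spec hex
  have h2 : Nat.find hex ≠ a := fun h => by rw [h] at h1; exact h1.2 ha
  have h3 := Nat.find_min' hex ⟨hab, hb⟩
  refine ⟨Nat.find hex - 1, by omega, by omega, fun m hm hm' => ?_, ?_⟩
  · by_contra hp
    have := Nat.find_min' hex ⟨hm, hp⟩
    omega
  · rw [Nat.sub_add_cancel (by omega)]
    exact h1.2

theorem inter_nonempty_of_quorums {ι : Type*} [Fintype ι] {A B : Set ι}
    (h : Fintype.card ι < A.ncard + B.ncard) : (A ∩ B).Nonempty := by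
  rw [Set.nonempty_iff_ne_empty, Ne, ← Set.disjoint_iff_inter_eq_empty]
  intro hd
  have h1 := Set.ncard_union_eq hd (Set.toFinite _) (Set.toFinite _)
  have h2 := Set.ncard_le_ncard (Set.subset_univ (A ∪ B)) (Set.toFinite _)
  rw [Set.ncard_univ, Nat.card_eq_fintype_card] at h2
  omega

/-- Quorum intersection. Before sending put-data again, the writer has collected `f₁ + k`
acknowledgments, each from a server listing a tag at least `t`. Its next tag query hears from `f₁ +
k` servers, and `2(f₁ + k) > n₁` as `k > 0`. A common server reports a tag at least `t`, so the new
tag is strictly higher. -/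
theorem putData_lt (hk : 0 < P.k) {G G' : ℕ} {w : W} {dst dst' : Proc P W R} {t : Tag W}
    {v v' : Value P F} (h : ⟨.writer w, dst, .putData t v⟩ ∈ E.sent G)
    (h' : ⟨.writer w, dst', .putData t v'⟩ ∈ E.sent G') : ¬ G < G' := by
  intro hlt
  obtain ⟨_, _, _, _, _, _, hG, _⟩ := E.putData_sent h
  obtain ⟨m', j', resp, t', hev', hph', -, hq', ht', -⟩ := E.putData_sent h'
  obtain ⟨n, hGn, hnG', hall, hn⟩ := exists_last
    (p := fun n => ∃ acks, ((E.config n).writer w).phase = .putData t v acks)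
    (show G + 1 ≤ G' from hlt) ⟨∅, by rw [hG]⟩ (by rw [hph']; simp)
  obtain ⟨acks, hacks⟩ := hall n hGn le_rfl
  -- `Q` is the set of acknowledging servers at step `n`, where the earlier put-data phase ends.
  obtain ⟨Q, hQ, hQge, hidle, hops⟩ : ∃ Q : Set (Fin P.n₁), P.f₁ + P.k ≤ Q.ncard ∧
      (∀ j ∈ Q, E.HasGe j t (n + 1)) ∧ ((E.config (n + 1)).writer w).phase = .idle ∧
      ((E.config (n + 1)).writer w).ops = ((E.config n).writer w).ops := by
    rcases E.writer_step n w with ⟨hs, -⟩ | ⟨v, hs, -⟩ | ⟨m, j, msg, out, hev, hs, -⟩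
    · exact absurd ⟨acks, by rw [hs, hacks]⟩ hn
    · have := (E.invokeWrite_ok _ _ _ hs).2
      rw [hacks] at this
      cases this
    · generalize hb : (E.config (n + 1)).writer w = b' at hs hn ⊢
      cases hs
      case ackDone t1 v1 acks1 hph hq =>
        rw [hacks] at hph
        cases hph
        refine ⟨_, hq, ?_, rfl, rfl⟩
        rintro p (rfl | hp)
        · obtain ⟨h1, h2⟩ := E.mem_sent_of_deliver hev
          exact (E.ackWrite_sent h2).2.1.mono (by omega)
        · exact ((E.putData_inv w n hacks).2 p hp).mono (Nat.le_succ n)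
      case skip => exact absurd ⟨acks, hacks⟩ hn
      case ackMore t1 v1 acks1 hph hq =>
        rw [hacks] at hph
        cases hph
        exact absurd ⟨_, rfl⟩ hn
      case tagMore _ _ _ hph _ => rw [hacks] at hph; cases hph
      case tagDone _ _ _ _ hph _ _ => rw [hacks] at hph; cases hph
  -- Leaving `idle` takes an invocation, which raises `ops`. This separates answers to the later
  -- operation from older ones.
  have hlater : ∀ m, n + 1 ≤ m →
      (((E.config m).writer w).phase = .idle ∨
        ((E.config n).writer w).ops < ((E.config m).writer w).ops) := by
    intro m hm
    induction m, hm using Nat.le_induction with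
    | base => exact Or.inl hidle
    | succ m hm ih =>
      have hmono := E.writer_ops_mono w (show n ≤ m by omega)
      rcases E.writer_step m w with ⟨hs, -⟩ | ⟨v, hs, hs', -⟩ | ⟨l, j, msg, out, hev, hs, -⟩
      · rwa [hs]
      · right
        rw [hs']
        exact Nat.lt_succ_of_le hmono
      · rcases ih with ih | ih
        · left
          generalize (E.config (m + 1)).writer w = b' at hs ⊢
          cases hs <;> simp_all
        · right
          exact ih.trans_le (E.writer_ops_mono w (Nat.le_succ _))
  have hopsG' : ((E.config n).writer w).ops < ((E.config G').writer w).ops := by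
    rcases hlater G' hnG' with h | h
    · rw [hph'] at h
      cases h
    · exact h
  obtain ⟨hfin, -, hresp⟩ := E.getTag_inv w G' hph'
  have hresp' : ∀ p ∈ insert (j', t') resp, ∃ m, ((E.config G').writer w).ops ≤
      ((E.config m).writer w).ops ∧
        p.2 = maxTag S.t₀ {t | ∃ x, (t, x) ∈ ((E.config m).edge p.1).L} := by
    rintro p (rfl | hp)
    · obtain ⟨h1, h2, h3⟩ := E.tagResp_origin hev'
      exact ⟨m', h2, h3⟩
    · obtain ⟨m, -, h2, h3⟩ := hresp p hp
      exact ⟨m, h2, h3⟩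
  obtain ⟨x, hxQ, t'', hx⟩ := inter_nonempty_of_quorums (A := Q)
    (B := {j | ∃ t'', (j, t'') ∈ insert (j', t') resp}) (by
      rw [Fintype.card_fin]
      have : P.n₁ = 2 * P.f₁ + P.k := rfl
      omega)
  obtain ⟨m, hm, hmax⟩ := hresp' _ hx
  -- An answer computed by step `n` would predate the invocation, when `ops` was still too small.
  have hnm : n + 1 ≤ m := by
    by_contra hlt
    have := E.writer_ops_mono w (show m ≤ n by omega)
    simp only at this
    omega
  obtain ⟨t1, ht1, hL⟩ := (hQge x hxQ).mono hnm
  have h1 : t ≤ t'' := by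
    simp only at hmax
    rw [hmax]
    exact ht1.trans (le_maxTag _ (E.edge_inv m x).finite hL)
  have h2 : t'' ≤ maxTag S.t₀ {t'' | ∃ j, (j, t'') ∈ insert (j', t') resp} := by
    refine le_maxTag _ ?_ ⟨x, hx⟩
    refine ((hfin.insert (j', t')).image Prod.snd).subset ?_
    rintro a ⟨b, hb⟩
    exact ⟨_, hb, rfl⟩
  have h3 := h1.trans h2
  generalize maxTag S.t₀ {t'' | ∃ j, (j, t'') ∈ insert (j', t') resp} = mx at h3 ht'
  -- The first component of `t` is one more than that of `mx`, which rules out `t ≤ mx`.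
  rw [ht', Prod.Lex.le_iff] at h3
  simp at h3

theorem putData_unique (hk : 0 < P.k) {G G' : ℕ} {w : W} {dst dst' : Proc P W R} {t : Tag W}
    {v v' : Value P F} (h : ⟨.writer w, dst, .putData t v⟩ ∈ E.sent G)
    (h' : ⟨.writer w, dst', .putData t v'⟩ ∈ E.sent G') : G = G' ∧ v = v' := by
  have hG : G = G' :=
    le_antisymm (not_lt.1 (E.putData_lt hk h' h)) (not_lt.1 (E.putData_lt hk h h'))
  subst hG
  obtain ⟨_, _, _, _, _, _, h1, _⟩ := E.putData_sent h
  obtain ⟨_, _, _, _, _, _, h2, _⟩ := E.putData_sent h'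
  rw [h1] at h2
  simp only [WState.mk.injEq, WPhase.putData.injEq, true_and] at h2
  exact ⟨rfl, h2.1⟩

theorem putData_writer {n : ℕ} {w : W} {dst : Proc P W R} {t : Tag W} {v : Value P F}
    (h : ⟨.writer w, dst, .putData t v⟩ ∈ E.sent n) : w = (ofLex t).2 := by
  obtain ⟨_, _, _, _, _, _, _, _, ht, _⟩ := E.putData_sent h
  rw [ht]
  rfl

end Execution
end LDS

namespace LDS
namespace Execution

variable {P : Params} {F W : Type*} [Zero F] [LinearOrder W] {S : System P F W} {R : Type*}
  (E : Execution S R)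

/-! ### The broadcast primitive -/

theorem seen_of_deliver {n m : ℕ} {s s' o : Fin P.n₁} {t : Tag W}
    (h : E.event n = .deliver m ⟨.edge s', .edge s, .commitTag o t⟩) :
    (o, t) ∈ ((E.config (n + 1)).edge s).seen := by
  rw [E.edge_deliver h]
  simp only [EdgeState.recv, EdgeState.commitTagRecv, EdgeState.broadcastResp]
  split_ifs with h1 h2 h3
  · exact h1
  all_goals exact Set.mem_insert _ _

theorem relay_forwards {n : ℕ} {ρ o : Fin P.n₁} (hρ : ρ ∈ S.relays) {t : Tag W}
    (h : (o, t) ∈ ((E.config n).edge ρ).seen) :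
    ∃ m < n, ∀ s : Fin P.n₁, ⟨.edge ρ, .edge s, .commitTag o t⟩ ∈ E.sent m := by
  induction n with
  | zero =>
    rw [E.config_zero] at h
    exact absurd h (Set.notMem_empty _)
  | succ n ih =>
    have aux : (o, t) ∈ ((E.config n).edge ρ).seen → ∃ m < n + 1, ∀ s : Fin P.n₁,
        ⟨.edge ρ, .edge s, .commitTag o t⟩ ∈ E.sent m := fun h =>
      (ih h).imp fun m h => ⟨h.1.trans (Nat.lt_succ_self n), h.2⟩
    rcases E.edge_step n ρ with ⟨h', -⟩ | ⟨m, src, msg, out, hev, htr, hs⟩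
    · rw [h'] at h
      exact aux h
    · generalize (E.config (n + 1)).edge ρ = e' at htr h
      cases htr <;> try exact aux h
      all_goals
        rcases h with h | h
        · cases h
          refine ⟨n, Nat.lt_succ_self n, fun s => ?_⟩
          rw [hs]
          refine ⟨rfl, ?_⟩
          simp [hρ]
        · exact aux h

theorem recvPut_broadcasts {a l : ℕ} {o : Fin P.n₁} {w : W} {t : Tag W} {v : Value P F}
    (h : E.event a = .deliver l ⟨.writer w, .edge o, .putData t v⟩) {ρ : Fin P.n₁}
    (hρ : ρ ∈ S.relays) : ⟨.edge o, .edge ρ, .commitTag o t⟩ ∈ E.sent a := by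
  rw [E.sent_deliver_edge h]
  refine ⟨rfl, ?_⟩
  simp only [EdgeState.recv, EdgeState.putDataResp]
  split_ifs
  · exact ⟨ρ, hρ, rfl⟩
  · exact Or.inl ⟨ρ, hρ, rfl⟩

variable {E} {τ₀ τ₁ τ₂ : ℝ}

/-- Two first-layer links: from the origin to a live relay, and from the relay to `s`. If the relay
saw the broadcast earlier by another route, it forwarded it earlier still. The origin may crash
after its first transmission. -/
theorem BoundedLatency.broadcast (hτ : E.BoundedLatency τ₀ τ₁ τ₂) (hE : E.FewCrashes)
    {a : ℕ} {o : Fin P.n₁} {t : Tag W} (h : E.RecvPut o t a) (s : Fin P.n₁) :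
    ∃ c, E.time c ≤ E.time a + 2 * τ₀ ∧
      (E.event c = .crash (.edge s) ∨ (o, t) ∈ ((E.config (c + 1)).edge s).seen) := by
  obtain ⟨ρ, hρ, hlive⟩ := hE.exists_relay
  obtain ⟨l, w, v, h⟩ := h
  obtain ⟨b, hab, htb, hb⟩ := hτ.delivered_of_live (E.recvPut_broadcasts h hρ) hlive
  obtain ⟨m, hm, hfwd⟩ := E.relay_forwards hρ (E.seen_of_deliver hb)
  obtain ⟨c, htc, hc⟩ := hτ m _ (hfwd s)
  refine ⟨c, ?_, ?_⟩
  · have := E.time_mono (Nat.lt_succ_iff.1 hm)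
    simp only [linkBound] at htb htc
    linarith
  · rcases hc with hc | hc
    · exact Or.inr (E.seen_of_deliver hc)
    · exact Or.inl hc

variable (E) in
theorem ack_or_tag_of_recvPut {o : Fin P.n₁} {t : Tag W} {a n : ℕ} (h : E.RecvPut o t a)
    (hn : a < n) : (∃ x, (t, x) ∈ ((E.config n).edge o).L) ∨
      (t ≤ ((E.config n).edge o).tc ∧
        ∃ c < n, ⟨.edge o, .writer (ofLex t).2, .ackWrite t⟩ ∈ E.sent c) := by
  obtain ⟨l, w, v, h⟩ := h
  have h' := E.edge_deliver h
  have hs := E.sent_deliver_edge h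
  simp only [EdgeState.recv, EdgeState.putDataResp] at h' hs
  split_ifs at h' hs with htc
  · left
    refine E.tag_mono o hn ⟨some v, ?_⟩
    rw [h']
    exact Or.inl rfl
  · right
    refine ⟨(not_lt.1 htc).trans (E.tc_mono o hn.le), a, hn, ?_⟩
    rw [hs]
    exact ⟨rfl, Or.inr rfl⟩

variable (E) in
/-- A server that has consumed enough broadcasts of a tag, among them its own, has acknowledged
the write and committed a tag at least as high. -/
theorem committed_of_seen {n : ℕ} {s : Fin P.n₁} {t : Tag W}
    (hs : (s, t) ∈ ((E.config n).edge s).seen)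
    (hq : P.f₁ + P.k ≤ {o | (o, t) ∈ ((E.config n).edge s).seen}.ncard) :
    t ≤ ((E.config n).edge s).tc ∧
      ∃ c < n, ⟨.edge s, .writer (ofLex t).2, .ackWrite t⟩ ∈ E.sent c := by
  induction n with
  | zero =>
    rw [E.config_zero] at hs
    exact absurd hs (Set.notMem_empty _)
  | succ n ih =>
    -- Only the first step at which both conditions hold needs work; afterwards the conclusion
    -- persists.
    by_cases hold : (s, t) ∈ ((E.config n).edge s).seen ∧
        P.f₁ + P.k ≤ {o | (o, t) ∈ ((E.config n).edge s).seen}.ncard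
    · obtain ⟨h1, c, hc, h2⟩ := ih hold.1 hold.2
      exact ⟨h1.trans (E.tc_mono s (Nat.le_succ n)), c, by omega, h2⟩
    obtain ⟨a, ha, hput⟩ := E.exists_recvPut_of_seen hs
    rcases E.edge_step n s with ⟨h', -⟩ | ⟨m, src, msg, out, hev, htr, hsent⟩
    · rw [h'] at hs hq
      exact absurd ⟨hs, hq⟩ hold
    -- A step delivers a single packet, so a step that consumes a broadcast is not the server's own
    -- put-data step, which therefore came strictly before.
    have htag : (∃ o' origin t', msg = .commitTag origin t' ∧ src = .edge o') → a < n := by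
      rintro ⟨o', origin, t', rfl, rfl⟩
      rcases Nat.lt_succ_iff_lt_or_eq.1 ha with h | rfl
      · exact h
      · obtain ⟨_, _, _, h⟩ := hput
        rw [hev] at h
        cases h
    -- If both conditions become true in this step, the broadcast consumed in it is one of `t`
    -- itself.
    have hnew : ∀ {origin t'}, (origin, t') ∉ ((E.config n).edge s).seen →
        (s, t) ∈ insert (origin, t') ((E.config n).edge s).seen →
        P.f₁ + P.k ≤ {o | (o, t) ∈ insert (origin, t') ((E.config n).edge s).seen}.ncard →
        t = t' ∧ P.f₁ + P.k ≤ ((E.config n).edge s).commitCounter t' + 1 := by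
      intro origin t' h h1 h2
      rw [← counter_insert (E.edge_inv n s).counter_eq h t] at h2
      by_cases ht : t = t'
      · subst ht
        rw [Function.update_self] at h2
        exact ⟨rfl, h2⟩
      · rw [Function.update_of_ne ht, (E.edge_inv n s).counter_eq] at h2
        exact absurd ⟨by simpa [ht] using h1, h2⟩ hold
    have hle : ((E.config n).edge s).tc ≤ ((E.config (n + 1)).edge s).tc :=
      E.tc_mono s (Nat.le_succ n)
    generalize (E.config (n + 1)).edge s = e' at htr hs hq hle ⊢
    cases htr
    case bcastCount o' origin t' h hc =>
      obtain ⟨rfl, h2⟩ := hnew h hs hq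
      -- The count suffices but nothing was acknowledged, so `t` is not listed. Then its put-data
      -- had found `t` at most the committed tag and was acknowledged at once.
      rcases E.ack_or_tag_of_recvPut hput (htag ⟨_, _, _, rfl, rfl⟩) with h3 | ⟨h3, c, hc, h4⟩
      · exact absurd ⟨h3, h2⟩ hc
      · exact ⟨h3.trans hle, c, by omega, h4⟩
    case bcastAck o' origin t' h hL hc ht =>
      obtain ⟨rfl, h2⟩ := hnew h hs hq
      refine ⟨ht, n, Nat.lt_succ_self n, ?_⟩
      rw [hsent]
      exact ⟨rfl, Or.inr rfl⟩
    case bcastCommit o' origin t' h hL hc ht =>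
      obtain ⟨rfl, h2⟩ := hnew h hs hq
      refine ⟨le_rfl, n, Nat.lt_succ_self n, ?_⟩
      rw [hsent]
      exact ⟨rfl, Or.inr (Or.inl (Or.inl rfl))⟩
    all_goals exact absurd (And.intro hs hq) hold

/-- Finitely many persistent properties, each reached by a common deadline, hold together at the
latest of these steps. The lower bound `n₀` also covers empty `O`. -/
theorem exists_common {ι : Type*} [Finite ι] (O : Set ι) {T : ℝ} {p : ι → ℕ → Prop}
    (hp : ∀ o m n, m ≤ n → p o m → p o n) {n₀ : ℕ} (h₀ : E.time n₀ ≤ T)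
    (h : ∀ o ∈ O, ∃ c, E.time c ≤ T ∧ p o c) :
    ∃ n, n₀ ≤ n ∧ E.time n ≤ T ∧ ∀ o ∈ O, p o n := by
  induction O, O.toFinite using Set.Finite.induction_on with
  | empty => exact ⟨n₀, le_rfl, h₀, by simp⟩
  | @insert a O _ _ ih =>
    obtain ⟨n, hn, hT, hO⟩ := ih fun o ho => h o (Or.inr ho)
    obtain ⟨c, hc, hpc⟩ := h a (Or.inl rfl)
    refine ⟨max n c, hn.trans (le_max_left _ _), ?_, ?_⟩
    · rcases max_choice n c with h | h <;> rw [h] <;> assumption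
    · rintro o (rfl | ho)
      · exact hp _ _ _ (le_max_right _ _) hpc
      · exact hp _ _ _ (le_max_left _ _) (hO o ho)

/-- Within `τ₁ + 2 τ₀` of the put-data phase every server acknowledges and commits, or crashes. -/
theorem BoundedLatency.committed (hτ : E.BoundedLatency τ₀ τ₁ τ₂) (hE : E.FewCrashes)
    (h₀ : 0 ≤ τ₀) (h₁ : 0 ≤ τ₁) {G : ℕ} {w : W} {t : Tag W} {v : Value P F}
    (hG : ∀ s : Fin P.n₁, ⟨.writer w, .edge s, .putData t v⟩ ∈ E.sent G) (s : Fin P.n₁) :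
    ∃ n, E.time n ≤ E.time G + (τ₁ + 2 * τ₀) ∧ (E.event n = .crash (.edge s) ∨
      (t ≤ ((E.config (n + 1)).edge s).tc ∧
        ∃ c ≤ n, ⟨.edge s, .writer (ofLex t).2, .ackWrite t⟩ ∈ E.sent c)) := by
  by_cases hcr : ∃ n, E.time n ≤ E.time G + (τ₁ + 2 * τ₀) ∧ E.event n = .crash (.edge s)
  · obtain ⟨n, h, h'⟩ := hcr
    exact ⟨n, h, Or.inl h'⟩
  push Not at hcr
  -- The live servers provide the count of `f₁ + k`; `s` is added because its own broadcast
  -- certifies that it received the value, even if `s` crashes after the deadline.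
  have hrecv : ∀ o ∈ insert s E.liveEdges, ∃ c, E.time c ≤ E.time G + (τ₁ + 2 * τ₀) ∧
      (o, t) ∈ ((E.config (c + 1)).edge s).seen := by
    intro o ho
    obtain ⟨a, hta, ha⟩ := hτ G _ (hG o)
    simp only [linkBound] at hta
    have ha' : E.RecvPut o t a := by
      rcases ha with ha | ha
      · exact ⟨G, w, v, ha⟩
      · rcases ho with rfl | ho
        · exact absurd ha (hcr a (by linarith))
        · exact absurd ha (ho a)
    obtain ⟨c, htc, hc⟩ := hτ.broadcast hE ha' s
    refine ⟨c, by linarith, ?_⟩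
    rcases hc with hc | hc
    · exact absurd hc (hcr c (by linarith))
    · exact hc
  obtain ⟨n, -, htn, hn⟩ := exists_common (E := E) (insert s E.liveEdges)
    (p := fun o n => (o, t) ∈ ((E.config (n + 1)).edge s).seen)
    (fun o m n hmn h => E.seen_mono s (Nat.succ_le_succ hmn) h)
    (n₀ := G) (T := E.time G + (τ₁ + 2 * τ₀)) (by linarith) hrecv
  have hq : P.f₁ + P.k ≤ {o | (o, t) ∈ ((E.config (n + 1)).edge s).seen}.ncard := by
    have h1 : E.liveEdges.ncard ≤ {o | (o, t) ∈ ((E.config (n + 1)).edge s).seen}.ncard :=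
      Set.ncard_le_ncard (fun o ho => hn o (Or.inr ho)) (Set.toFinite _)
    have := hE.edges
    have h2 : P.n₁ = 2 * P.f₁ + P.k := rfl
    omega
  obtain ⟨h1, c, hc, h2⟩ := E.committed_of_seen (hn s (Or.inl rfl)) hq
  exact ⟨n, htn, Or.inr ⟨h1, c, Nat.lt_succ_iff.1 hc, h2⟩⟩

variable (E)

/-! ### Values in the lists of first-layer servers -/

theorem exists_putData_of_some (n : ℕ) {s : Fin P.n₁} {t : Tag W} {v : Value P F}
    (h : (t, some v) ∈ ((E.config n).edge s).L) :
    ∃ a < n, ∃ l w, E.event a = .deliver l ⟨.writer w, .edge s, .putData t v⟩ := by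
  induction n with
  | zero =>
    rw [E.config_zero] at h
    simp [initConfig] at h
  | succ n ih =>
    have aux : (t, some v) ∈ ((E.config n).edge s).L → ∃ a < n + 1, ∃ l w,
        E.event a = .deliver l ⟨.writer w, .edge s, .putData t v⟩ := fun h =>
      (ih h).imp fun a h => ⟨h.1.trans (Nat.lt_succ_self n), h.2⟩
    rcases E.edge_step n s with ⟨h', -⟩ | ⟨m, src, msg, out, hev, htr, -⟩
    · rw [h'] at h
      exact aux h
    · generalize (E.config (n + 1)).edge s = e' at htr h
      cases htr <;> (try simp only [collect_some] at h) <;> try first | exact aux h | exact aux h.1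
      case putDataNew w t' v' _ =>
        rcases h with h | h
        · cases h
          exact ⟨n, Nat.lt_succ_self n, _, _, hev⟩
        · exact aux h
      case ackCodeDone =>
        rcases h with h | h
        · exact aux h.1
        · simp at h
      case putTagNone =>
        rcases h.1 with h | h
        · simp at h
        · exact aux h

/-- Values enter lists through put-data only. The tag names its writer, and that writer uses it in a
single put-data phase. -/
theorem value_unique (hk : 0 < P.k) {n n' : ℕ} {s s' : Fin P.n₁} {t : Tag W} {v v' : Value P F}
    (h : (t, some v) ∈ ((E.config n).edge s).L)
    (h' : (t, some v') ∈ ((E.config n').edge s').L) : v = v' := by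
  obtain ⟨a, -, l, w, ha⟩ := E.exists_putData_of_some n h
  obtain ⟨a', -, l', w', ha'⟩ := E.exists_putData_of_some n' h'
  have h1 := (E.mem_sent_of_deliver ha).2
  have h2 := (E.mem_sent_of_deliver ha').2
  obtain rfl := E.putData_writer h1
  obtain rfl := E.putData_writer h2
  exact (E.putData_unique hk h1 h2).2

/-- Put-data adds values above the committed tag only, so once `t` is covered its value can
disappear but not return. -/
theorem some_of_some_of_tc {s : Fin P.n₁} {t : Tag W} {v : Value P F} {m n : ℕ} (hmn : m ≤ n)
    (ht : t ≤ ((E.config m).edge s).tc) (h : (t, some v) ∈ ((E.config n).edge s).L) :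
    (t, some v) ∈ ((E.config m).edge s).L := by
  induction n, hmn using Nat.le_induction with
  | base => exact h
  | succ n hmn ih =>
    have htn := ht.trans (E.tc_mono s hmn)
    rcases E.edge_step n s with ⟨h', -⟩ | ⟨m, src, msg, out, hev, htr, -⟩
    · rw [h'] at h
      exact ih h
    · generalize (E.config (n + 1)).edge s = e' at htr h
      cases htr <;> (try simp only [collect_some] at h) <;> try first | exact ih h | exact ih h.1
      case putDataNew w t' v' hlt =>
        rcases h with h | h
        · cases h
          exact absurd hlt (not_lt.2 htn)
        · exact ih h
      case ackCodeDone =>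
        rcases h with h | h
        · exact ih h.1
        · simp at h
      case putTagNone =>
        rcases h.1 with h | h
        · simp at h
        · exact ih h

/-- The step that raises the committed tag is not a put-data step, hence brings no new value. -/
theorem some_of_commit {s : Fin P.n₁} {t : Tag W} {v : Value P F} {c : ℕ}
    (hlt : ((E.config c).edge s).tc < t) (hge : t ≤ ((E.config (c + 1)).edge s).tc)
    (h : (t, some v) ∈ ((E.config (c + 1)).edge s).L) :
    (t, some v) ∈ ((E.config c).edge s).L := by
  rcases E.edge_step c s with ⟨h', -⟩ | ⟨m, src, msg, out, hev, htr, -⟩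
  · rwa [h'] at h
  · generalize (E.config (c + 1)).edge s = e' at htr h hge
    cases htr <;> (try simp only [collect_some] at h) <;> try first | exact h | exact h.1
    case putDataNew => exact absurd hlt (not_lt.2 hge)
    case ackCodeDone => exact absurd hlt (not_lt.2 hge)
    case putTagNone =>
      rcases h.1 with h | h
      · simp at h
      · exact h

/-- The equality `heq` matters: a commit that jumps over `t` drops its value without writing it to
the second layer. -/
theorem writeToL2_of_commit {s : Fin P.n₁} {t : Tag W} {v : Value P F} {c : ℕ}
    (hlt : ((E.config c).edge s).tc < t) (heq : ((E.config (c + 1)).edge s).tc = t)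
    (h : (t, some v) ∈ ((E.config c).edge s).L) (i : Fin P.n₂) :
    ⟨.edge s, .back i, .writeCodeElem t (S.code.encode v (Fin.natAdd P.n₁ i))⟩ ∈ E.sent c := by
  rcases E.edge_step c s with ⟨h', -⟩ | ⟨m, src, msg, out, hev, htr, hs⟩
  · rw [h'] at heq
    exact absurd heq hlt.ne
  · rw [hs]
    refine ⟨rfl, ?_⟩
    generalize (E.config (c + 1)).edge s = e' at htr heq
    cases htr <;> try exact absurd heq hlt.ne
    case bcastCommit =>
      subst heq
      exact Or.inr (Or.inr ⟨i, v, h, rfl⟩)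
    case putTagValue =>
      subst heq
      exact Or.inl (Or.inr ⟨i, v, h, rfl⟩)
    case putTagNone h' =>
      subst heq
      exact absurd ⟨v, h⟩ h'

theorem writeCodeElem_sent {n : ℕ} {s : Fin P.n₁} {dst : Proc P W R} {t : Tag W} {c : Coded P F}
    (h : ⟨.edge s, dst, .writeCodeElem t c⟩ ∈ E.sent n) :
    ((E.config n).edge s).tc < t ∧ ((E.config (n + 1)).edge s).tc = t ∧
      ∃ i v, dst = .back i ∧ (t, some v) ∈ ((E.config n).edge s).L ∧
        c = S.code.encode v (Fin.natAdd P.n₁ i) := by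
  obtain ⟨m, src, msg, out, hev, htr, ho⟩ := E.sent_edge h
  generalize (E.config (n + 1)).edge s = e' at htr ⊢
  cases htr
  case bcastCommit o' origin t' _ _ _ hlt =>
    rcases ho with ⟨-, j', ho⟩ | ((ho | ⟨r, q, treq, v, -, -, -, ho⟩) | ⟨i, v, hv, ho⟩)
    · cases ho
    · cases ho
    · cases ho
    · cases ho
      exact ⟨hlt, rfl, i, v, rfl, hv, rfl⟩
  case putTagValue r q t' hlt _ =>
    rcases ho with (⟨r, q, treq, v, -, -, -, ho⟩ | ⟨i, v, hv, ho⟩) | ho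
    · cases ho
    · cases ho
      exact ⟨hlt, rfl, i, v, rfl, hv, rfl⟩
    · cases ho
  all_goals simp [ackWriter, serve] at ho

end Execution
end LDS

namespace LDS
namespace Execution

variable {P : Params} {F W : Type*} [Zero F] [LinearOrder W] {S : System P F W} {R : Type*}
  (E : Execution S R)

/-! ### Write-to-L2 -/

/-- The acknowledgment is traced back through the second-layer server, whose stored tag never
decreases, to the step in which `s` committed exactly `t`. -/
theorem ackCodeElem_origin {n m : ℕ} {i : Fin P.n₂} {s : Fin P.n₁} {t : Tag W}
    (h : E.event n = .deliver m ⟨.back i, .edge s, .ackCodeElem t⟩) :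
    t ≤ ((E.config n).back i).t ∧ ∃ l v,
      E.event m = .deliver l ⟨.edge s, .back i,
        .writeCodeElem t (S.code.encode v (Fin.natAdd P.n₁ i))⟩ ∧ l < m ∧ m < n ∧
      (t, some v) ∈ ((E.config l).edge s).L ∧
      ((E.config l).edge s).tc < t ∧ ((E.config (l + 1)).edge s).tc = t := by
  obtain ⟨hmn, hp⟩ := E.mem_sent_of_deliver h
  obtain ⟨l, j, msg, out, hev, htr, ho⟩ := E.sent_back hp
  have hle : ((E.config (m + 1)).back i).t ≤ ((E.config n).back i).t := E.back_mono i hmn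
  have key : j = s → (∃ c, msg = .writeCodeElem t c) → t ≤ ((E.config (m + 1)).back i).t →
      t ≤ ((E.config n).back i).t ∧ ∃ l v,
      E.event m = .deliver l ⟨.edge s, .back i,
        .writeCodeElem t (S.code.encode v (Fin.natAdd P.n₁ i))⟩ ∧ l < m ∧ m < n ∧
      (t, some v) ∈ ((E.config l).edge s).L ∧
      ((E.config l).edge s).tc < t ∧ ((E.config (l + 1)).edge s).tc = t := by
    rintro rfl ⟨c, rfl⟩ ht
    obtain ⟨hlm, hp⟩ := E.mem_sent_of_deliver hev
    obtain ⟨h1, h2, i', v, hi, hv, rfl⟩ := E.writeCodeElem_sent hp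
    cases hi
    exact ⟨ht.trans hle, l, v, hev, hlm, hmn, hv, h1, h2⟩
  generalize (E.config (m + 1)).back i = b' at htr key
  cases htr
  case writeNew t' c h' =>
    cases ho
    exact key rfl ⟨_, rfl⟩ le_rfl
  case writeOld t' c h' =>
    cases ho
    exact key rfl ⟨_, rfl⟩ h'
  case skip => exact absurd ho (Set.notMem_empty _)
  case query => cases ho

theorem le_tc_of_ackCodeElem {n m : ℕ} {i : Fin P.n₂} {s : Fin P.n₁} {t : Tag W}
    (h : E.event n = .deliver m ⟨.back i, .edge s, .ackCodeElem t⟩) :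
    t ≤ ((E.config n).edge s).tc := by
  obtain ⟨-, l, v, -, h1, h2, -, -, h3⟩ := E.ackCodeElem_origin h
  rw [← h3]
  exact E.tc_mono s (by omega)

/-- The committed tag of `s` rises to `t` in one step only, and the value of `t` is unique. So both
acknowledgments answer the same packet, which is delivered once, as is the answer. -/
theorem ackCodeElem_unique (hk : 0 < P.k) {n n' m m' : ℕ} {i : Fin P.n₂} {s : Fin P.n₁}
    {t : Tag W} (h : E.event n = .deliver m ⟨.back i, .edge s, .ackCodeElem t⟩)
    (h' : E.event n' = .deliver m' ⟨.back i, .edge s, .ackCodeElem t⟩) : n = n' := by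
  obtain ⟨-, l, v, hm, -, -, hv, h1, h2⟩ := E.ackCodeElem_origin h
  obtain ⟨-, l', v', hm', -, -, hv', h1', h2'⟩ := E.ackCodeElem_origin h'
  obtain rfl := E.value_unique hk hv hv'
  have hl : l = l' := by
    rcases lt_trichotomy l l' with hl | hl | hl
    · have : ((E.config (l + 1)).edge s).tc ≤ ((E.config l').edge s).tc := E.tc_mono s hl
      rw [h2] at this
      exact absurd h1' (not_lt.2 this)
    · exact hl
    · have : ((E.config (l' + 1)).edge s).tc ≤ ((E.config l).edge s).tc := E.tc_mono s hl
      rw [h2'] at this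
      exact absurd h1 (not_lt.2 this)
  subst hl
  obtain rfl := E.deliver_once _ _ _ _ hm hm'
  exact E.deliver_once _ _ _ _ h h'

/-- The second-layer servers whose acknowledgment of tag `t` has reached server `s`. -/
def ackedBacks (s : Fin P.n₁) (t : Tag W) (n : ℕ) : Set (Fin P.n₂) :=
  {i | ∃ n' < n, ∃ m, E.event n' = .deliver m ⟨.back i, .edge s, .ackCodeElem t⟩}

theorem writeCounter_eq (hk : 0 < P.k) (s : Fin P.n₁) (t : Tag W) (n : ℕ) :
    ((E.config n).edge s).writeCounter t = (E.ackedBacks s t n).ncard := by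
  induction n with
  | zero => simp [E.config_zero, initConfig, ackedBacks]
  | succ n ih =>
    by_cases hev : ∃ m i, E.event n = .deliver m ⟨.back i, .edge s, .ackCodeElem t⟩
    · obtain ⟨m, i, hev⟩ := hev
      have h1 : E.ackedBacks s t (n + 1) = insert i (E.ackedBacks s t n) := by
        ext i'
        constructor
        · rintro ⟨n', hn', m', h⟩
          rcases Nat.lt_succ_iff_lt_or_eq.1 hn' with hn' | rfl
          · exact Or.inr ⟨n', hn', m', h⟩
          · rw [hev] at h
            cases h
            exact Or.inl rfl
        · rintro (rfl | ⟨n', hn', h⟩)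
          · exact ⟨n, Nat.lt_succ_self n, m, hev⟩
          · exact ⟨n', hn'.trans (Nat.lt_succ_self n), h⟩
      have h2 : i ∉ E.ackedBacks s t n := by
        rintro ⟨n', hn', m', h⟩
        exact absurd (E.ackCodeElem_unique hk h hev) hn'.ne
      rw [h1, Set.ncard_insert_of_notMem h2 (Set.toFinite _), ← ih, E.edge_deliver hev]
      simp only [EdgeState.recv, EdgeState.ackCodeElemRecv]
      split_ifs <;> simp
    · have h1 : E.ackedBacks s t (n + 1) = E.ackedBacks s t n := by
        ext i'
        constructor
        · rintro ⟨n', hn', m', h⟩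
          rcases Nat.lt_succ_iff_lt_or_eq.1 hn' with hn' | rfl
          · exact ⟨n', hn', m', h⟩
          · exact absurd ⟨_, _, h⟩ hev
        · rintro ⟨n', hn', h⟩
          exact ⟨n', hn'.trans (Nat.lt_succ_self n), h⟩
      rw [h1, ← ih]
      rcases E.edge_step n s with ⟨h', -⟩ | ⟨m, src, msg, out, hev', htr, -⟩
      · rw [h']
      · generalize (E.config (n + 1)).edge s = e' at htr ⊢
        cases htr <;> try rfl
        all_goals
          rename_i i t' _
          have ht : t ≠ t' := by
            rintro rfl
            exact hev ⟨m, i, hev'⟩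
          simp [Function.update_of_ne ht]

/-- The counter grows by one, so it hits `n₂ - f₂` exactly, and there the value is erased. A
positive counter forces `t` to be at most the committed tag, so put-data cannot bring the value
back. -/
theorem not_some_of_writeCounter (hn : 0 < P.n₂ - P.f₂) {s : Fin P.n₁} {t : Tag W} (n : ℕ)
    (h : P.n₂ - P.f₂ ≤ ((E.config n).edge s).writeCounter t) (v : Value P F) :
    (t, some v) ∉ ((E.config n).edge s).L := by
  have hwc : ∀ n, 0 < ((E.config n).edge s).writeCounter t → t ≤ ((E.config n).edge s).tc := by
    intro n
    induction n with
    | zero => simp [E.config_zero, initConfig]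
    | succ n ih =>
      intro h
      have hle : ((E.config n).edge s).tc ≤ ((E.config (n + 1)).edge s).tc :=
        E.tc_mono s (Nat.le_succ n)
      by_cases h0 : 0 < ((E.config n).edge s).writeCounter t
      · exact (ih h0).trans hle
      · rcases E.edge_step n s with ⟨h', -⟩ | ⟨m, src, msg, out, hev', htr, -⟩
        · rw [h'] at h
          exact absurd h h0
        · generalize (E.config (n + 1)).edge s = e' at htr hle h ⊢
          cases htr <;> try exact absurd h h0
          all_goals
            rename_i i t' _
            by_cases ht : t = t'
            · subst ht
              exact E.le_tc_of_ackCodeElem hev'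
            · simp only [Function.update_of_ne ht] at h
              exact absurd h h0
  induction n with
  | zero =>
    rw [E.config_zero]
    simp [initConfig]
  | succ n ih =>
    rcases E.edge_step n s with ⟨h', -⟩ | ⟨m, src, msg, out, hev', htr, -⟩
    · rw [h'] at h ⊢
      exact ih h
    · have hwcn := hwc n
      generalize (E.config (n + 1)).edge s = e' at htr h ⊢
      cases htr <;> (try simp only [collect_some]) <;>
        try first | exact ih h | exact fun h' => ih h h'.1
      case putDataNew w t' v' hlt =>
        rintro (h' | h')
        · cases h'
          exact absurd hlt (not_lt.2 (hwcn (hn.trans_le h)))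
        · exact ih h h'
      case ackCodeDone i t' hc =>
        rintro (h' | h')
        · simp only [Function.update_of_ne (Ne.symm (Ne.symm h'.2))] at h
          exact ih h h'.1
        · simp at h'
      case ackCodeCount i t' hc =>
        by_cases ht : t = t'
        · subst ht
          simp only [Function.update_self] at h
          -- The new count is at least the threshold but differs from it, so the old count had
          -- reached it already.
          exact ih (by omega)
        · simp only [Function.update_of_ne ht] at h
          exact ih h
      case putTagNone =>
        rintro ⟨h' | h', -⟩
        · simp at h'
        · exact ih h h'

/-- A value with the committed tag disappears only when enough second-layer servers have
acknowledged it. -/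
theorem some_or_writeCounter {s : Fin P.n₁} {t : Tag W} {v : Value P F} {m n : ℕ} (hmn : m ≤ n)
    (h : (t, some v) ∈ ((E.config m).edge s).L) (ht : ((E.config n).edge s).tc ≤ t) :
    (t, some v) ∈ ((E.config n).edge s).L ∨
      P.n₂ - P.f₂ ≤ ((E.config n).edge s).writeCounter t := by
  induction n, hmn using Nat.le_induction with
  | base => exact Or.inl h
  | succ n hmn ih =>
    have hle : ((E.config n).edge s).tc ≤ ((E.config (n + 1)).edge s).tc :=
      E.tc_mono s (Nat.le_succ n)
    specialize ih (hle.trans ht)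
    rcases E.edge_step n s with ⟨h', -⟩ | ⟨m, src, msg, out, hev', htr, -⟩
    · rwa [h']
    · generalize (E.config (n + 1)).edge s = e' at htr ht ⊢
      cases htr <;> (try simp only [collect_some]) <;>
        try first | exact ih | exact ih.imp_left fun h => ⟨h, ht⟩
      case putDataNew => exact ih.imp_left Or.inr
      case ackCodeDone i t' hc =>
        by_cases htt : t = t'
        · subst htt
          right
          simp only [Function.update_self]
          exact hc.ge
        · simp only [Function.update_of_ne htt]
          exact ih.imp_left fun h => Or.inl ⟨h, htt⟩
      case ackCodeCount i t' hc =>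
        refine ih.imp_right fun h => ?_
        by_cases htt : t = t'
        · subst htt
          simp only [Function.update_self]
          omega
        · simpa only [Function.update_of_ne htt]
      case putTagNone => exact ih.imp_left fun h => ⟨Or.inr h, ht⟩

theorem exists_commit {s : Fin P.n₁} {t : Tag W} (h0 : S.t₀ < t) {n : ℕ}
    (h : t ≤ ((E.config n).edge s).tc) :
    ∃ c < n, ((E.config c).edge s).tc < t ∧ t ≤ ((E.config (c + 1)).edge s).tc := by
  obtain ⟨c, -, hc, h1, h2⟩ := exists_last (p := fun n => ((E.config n).edge s).tc < t)
    (Nat.zero_le n) (by simpa [E.config_zero, initConfig]) (not_lt.2 h)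
  exact ⟨c, hc, h1 c (Nat.zero_le c) le_rfl, not_lt.1 h2⟩

variable {E} {τ₀ τ₁ τ₂ : ℝ}

/-- Within `2 τ₂` of the commitment of a tag at least `t`, server `s` has no value for `t`. -/
theorem BoundedLatency.cleared (hτ : E.BoundedLatency τ₀ τ₁ τ₂) (hP : P.Valid)
    (hE : E.FewCrashes) (h₂ : 0 ≤ τ₂) {n : ℕ} {s : Fin P.n₁} {t : Tag W}
    (h : t ≤ ((E.config (n + 1)).edge s).tc) :
    ∃ n', n ≤ n' ∧ E.time n' ≤ E.time n + 2 * τ₂ ∧ (.edge s ∈ (E.config (n' + 1)).crashed ∨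
      ∀ v, (t, some v) ∉ ((E.config (n' + 1)).edge s).L) := by
  by_cases hv : ∃ v, (t, some v) ∈ ((E.config (n + 1)).edge s).L
  swap
  · exact ⟨n, le_rfl, by linarith, Or.inr (not_exists.1 hv)⟩
  obtain ⟨v, hv⟩ := hv
  have hk : 0 < P.k := by have := hP.f₁_lt; simp only [Params.n₁] at this; omega
  -- No value lies below the committed tag. So as long as the value of `t` is present, `t` itself is
  -- the committed tag, and its commit has started write-to-L2.
  have heq : t = ((E.config (n + 1)).edge s).tc :=
    le_antisymm h ((E.edge_inv (n + 1) s).tc_le_of_some _ _ hv)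
  -- The initial tag starts with `⊥` and, being covered from the beginning, never gets a value. So
  -- `t` was committed in some step.
  have h0 : S.t₀ < t := by
    refine lt_of_le_of_ne (((E.edge_inv (n + 1) s).init_le).trans heq.ge) ?_
    rintro rfl
    have := E.some_of_some_of_tc (Nat.zero_le (n + 1)) (by simp [E.config_zero, initConfig]) hv
    simp [E.config_zero, initConfig] at this
  obtain ⟨c, hc, hlt, hge⟩ := E.exists_commit h0 h
  have hceq : ((E.config (c + 1)).edge s).tc = t :=
    le_antisymm (by rw [heq]; exact E.tc_mono s hc) hge
  have hsent := E.writeToL2_of_commit hlt hceq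
    (E.some_of_commit hlt hge (E.some_of_some_of_tc hc hge hv))
  have htime : E.time c ≤ E.time n := E.time_mono (Nat.lt_succ_iff.1 hc)
  by_cases hcr : ∃ n', E.time n' ≤ E.time n + 2 * τ₂ ∧ E.event n' = .crash (.edge s)
  · obtain ⟨n', h1, h2⟩ := hcr
    refine ⟨max n n', le_max_left _ _, ?_, Or.inl ((E.crashed_iff _ _).2 ⟨n', ?_, h2⟩)⟩
    · rcases max_choice n n' with h | h <;> rw [h] <;> linarith
    · exact Nat.lt_succ_of_le (le_max_right _ _)
  push Not at hcr
  have hack : ∀ i ∈ E.liveBacks, ∃ n', E.time n' ≤ E.time n + 2 * τ₂ ∧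
      i ∈ E.ackedBacks s t (n' + 1) := by
    intro i hi
    obtain ⟨b, -, htb, hb⟩ := hτ.delivered_of_live (hsent i) hi
    have hb' : ⟨.back i, .edge s, .ackCodeElem t⟩ ∈ E.sent b := by
      rw [E.sent_deliver_back hb]
      exact ⟨rfl, rfl⟩
    obtain ⟨n', htn, hn'⟩ := hτ b _ hb'
    simp only [linkBound] at htb htn
    rcases hn' with hn' | hn'
    · exact ⟨n', by linarith, n', Nat.lt_succ_self _, b, hn'⟩
    · exact absurd hn' (hcr n' (by linarith))
  obtain ⟨n', hnn', htn', hall⟩ := E.exists_common E.liveBacks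
    (p := fun i n' => i ∈ E.ackedBacks s t (n' + 1))
    (fun o m n hmn => fun ⟨a, ha, h⟩ => ⟨a, by omega, h⟩) (n₀ := n)
    (T := E.time n + 2 * τ₂) (by linarith) hack
  refine ⟨n', hnn', htn', Or.inr (E.not_some_of_writeCounter ?_ _ ?_)⟩
  · have := hP.f₂_lt
    omega
  · rw [E.writeCounter_eq hk]
    have h1 : E.liveBacks.ncard ≤ (E.ackedBacks s t (n' + 1)).ncard :=
      Set.ncard_le_ncard hall (Set.toFinite _)
    have := hE.backs
    omega

/-! ### The phases of a write -/

variable (E)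

theorem writer_busy_step {n : ℕ} {w : W} (h : ((E.config n).writer w).phase ≠ .idle) :
    (E.config (n + 1)).writer w = (E.config n).writer w ∨
    ∃ m j msg out, E.event n = .deliver m ⟨.edge j, .writer w, msg⟩ ∧
      WTrans S w ((E.config n).writer w) j msg ((E.config (n + 1)).writer w) out ∧
      E.sent n = packets (.writer w) out := by
  rcases E.writer_step n w with h' | ⟨v, h', -⟩ | h'
  · exact Or.inl h'.1
  · exact absurd (E.invokeWrite_ok _ _ _ h').2 h
  · exact Or.inr h'

theorem getTag_mono {m n : ℕ} (hmn : m ≤ n) {w : W}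
    (h : ∀ l, m ≤ l → l ≤ n → ∃ v resp, ((E.config l).writer w).phase = .getTag v resp)
    {v : Value P F} {resp : Set (Fin P.n₁ × Tag W)}
    (hm : ((E.config m).writer w).phase = .getTag v resp) :
    ∃ resp', ((E.config n).writer w).phase = .getTag v resp' ∧ resp ⊆ resp' ∧
      ((E.config n).writer w).ops = ((E.config m).writer w).ops := by
  induction n, hmn using Nat.le_induction with
  | base => exact ⟨resp, hm, subset_rfl, rfl⟩
  | succ n hmn ih =>
    obtain ⟨resp', h1, h2, h3⟩ := ih fun l hl hl' => h l hl (by omega)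
    obtain ⟨v', resp'', hn⟩ := h (n + 1) (by omega) le_rfl
    rcases E.writer_busy_step (n := n) (w := w) (by rw [h1]; simp) with
      h' | ⟨m', j, msg, out, hev, htr, -⟩
    · rw [h']
      exact ⟨resp', h1, h2, h3⟩
    · generalize (E.config (n + 1)).writer w = b' at htr hn ⊢
      cases htr
      case skip => exact ⟨resp', h1, h2, h3⟩
      case tagMore v0 resp0 t hph _ =>
        rw [h1] at hph
        cases hph
        exact ⟨_, rfl, h2.trans (Set.subset_insert _ _), h3⟩
      all_goals cases hn

theorem putData_mono {m n : ℕ} (hmn : m ≤ n) {w : W}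
    (h : ∀ l, m ≤ l → l ≤ n → ((E.config l).writer w).phase ≠ .idle) {t : Tag W}
    {v : Value P F} {acks : Set (Fin P.n₁)}
    (hm : ((E.config m).writer w).phase = .putData t v acks) :
    ∃ acks', ((E.config n).writer w).phase = .putData t v acks' ∧ acks ⊆ acks' := by
  induction n, hmn using Nat.le_induction with
  | base => exact ⟨acks, hm, subset_rfl⟩
  | succ n hmn ih =>
    obtain ⟨acks', h1, h2⟩ := ih fun l hl hl' => h l hl (by omega)
    have hn := h (n + 1) (by omega) le_rfl
    rcases E.writer_busy_step (n := n) (w := w) (by rw [h1]; simp) with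
      h' | ⟨m', j, msg, out, hev, htr, -⟩
    · rw [h']
      exact ⟨acks', h1, h2⟩
    · generalize (E.config (n + 1)).writer w = b' at htr hn ⊢
      cases htr
      case skip => exact ⟨acks', h1, h2⟩
      case ackMore t0 v0 acks0 hph _ =>
        rw [h1] at hph
        cases hph
        exact ⟨_, rfl, h2.trans (Set.subset_insert _ _)⟩
      case ackDone => exact absurd rfl hn
      case tagMore _ _ _ hph _ => rw [h1] at hph; cases hph
      case tagDone _ _ _ _ hph _ _ => rw [h1] at hph; cases hph

theorem mem_resp_of_deliver {n m : ℕ} {w : W} {s : Fin P.n₁} {t : Tag W} {v v' : Value P F}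
    {resp resp' : Set (Fin P.n₁ × Tag W)} (hph : ((E.config n).writer w).phase = .getTag v resp)
    (hph' : ((E.config (n + 1)).writer w).phase = .getTag v' resp')
    (h : E.event n =
      .deliver m ⟨.edge s, .writer w, .tagResp ((E.config n).writer w).ops t⟩) :
    (s, t) ∈ resp' := by
  have h' := E.writer_deliver h
  simp only [WState.recv, hph, if_true] at h'
  split_ifs at h'
  · rw [h'] at hph'
    cases hph'
  · rw [h'] at hph'
    cases hph'
    exact Set.mem_insert _ _

theorem mem_acks_of_deliver {n m : ℕ} {w : W} {s : Fin P.n₁} {t : Tag W} {v v' : Value P F}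
    {acks acks' : Set (Fin P.n₁)} (hph : ((E.config n).writer w).phase = .putData t v acks)
    (hph' : ((E.config (n + 1)).writer w).phase = .putData t v' acks')
    (h : E.event n = .deliver m ⟨.edge s, .writer w, .ackWrite t⟩) : s ∈ acks' := by
  have h' := E.writer_deliver h
  simp only [WState.recv, hph, if_true] at h'
  split_ifs at h'
  · rw [h'] at hph'
    cases hph'
  · rw [h'] at hph'
    cases hph'
    exact Set.mem_insert _ _

variable {E}

theorem SuccessfulWrite.phases {i j : ℕ} {w : W} {v : Value P F} {t : Tag W}
    (h : E.SuccessfulWrite i j w v t) :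
    ∃ G, i < G ∧ G < j ∧
      (∀ n, i < n → n ≤ G → ∃ v resp, ((E.config n).writer w).phase = .getTag v resp) ∧
      (∀ s : Fin P.n₁, ⟨.writer w, .edge s, .putData t v⟩ ∈ E.sent G) ∧
      (∀ n, G < n → n ≤ j → ∃ acks, ((E.config n).writer w).phase = .putData t v acks) := by
  obtain ⟨hev, hij, hbusy, ⟨acks, hacks⟩, -⟩ := h
  have h1 : ((E.config (i + 1)).writer w).phase = .getTag v ∅ := by
    rw [E.config_succ, hev]
    simp [act, WState.invoke]
  obtain ⟨G, hiG, hGj, hall, hG⟩ := exists_last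
    (p := fun n => ∃ v resp, ((E.config n).writer w).phase = .getTag v resp)
    (show i + 1 ≤ j from hij) ⟨v, ∅, h1⟩ (by rw [hacks]; simp)
  obtain ⟨resp, hresp, -⟩ := E.getTag_mono hiG hall h1
  have hGb := hbusy (G + 1) (by omega) hGj
  obtain ⟨tw, vw, hsent, hput⟩ : ∃ tw vw,
      (∀ s : Fin P.n₁, ⟨.writer w, .edge s, .putData tw vw⟩ ∈ E.sent G) ∧
      ((E.config (G + 1)).writer w).phase = .putData tw vw ∅ := by
    rcases E.writer_busy_step (n := G) (w := w) (by rw [hresp]; simp) with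
      h' | ⟨m', j, msg, out, hev, htr, hs⟩
    · exact absurd ⟨v, resp, by rw [h', hresp]⟩ hG
    · rw [hs]
      generalize (E.config (G + 1)).writer w = b' at htr hG ⊢
      cases htr
      case skip => exact absurd ⟨v, resp, hresp⟩ hG
      case tagMore => exact absurd ⟨_, _, rfl⟩ hG
      case tagDone => exact ⟨_, _, fun s => ⟨rfl, s, rfl⟩, rfl⟩
      case ackMore _ _ _ hph _ => rw [hresp] at hph; cases hph
      case ackDone _ _ _ hph _ => rw [hresp] at hph; cases hph
  have hall' : ∀ n, G < n → n ≤ j →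
      ∃ acks, ((E.config n).writer w).phase = .putData tw vw acks := fun n hn hn' =>
    (E.putData_mono hn (fun l hl hl' => hbusy l (by omega) (by omega)) hput).imp
      fun _ h => h.1
  obtain ⟨acks', h'⟩ := hall' j hGj le_rfl
  rw [hacks] at h'
  cases h'
  exact ⟨G, hiG, hGj, fun n hn hn' => hall n hn hn', hsent, hall'⟩

/-- Completion happens on a delivery, and deliveries go only to processes that have not crashed. -/
theorem SuccessfulWrite.not_crash {i j : ℕ} {w : W} {v : Value P F} {t : Tag W}
    (h : E.SuccessfulWrite i j w v t) {n : ℕ} (hn : n ≤ j) :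
    E.event n ≠ .crash (.writer w) := by
  obtain ⟨hev, hij, hbusy, ⟨acks, hacks⟩, hidle⟩ := h
  rcases E.writer_busy_step (n := j) (w := w) (by rw [hacks]; simp) with
    h' | ⟨m', j', msg, out, hev, htr, hs⟩
  · rw [h', hacks] at hidle
    cases hidle
  · exact E.not_crash_of_deliver hev hn

theorem BoundedLatency.getTag_le (hτ : E.BoundedLatency τ₀ τ₁ τ₂) (hE : E.FewCrashes)
    (hk : 0 < P.k) {i G : ℕ} {w : W} {v : Value P F} (hev : E.event i = .invokeWrite w v)
    (hiG : i < G) (hcr : ∀ n ≤ G, E.event n ≠ .crash (.writer w))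
    (hG : ∀ n, i < n → n ≤ G → ∃ v resp, ((E.config n).writer w).phase = .getTag v resp) :
    E.time G ≤ E.time i + 2 * τ₁ := by
  by_contra! hlt
  obtain ⟨v', resp, hresp⟩ := hG G hiG le_rfl
  have h1 : (E.config (i + 1)).writer w = ⟨((E.config i).writer w).ops + 1, .getTag v ∅⟩ := by
    rw [E.config_succ, hev]
    simp [act, WState.invoke]
  have hmem : E.liveEdges ⊆ {j' | ∃ t', (j', t') ∈ resp} := by
    intro s hs
    have hq : ⟨.writer w, .edge s, .queryTag (((E.config i).writer w).ops + 1)⟩ ∈ E.sent i := by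
      unfold sent
      rw [hev]
      exact ⟨rfl, s, rfl⟩
    obtain ⟨a, hia, hta, ha⟩ := hτ.delivered_of_live hq hs
    have hr : ∃ t, ⟨.edge s, .writer w, .tagResp (((E.config i).writer w).ops + 1) t⟩ ∈
        E.sent a := by
      rw [E.sent_deliver_edge ha]
      exact ⟨_, rfl, rfl⟩
    obtain ⟨t, hr⟩ := hr
    simp only [linkBound] at hta
    obtain ⟨b, hab, hbG, -, hb⟩ := hτ.delivered (j := G) hr (fun n hn => hcr n hn.le)
      (by simp only [linkBound]; linarith)
    obtain ⟨v1, resp1, hr1⟩ := hG b (by omega) hbG.le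
    obtain ⟨v2, resp2, hr2⟩ := hG (b + 1) (by omega) hbG
    obtain ⟨_, -, -, hops⟩ := E.getTag_mono (show i + 1 ≤ b by omega)
      (fun l hl hl' => hG l (by omega) (by omega)) (by rw [h1])
    rw [h1] at hops
    simp only at hops
    rw [← hops] at hb
    have hmem := E.mem_resp_of_deliver hr1 hr2 hb
    obtain ⟨resp3, hr3, hsub, -⟩ := E.getTag_mono (show b + 1 ≤ G from hbG)
      (fun l hl hl' => hG l (by omega) (by omega)) hr2
    rw [hresp] at hr3
    cases hr3
    exact ⟨t, hsub hmem⟩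
  have h2 := Set.ncard_le_ncard hmem (Set.toFinite _)
  have h3 := (E.getTag_inv w G hresp).2.1 hk
  have h4 := hE.edges
  have h5 : P.n₁ = 2 * P.f₁ + P.k := rfl
  omega

/-- Live servers acknowledge within `τ₁ + 2τ₀` of the start of the phase, and `τ₁` more delivers the
acknowledgments. There are enough of them to end the phase. -/
theorem BoundedLatency.putData_le (hτ : E.BoundedLatency τ₀ τ₁ τ₂) (hE : E.FewCrashes)
    (hk : 0 < P.k) (h₀ : 0 ≤ τ₀) (h₁ : 0 ≤ τ₁) {G j : ℕ} {w : W} {t : Tag W} {v : Value P F}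
    (hsent : ∀ s : Fin P.n₁, ⟨.writer w, .edge s, .putData t v⟩ ∈ E.sent G) (hGj : G < j)
    (hcr : ∀ n ≤ j, E.event n ≠ .crash (.writer w))
    (hj : ∀ n, G < n → n ≤ j → ∃ acks, ((E.config n).writer w).phase = .putData t v acks) :
    E.time j ≤ E.time G + (2 * τ₁ + 2 * τ₀) := by
  by_contra! hlt
  obtain ⟨acks, hacks⟩ := hj j hGj le_rfl
  have hn₁ : P.n₁ = 2 * P.f₁ + P.k := rfl
  have hw := E.putData_writer (hsent ⟨0, by omega⟩)
  have hmem : E.liveEdges ⊆ acks := by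
    intro s hs
    obtain ⟨n, htn, hn | ⟨-, c, hc, hack⟩⟩ := hτ.committed hE h₀ h₁ hsent s
    · exact absurd hn (hs n)
    rw [← hw] at hack
    have htc := E.time_mono hc
    obtain ⟨b, hcb, hbj, -, hb⟩ := hτ.delivered (j := j) hack (fun n hn => hcr n hn.le)
      (by simp only [linkBound]; linarith)
    -- An acknowledgment arriving before the phase would be ignored. But it presupposes a put-data
    -- message with tag `t`, and by uniqueness of tags that message was sent in step `G`.
    have hGb : G < b := by
      obtain ⟨-, -, o, a, hac, l, w', v', ha⟩ := E.ackWrite_sent hack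
      obtain ⟨hla, hl⟩ := E.mem_sent_of_deliver ha
      have hw' := E.putData_writer hl
      rw [← hw] at hw'
      subst hw'
      obtain ⟨rfl, -⟩ := E.putData_unique hk hl (hsent o)
      omega
    obtain ⟨acks1, h1⟩ := hj b hGb hbj.le
    obtain ⟨acks2, h2⟩ := hj (b + 1) (by omega) hbj
    have hmem := E.mem_acks_of_deliver h1 h2 hb
    obtain ⟨acks3, h3, hsub⟩ := E.putData_mono (show b + 1 ≤ j from hbj)
      (fun l hl hl' => by
        obtain ⟨_, h⟩ := hj l (by omega) hl'
        rw [h]; simp) h2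
    rw [hacks] at h3
    cases h3
    exact hsub hmem
  have h2 := Set.ncard_le_ncard hmem (Set.toFinite _)
  have h3 := (E.putData_inv w j hacks).1 hk
  have h4 := hE.edges
  omega

/-- Commit takes `τ₁ + 2τ₀`, and clearing takes `2τ₂` more. The state reached is permanent:
committed tags only grow, and a covered tag does not regain a value. -/
theorem BoundedLatency.clearedAfter (hτ : E.BoundedLatency τ₀ τ₁ τ₂) (hP : P.Valid)
    (hE : E.FewCrashes) (h₀ : 0 ≤ τ₀) (h₁ : 0 ≤ τ₁) (h₂ : 0 ≤ τ₂) {G : ℕ} {w : W} {t : Tag W}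
    {v : Value P F} (hsent : ∀ s : Fin P.n₁, ⟨.writer w, .edge s, .putData t v⟩ ∈ E.sent G) :
    ∃ e, E.time e ≤ E.time G + (τ₁ + 2 * τ₀ + 2 * τ₂) ∧ E.ClearedAfter t e := by
  obtain ⟨e, -, he, hall⟩ := E.exists_common (Set.univ : Set (Fin P.n₁))
    (p := fun s n => .edge s ∈ (E.config (n + 1)).crashed ∨
      (t ≤ ((E.config (n + 1)).edge s).tc ∧ ∀ v, (t, some v) ∉ ((E.config (n + 1)).edge s).L))
    (fun s m n hmn h => by
      rcases h with h | ⟨h1, h2⟩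
      · left
        rw [crashed_iff] at h ⊢
        exact h.imp fun a h => ⟨by omega, h.2⟩
      · right
        refine ⟨h1.trans (E.tc_mono s (Nat.succ_le_succ hmn)), fun v hv => h2 v ?_⟩
        exact E.some_of_some_of_tc (Nat.succ_le_succ hmn) h1 hv)
    (n₀ := G) (T := E.time G + (τ₁ + 2 * τ₀ + 2 * τ₂)) (by linarith) (by
      intro s _
      obtain ⟨n, htn, hn | ⟨h1, -⟩⟩ := hτ.committed hE h₀ h₁ hsent s
      · exact ⟨n, by linarith, Or.inl ((E.crashed_iff _ _).2 ⟨n, Nat.lt_succ_self n, hn⟩)⟩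
      · obtain ⟨n', hnn', htn', h2⟩ := hτ.cleared hP hE h₂ h1
        exact ⟨n', by linarith, h2.imp_right fun h2 =>
          ⟨h1.trans (E.tc_mono s (Nat.succ_le_succ hnn')), h2⟩⟩)
  refine ⟨e, he, fun n hn s hs => ?_⟩
  rcases hall s trivial with h | ⟨h1, h2⟩
  · refine absurd ?_ hs
    rw [crashed_iff] at h ⊢
    exact h.imp fun a h => ⟨by omega, h.2⟩
  · have h3 : t ≤ ((E.config n).edge s).tc := h1.trans (E.tc_mono s hn)
    refine ⟨h3, fun t' v' ht' hv' => ?_⟩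
    -- Values below the committed tag do not occur, so `t' = t` is the only case left.
    have h4 := (E.edge_inv n s).tc_le_of_some _ _ hv'
    obtain rfl := le_antisymm ht' (h3.trans h4)
    exact h2 v' (E.some_of_some_of_tc hn h1 hv')

theorem BoundedLatency.write_le (hτ : E.BoundedLatency τ₀ τ₁ τ₂) (hP : P.Valid)
    (hE : E.FewCrashes) (h₀ : 0 ≤ τ₀) (h₁ : 0 ≤ τ₁) (h₂ : 0 ≤ τ₂) {i j : ℕ} {w : W}
    {v : Value P F} {t : Tag W} (h : E.SuccessfulWrite i j w v t) :
    E.time j - E.time i ≤ 4 * τ₁ + 2 * τ₀ ∧ ∃ e, E.ExtendedWrite i j e w v t ∧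
      max (E.time j) (E.time e) - E.time i ≤
        max (3 * τ₁ + 2 * τ₀ + 2 * τ₂) (4 * τ₁ + 2 * τ₀) := by
  have hk : 0 < P.k := by have := hP.f₁_lt; simp only [Params.n₁] at this; omega
  obtain ⟨G, hiG, hGj, hget, hsent, hput⟩ := h.phases
  have hG := hτ.getTag_le hE hk h.1 hiG (fun n hn => h.not_crash (by omega)) hget
  have hj := hτ.putData_le hE hk h₀ h₁ hsent hGj (fun n hn => h.not_crash hn) hput
  obtain ⟨e, he, hcl⟩ := hτ.clearedAfter hP hE h₀ h₁ h₂ hsent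
  refine ⟨by linarith, sInf {e | E.ClearedAfter t e}, ⟨h, Nat.sInf_mem ⟨e, hcl⟩,
    fun x hx => Nat.sInf_le hx⟩, ?_⟩
  have h3 := E.time_mono (Nat.sInf_le (s := {e | E.ClearedAfter t e}) hcl)
  rw [sub_le_iff_le_add, max_le_iff]
  constructor
  · have := le_max_right (3 * τ₁ + 2 * τ₀ + 2 * τ₂) (4 * τ₁ + 2 * τ₀)
    linarith
  · have := le_max_left (3 * τ₁ + 2 * τ₀ + 2 * τ₂) (4 * τ₁ + 2 * τ₀)
    linarith

end Execution
end LDS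

namespace LDS

/-! ### Tags bounded by committed tags: the local steps. -/

section Carried

variable {P : Params} {F W R : Type*} [Zero F] [LinearOrder W]

/-- The tags in messages that are bounded by a committed tag when they are sent. -/
def Msg.carried : Msg P F W R → Set (Tag W)
  | .commTagResp _ t => {t}
  | .queryData _ t => {t}
  | .dataValue _ t _ => {t}
  | .dataCoded _ t _ => {t}
  | .helperElem _ _ t _ => {t}
  | .putTag _ t => {t}
  | .writeCodeElem t _ => {t}
  | _ => ∅

variable {S : System P F W} {B : Tag W → Prop}

/-- Two outputs need an argument. A regenerated tag occurs in at least `d > 0` helper responses,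
hence in one that satisfies `B`. A put-tag without value serves a tag below the new committed tag,
whence the closure of `B` downwards. -/
theorem EdgeTrans.carried (hd : 0 < P.d) {s : Fin P.n₁} {e e' : EdgeState P F W R}
    {src : Proc P W R} {msg : Msg P F W R} {out : Out P F W R}
    (h : EdgeTrans S s e src msg e' out) (hB : ∀ t t', t ≤ t' → B t' → B t) (htc : B e'.tc)
    (hmsg : ∀ t ∈ msg.carried, B t) (hK : ∀ rq, ∀ x ∈ e.K rq, B x.2.1) :
    (∀ o ∈ out, ∀ t ∈ o.2.carried, B t) ∧ ∀ rq, ∀ x ∈ e'.K rq, B x.2.1 := by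
  classical
  have hempty : ∀ o ∈ (∅ : Out P F W R), ∀ t ∈ o.2.carried, B t := fun o ho => absurd ho id
  cases h
  case skip => exact ⟨hempty, hK⟩
  case queryTag => exact ⟨by rintro o rfl t ht; exact absurd ht id, hK⟩
  case putDataNew => exact ⟨by rintro o ⟨j', -, rfl⟩ t ht; exact absurd ht id, hK⟩
  case putDataOld =>
    exact ⟨by rintro o (⟨j', -, rfl⟩ | rfl) t ht <;> exact absurd ht id, hK⟩
  case bcastSeen => exact ⟨hempty, hK⟩
  case bcastCount => exact ⟨by rintro o ⟨-, j', rfl⟩ t ht; exact absurd ht id, hK⟩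
  case bcastAck =>
    exact ⟨by rintro o (⟨-, j', rfl⟩ | rfl) t ht <;> exact absurd ht id, hK⟩
  case bcastCommit =>
    refine ⟨?_, hK⟩
    rintro o (⟨-, j', rfl⟩ | ((rfl | ⟨r, q, treq, v, -, -, -, rfl⟩) | ⟨i, v, -, rfl⟩)) t ht
    · exact absurd ht id
    · exact absurd ht id
    · cases ht; exact htc
    · cases ht; exact htc
  case ackCodeDone => exact ⟨hempty, hK⟩
  case ackCodeCount => exact ⟨hempty, hK⟩
  case helperDone i r q t h hc =>
    have hK' : ∀ x ∈ insert (i, t, h) (e.K (r, q)), B x.2.1 := by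
      rintro x (rfl | hx)
      · exact hmsg _ rfl
      · exact hK _ x hx
    refine ⟨?_, ?_⟩
    · rintro o ⟨treq, -, ⟨t', ⟨hreg, -⟩, -, rfl⟩ | ⟨-, rfl⟩⟩ t ht
      · cases ht
        have hne : {i' | ∃ h', (i', t', h') ∈ insert (i, t, h) (e.K (r, q))}.Nonempty := by
          rw [← Set.ncard_pos (Set.toFinite _)]
          exact hd.trans_le hreg
        obtain ⟨i', h', hx⟩ := hne
        exact hK' _ hx
      · exact absurd ht id
    · intro rq x hx
      by_cases hrq : rq = (r, q)
      · subst hrq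
        simp at hx
      · simp only [Function.update_of_ne hrq] at hx
        exact hK rq x hx
  case helperCount i r q t h hc =>
    refine ⟨hempty, ?_⟩
    intro rq x hx
    by_cases hrq : rq = (r, q)
    · subst hrq
      simp only [Function.update_self] at hx
      rcases hx with rfl | hx
      · exact hmsg _ rfl
      · exact hK _ x hx
    · simp only [Function.update_of_ne hrq] at hx
      exact hK rq x hx
  case queryCommTag => exact ⟨by rintro o rfl t ht; cases ht; exact htc, hK⟩
  case queryDataReq =>
    exact ⟨by rintro o ⟨v, -, rfl⟩ t ht; cases ht; exact hmsg _ rfl, hK⟩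
  case queryDataComm => exact ⟨by rintro o ⟨v, -, rfl⟩ t ht; cases ht; exact htc, hK⟩
  case queryDataRegister => exact ⟨by rintro o ⟨v, rfl⟩ t ht; exact absurd ht id, hK⟩
  case putTagValue =>
    refine ⟨?_, hK⟩
    rintro o ((⟨r, q, treq, v, -, -, -, rfl⟩ | ⟨i, v, -, rfl⟩) | rfl) t ht
    · cases ht; exact htc
    · cases ht; exact htc
    · exact absurd ht id
  case putTagNone =>
    refine ⟨?_, hK⟩
    rintro o (⟨t', ⟨⟨hlt, -⟩, -⟩, r, q, treq, v, -, -, -, rfl⟩ | rfl) t ht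
    · cases ht; exact hB _ _ hlt.le htc
    · exact absurd ht id
  case putTagOld => exact ⟨by rintro o rfl t ht; exact absurd ht id, hK⟩

/-- All tags that a reader has learned satisfy `B`. -/
def RState.Bounded (B : Tag W → Prop) (s : RState P F W) : Prop :=
  match s.phase with
  | .getCommTag resp => ∀ x ∈ resp, B x.2
  | .getData _ resp => ∀ x ∈ resp, match x.2 with
    | .value t _ => B t
    | .coded t _ => B t
    | .fail => True
  | _ => True

/-- A decodable tag comes with at least `k > 0` coded elements, so it was received. The hypothesis
on `S.t₀` covers the default value of `maxTag`. -/
theorem RTrans.carried (hk : 0 < P.k) {s s' : RState P F W} {j : Fin P.n₁}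
    {msg : Msg P F W R} {out : Out P F W R} (h : RTrans S s j msg s' out) (h0 : B S.t₀)
    (hmsg : ∀ t ∈ msg.carried, B t) (hs : s.Bounded B) :
    (∀ o ∈ out, ∀ t ∈ o.2.carried, B t) ∧ s'.Bounded B := by
  have hempty : ∀ o ∈ (∅ : Out P F W R), ∀ t ∈ o.2.carried, B t := fun o ho => absurd ho id
  have hmax : ∀ A : Set (Tag W), (∀ t ∈ A, B t) → B (maxTag S.t₀ A) := by
    intro A hA
    rcases maxTag_mem_or S.t₀ A with h | h
    · exact hA _ h
    · rwa [h]
  cases h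
  case skip => exact ⟨hempty, hs⟩
  case tagMore resp t hph _ =>
    refine ⟨hempty, ?_⟩
    simp only [RState.Bounded, hph] at hs
    rintro x (rfl | hx)
    · exact hmsg _ rfl
    · exact hs x hx
  case tagDone resp t treq hph _ ht =>
    simp only [RState.Bounded, hph] at hs
    refine ⟨?_, fun x hx => absurd hx id⟩
    rintro o ⟨j', rfl⟩ t' ht'
    cases ht'
    rw [ht]
    refine hmax _ ?_
    rintro t'' ⟨j'', h | h⟩
    · cases h
      exact hmsg _ rfl
    · exact hs _ h
  case dataMore treq resp x hph _ =>
    refine ⟨hempty, ?_⟩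
    simp only [RState.Bounded, hph] at hs
    rintro y (rfl | hy)
    · cases x
      · exact hmsg _ rfl
      · exact hmsg _ rfl
      · trivial
    · exact hs y hy
  case dataDone treq resp x t v hph _ ht =>
    refine ⟨?_, trivial⟩
    simp only [RState.Bounded, hph] at hs
    rintro o ⟨j', rfl⟩ t' ht'
    cases ht'
    rw [ht]
    refine hmax _ ?_
    have hs' : ∀ y ∈ insert (j, x) resp, match y.2 with
        | .value t _ => B t
        | .coded t _ => B t
        | .fail => True := by
      rintro y (rfl | hy)
      · cases x
        · exact hmsg _ rfl
        · exact hmsg _ rfl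
        · trivial
      · exact hs y hy
    rintro t'' (⟨j'', v', h⟩ | h)
    · exact hs' _ h
    · have hne : {i' | ∃ c, (i', DataResp.coded t'' c) ∈ insert (j, x) resp}.Nonempty := by
        rw [← Set.ncard_pos (Set.toFinite _)]
        exact hk.trans_le h
      obtain ⟨i', c, h⟩ := hne
      exact hs' _ h
  case ackMore => exact ⟨hempty, trivial⟩
  case ackDone => exact ⟨hempty, trivial⟩

theorem BackTrans.carried {i : Fin P.n₂} {b b' : BackState P F W} {j : Fin P.n₁}
    {msg : Msg P F W R} {out : Out P F W R} (h : BackTrans S i b j msg b' out)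
    (hmsg : ∀ t ∈ msg.carried, B t) (hb : B b.t) :
    (∀ o ∈ out, ∀ t ∈ o.2.carried, B t) ∧ B b'.t := by
  cases h
  case skip => exact ⟨fun o ho => absurd ho id, hb⟩
  case writeNew => exact ⟨by rintro o rfl t ht; exact absurd ht id, hmsg _ rfl⟩
  case writeOld => exact ⟨by rintro o rfl t ht; exact absurd ht id, hb⟩
  case query => exact ⟨by rintro o rfl t ht; cases ht; exact hb, hb⟩

theorem WTrans.carried {w : W} {s s' : WState P F W} {j : Fin P.n₁}
    {msg : Msg P F W R} {out : Out P F W R} (h : WTrans S w s j msg s' out) :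
    ∀ o ∈ out, o.2.carried = ∅ := by
  cases h
  case tagDone => rintro o ⟨j', rfl⟩; rfl
  all_goals exact fun o ho => absurd ho id

end Carried

/-! ### Committed tags dominate circulating tags; the fate of outstanding reads. -/

namespace Execution

variable {P : Params} {F W : Type*} [Zero F] [LinearOrder W] {S : System P F W} {R : Type*}
  (E : Execution S R)

/-- Some first-layer server has committed a tag at least `t`. -/
def SomeCommitted (n : ℕ) (t : Tag W) : Prop := ∃ s, t ≤ ((E.config n).edge s).tc

variable {E} in
theorem SomeCommitted.mono {m n : ℕ} (hmn : m ≤ n) {t : Tag W} (h : E.SomeCommitted m t) :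
    E.SomeCommitted n t :=
  h.imp fun s h => h.trans (E.tc_mono s hmn)

theorem _root_.LDS.RState.Bounded.mono {B B' : Tag W → Prop} {s : RState P F W} (h : s.Bounded B)
    (hB : ∀ t, B t → B' t) : s.Bounded B' := by
  obtain ⟨ops, ph⟩ := s
  cases ph
  case getCommTag resp => exact fun x hx => hB _ (h x hx)
  case getData treq resp =>
    intro x hx
    have := h x hx
    rcases x with ⟨j, x⟩
    cases x
    · exact hB _ this
    · exact hB _ this
    · trivial
  all_goals trivial

/-- A new tag first travels only in the messages that `Msg.carried` leaves out, such as put-data and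
broadcasts. It gets into reads or into the second layer only through a commit. Messages, stored
pairs, helper responses and reader states pass tags to each other, hence the simultaneous induction.
-/
theorem bounded_tags (hP : P.Valid) (n : ℕ) :
    (∀ m < n, ∀ p ∈ E.sent m, ∀ t ∈ p.msg.carried, E.SomeCommitted n t) ∧
    (∀ i, E.SomeCommitted n ((E.config n).back i).t) ∧
    (∀ s rq, ∀ x ∈ ((E.config n).edge s).K rq, E.SomeCommitted n x.2.1) ∧
    ∀ r, ((E.config n).reader r).Bounded (E.SomeCommitted n) := by
  have hk : 0 < P.k := by have := hP.f₁_lt; simp only [Params.n₁] at this; omega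
  have hd : 0 < P.d := by have := hP.k_le_d; omega
  have ht₀ : ∀ n, E.SomeCommitted n S.t₀ := fun n =>
    ⟨⟨0, by simp only [Params.n₁]; omega⟩, (E.edge_inv n _).init_le⟩
  induction n with
  | zero =>
    refine ⟨fun m hm => absurd hm (Nat.not_lt_zero m), fun i => ?_, fun s rq x hx => ?_,
      fun r => ?_⟩
    · have := ht₀ 0
      rw [E.config_zero]
      exact this
    · rw [E.config_zero] at hx
      exact absurd hx id
    · rw [E.config_zero]
      trivial
  | succ n ih =>
    obtain ⟨h1, h2, h3, h4⟩ := ih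
    have hup : ∀ t, E.SomeCommitted n t → E.SomeCommitted (n + 1) t := fun t =>
      SomeCommitted.mono (Nat.le_succ n)
    have hdown : ∀ t t', t ≤ t' → E.SomeCommitted (n + 1) t' → E.SomeCommitted (n + 1) t :=
      fun t t' h h' => h'.imp fun s h' => h.trans h'
    have hmsg : ∀ {m p}, E.event n = .deliver m p → ∀ t ∈ p.msg.carried,
        E.SomeCommitted (n + 1) t := fun {m p} h t ht =>
      hup _ (h1 m (E.mem_sent_of_deliver h).1 p (E.mem_sent_of_deliver h).2 t ht)
    have hedge : ∀ s, (∀ p ∈ E.sent n, p.src = .edge s → ∀ t ∈ p.msg.carried,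
        E.SomeCommitted (n + 1) t) ∧ ∀ rq, ∀ x ∈ ((E.config (n + 1)).edge s).K rq,
          E.SomeCommitted (n + 1) x.2.1 := by
      intro s
      rcases E.edge_step n s with ⟨h, h'⟩ | ⟨m, src, msg, out, hev, htr, hs⟩
      · rw [h]
        exact ⟨fun p hp hsrc => absurd hsrc (h' p hp), fun rq x hx => hup _ (h3 s rq x hx)⟩
      · obtain ⟨h5, h6⟩ := htr.carried hd hdown ⟨s, le_rfl⟩ (hmsg hev)
          (fun rq x hx => hup _ (h3 s rq x hx))
        rw [hs]
        exact ⟨fun p hp _ => h5 _ hp.2, h6⟩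
    have hback : ∀ i, (∀ p ∈ E.sent n, p.src = .back i → ∀ t ∈ p.msg.carried,
        E.SomeCommitted (n + 1) t) ∧ E.SomeCommitted (n + 1) ((E.config (n + 1)).back i).t := by
      intro i
      rcases E.back_step n i with ⟨h, h'⟩ | ⟨m, j, msg, out, hev, htr, hs⟩
      · rw [h]
        exact ⟨fun p hp hsrc => absurd hsrc (h' p hp), hup _ (h2 i)⟩
      · obtain ⟨h5, h6⟩ := htr.carried (hmsg hev) (hup _ (h2 i))
        rw [hs]
        exact ⟨fun p hp _ => h5 _ hp.2, h6⟩
    have hreader : ∀ r, (∀ p ∈ E.sent n, p.src = .reader r → ∀ t ∈ p.msg.carried,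
        E.SomeCommitted (n + 1) t) ∧
          ((E.config (n + 1)).reader r).Bounded (E.SomeCommitted (n + 1)) := by
      intro r
      rcases E.reader_step n r with ⟨h, h'⟩ | ⟨-, h, hs⟩ | ⟨m, j, msg, out, hev, htr, hs⟩
      · rw [h]
        exact ⟨fun p hp hsrc => absurd hsrc (h' p hp), (h4 r).mono hup⟩
      · rw [h, hs]
        refine ⟨?_, fun x hx => absurd hx id⟩
        rintro ⟨src, dst, msg⟩ ⟨-, j, hj⟩ - t ht
        cases hj
        exact absurd ht id
      · obtain ⟨h5, h6⟩ := htr.carried hk (ht₀ _) (hmsg hev) ((h4 r).mono hup)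
        rw [hs]
        exact ⟨fun p hp _ => h5 _ hp.2, h6⟩
    have hwriter : ∀ w, ∀ p ∈ E.sent n, p.src = .writer w → p.msg.carried = ∅ := by
      intro w
      rcases E.writer_step n w with ⟨h, h'⟩ | ⟨v, -, h, hs⟩ | ⟨m, j, msg, out, hev, htr, hs⟩
      · exact fun p hp hsrc => absurd hsrc (h' p hp)
      · rw [hs]
        rintro ⟨src, dst, msg⟩ ⟨-, j, hj⟩ -
        cases hj
        rfl
      · rw [hs]
        exact fun p hp _ => htr.carried _ hp.2
    refine ⟨fun m hm p hp t ht => ?_, fun i => (hback i).2, fun s => (hedge s).2,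
      fun r => (hreader r).2⟩
    rcases Nat.lt_succ_iff_lt_or_eq.1 hm with hm | rfl
    · exact hup _ (h1 m hm p hp t ht)
    · rcases hsrc : p.src with w | r | s | i
      · rw [hwriter w p hp hsrc] at ht
        exact absurd ht id
      · exact (hreader r).1 p hp hsrc t ht
      · exact (hedge s).1 p hp hsrc t ht
      · exact (hback i).1 p hp hsrc t ht

/-- The first server to commit a tag has consumed enough broadcasts of it. -/
theorem first_commit (hP : P.Valid) {X : ℕ} {t : Tag W}
    (hX : ∀ s, ((E.config X).edge s).tc < t) {s : Fin P.n₁}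
    (hs : ((E.config (X + 1)).edge s).tc = t) :
    P.f₁ + P.k ≤ {o | (o, t) ∈ ((E.config (X + 1)).edge s).seen}.ncard := by
  -- A put-tag message carries a tag dominated by a tag committed before, while before step `X` all
  -- committed tags are below `t`. So broadcasts caused the commit.
  have hput : ∀ {m : ℕ} {r : R} {q : ℕ} {t' : Tag W},
      E.event X = .deliver m ⟨.reader r, .edge s, .putTag q t'⟩ → t' ≠ t := by
    rintro m r q t' h rfl
    obtain ⟨hm, hp⟩ := E.mem_sent_of_deliver h
    obtain ⟨s', hs'⟩ := (E.bounded_tags hP X).1 m hm _ hp t' rfl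
    exact absurd (hX s') (not_lt.2 hs')
  have hinv := (E.edge_inv (X + 1) s).counter_eq t
  rcases E.edge_step X s with ⟨h', -⟩ | ⟨m, src, msg, out, hev, htr, -⟩
  · rw [h'] at hs
    exact absurd hs (hX s).ne
  · generalize (E.config (X + 1)).edge s = e' at htr hs hinv ⊢
    rw [← hinv]
    cases htr <;> try exact absurd hs (hX s).ne
    case bcastCommit o' origin t' h hL hc hlt =>
      subst hs
      simp only [Function.update_self]
      exact hc
    case putTagValue => exact absurd hs (hput hev)
    case putTagNone => exact absurd hs (hput hev)

/-- A `⊥` arises initially, by garbage collection below the committed tag, by a put-tag for the new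
committed tag, or after acknowledgments from the second layer, which presuppose a commit. -/
theorem le_tc_of_none (n : ℕ) {s : Fin P.n₁} {t : Tag W}
    (h : (t, none) ∈ ((E.config n).edge s).L) : t ≤ ((E.config n).edge s).tc := by
  induction n with
  | zero =>
    rw [E.config_zero] at h ⊢
    cases h
    exact le_rfl
  | succ n ih =>
    have hle : ((E.config n).edge s).tc ≤ ((E.config (n + 1)).edge s).tc :=
      E.tc_mono s (Nat.le_succ n)
    rcases E.edge_step n s with ⟨h', -⟩ | ⟨m, src, msg, out, hev, htr, -⟩
    · rw [h'] at h ⊢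
      exact ih h
    · generalize (E.config (n + 1)).edge s = e' at htr h hle ⊢
      cases htr <;> try exact ih h
      case putDataNew =>
        rcases h with h | h
        · cases h
        · exact ih h
      case bcastCommit =>
        rcases collect_none h with h | h
        · exact (ih h).trans hle
        · exact h.le
      case ackCodeDone i t' hc =>
        rcases h with h | h
        · exact ih h.1
        · cases h
          exact E.le_tc_of_ackCodeElem hev
      case putTagValue =>
        rcases collect_none h with h | h
        · exact (ih h).trans hle
        · exact h.le
      case putTagNone =>
        rcases collect_none h with (h | h) | h
        · cases h
          exact le_rfl
        · exact (ih h).trans hle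
        · exact h.le

theorem exists_some_of_tag {n : ℕ} {s : Fin P.n₁} {t : Tag W}
    (h : ∃ x, (t, x) ∈ ((E.config n).edge s).L) (ht : ((E.config n).edge s).tc < t) :
    ∃ v, (t, some v) ∈ ((E.config n).edge s).L := by
  obtain ⟨x, h⟩ := h
  cases x with
  | none => exact absurd (E.le_tc_of_none n h) (not_le.2 ht)
  | some v => exact ⟨v, h⟩

/-- Committing a tag when a lower or equal tag has a value serves the outstanding reads. -/
theorem serves_of_commit {n : ℕ} {s : Fin P.n₁} {t : Tag W} {v : Value P F} {r : R} {q : ℕ}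
    {treq : Tag W} (hlt : ((E.config n).edge s).tc < t)
    (hge : t ≤ ((E.config (n + 1)).edge s).tc) (hv : (t, some v) ∈ ((E.config n).edge s).L)
    (hΓ : (r, q, treq) ∈ ((E.config n).edge s).Γ) (ht : treq ≤ t)
    (hput : ∀ m t', E.event n ≠ .deliver m ⟨.reader r, .edge s, .putTag q t'⟩) :
    ∃ t' v', ⟨.edge s, .reader r, .dataValue q t' v'⟩ ∈ E.sent n := by
  rcases E.edge_step n s with ⟨h', -⟩ | ⟨m, src, msg, out, hev, htr, hs⟩
  · rw [h'] at hge
    exact absurd hlt (not_lt.2 hge)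
  · rw [hs]
    have hfin := (E.edge_inv n s).finite
    have hsome := fun t' => E.exists_some_of_tag (n := n) (s := s) (t := t')
    generalize (E.config (n + 1)).edge s = e' at htr hge
    cases htr <;> try exact absurd hlt (not_lt.2 hge)
    case bcastCommit o' origin t' h hL hc hlt' =>
      obtain ⟨v', hv'⟩ := hsome t' hL hlt'
      exact ⟨t', v', rfl, Or.inr (Or.inl (Or.inr ⟨r, q, treq, v', hΓ, ht.trans hge, hv', rfl⟩))⟩
    case putTagValue r' q' t' hlt' hv' =>
      obtain ⟨v', hv'⟩ := hv'
      refine ⟨t', v', rfl, Or.inl (Or.inl ⟨r, q, treq, v', ⟨hΓ, ?_⟩, ht.trans hge, hv', rfl⟩)⟩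
      rintro ⟨rfl, rfl⟩
      exact hput _ _ hev
    case putTagNone r' q' t' hlt' hv' =>
      -- The put-tag jumps over `t`. As `t` has a value, the highest tag with a value below `t'` is
      -- at least `t`, hence high enough for this read.
      have htt : t ∈ {t'' | t'' < t' ∧ ∃ v, (t'', some v) ∈ ((E.config n).edge s).L} := by
        refine ⟨lt_of_le_of_ne hge ?_, v, hv⟩
        rintro rfl
        exact hv' ⟨v, hv⟩
      obtain ⟨g, hg, hmax⟩ := (hfin.subset (show {t'' | t'' < t' ∧ ∃ v, (t'', some v) ∈
        ((E.config n).edge s).L} ⊆ _ from fun x hx => ⟨_, hx.2.choose_spec⟩)).exists_maximal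
        ⟨t, htt⟩
      have hgr : IsGreatest {t'' | t'' < t' ∧ ∃ v, (t'', some v) ∈ ((E.config n).edge s).L} g :=
        ⟨hg, fun x hx => (le_total x g).elim id fun h => hmax hx h⟩
      obtain ⟨-, v', hg'⟩ := hg
      refine ⟨g, v', rfl, Or.inl ⟨g, hgr, r, q, treq, v', ⟨hΓ, ?_⟩, ht.trans (hgr.2 htt), hg',
        rfl⟩⟩
      rintro ⟨rfl, rfl⟩
      exact hput _ _ hev

/-- A read leaves the set of outstanding reads only when it is served or when it puts its tag. -/
theorem outstanding_or_served {A n : ℕ} (hAn : A ≤ n) {s : Fin P.n₁} {r : R} {q : ℕ}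
    {treq : Tag W} (hΓ : (r, q, treq) ∈ ((E.config A).edge s).Γ)
    (hput : ∀ l < n, ∀ m t', E.event l ≠ .deliver m ⟨.reader r, .edge s, .putTag q t'⟩) :
    (r, q, treq) ∈ ((E.config n).edge s).Γ ∨
      ∃ c, A ≤ c ∧ c < n ∧ ∃ t' v', ⟨.edge s, .reader r, .dataValue q t' v'⟩ ∈ E.sent c := by
  induction n, hAn using Nat.le_induction with
  | base => exact Or.inl hΓ
  | succ n hAn ih =>
    rcases ih fun l hl => hput l (by omega) with ih | ⟨c, h1, h2, h3⟩
    swap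
    · exact Or.inr ⟨c, h1, by omega, h3⟩
    specialize hput n (Nat.lt_succ_self n)
    suffices h : (r, q, treq) ∈ ((E.config (n + 1)).edge s).Γ ∨
        ∃ t' v', ⟨.edge s, .reader r, .dataValue q t' v'⟩ ∈ E.sent n from
      h.imp_right fun h => ⟨n, hAn, Nat.lt_succ_self n, h⟩
    rcases E.edge_step n s with ⟨h', -⟩ | ⟨m, src, msg, out, hev, htr, hs⟩
    · rw [h']
      exact Or.inl ih
    · rw [hs]
      have hsome := fun t' => E.exists_some_of_tag (n := n) (s := s) (t := t')
      generalize (E.config (n + 1)).edge s = e' at htr ⊢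
      cases htr <;> try exact Or.inl ih
      case bcastCommit o' origin t' h hL hc hlt' =>
        by_cases ht : treq ≤ t'
        · obtain ⟨v', hv'⟩ := hsome t' hL hlt'
          exact Or.inr ⟨t', v', rfl, Or.inr (Or.inl (Or.inr ⟨r, q, treq, v', ih, ht, hv', rfl⟩))⟩
        · exact Or.inl ⟨ih, ht⟩
      case queryDataRegister => exact Or.inl (Or.inr ih)
      case putTagValue r' q' t' hlt' hv' =>
        have hne : ¬ (r = r' ∧ q = q') := by
          rintro ⟨rfl, rfl⟩
          exact hput _ _ hev
        by_cases ht : treq ≤ t'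
        · obtain ⟨v', hv'⟩ := hv'
          exact Or.inr ⟨t', v', rfl, Or.inl (Or.inl ⟨r, q, treq, v', ⟨ih, hne⟩, ht, hv', rfl⟩)⟩
        · exact Or.inl ⟨⟨ih, hne⟩, ht⟩
      case putTagNone r' q' t' hlt' hv' =>
        have hne : ¬ (r = r' ∧ q = q') := by
          rintro ⟨rfl, rfl⟩
          exact hput _ _ hev
        by_cases ht : ∃ g, IsGreatest {t'' | t'' < t' ∧ ∃ v, (t'', some v) ∈
            ((E.config n).edge s).L} g ∧ treq ≤ g
        · obtain ⟨g, hg, hge⟩ := ht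
          obtain ⟨-, v', hv'⟩ := hg.1
          exact Or.inr ⟨g, v', rfl, Or.inl ⟨g, hg, r, q, treq, v', ⟨ih, hne⟩, hge, hv', rfl⟩⟩
        · exact Or.inl ⟨⟨ih, hne⟩, ht⟩
      case putTagOld r' q' t' _ =>
        refine Or.inl ⟨ih, ?_⟩
        rintro ⟨rfl, rfl⟩
        exact hput _ _ hev

end Execution
end LDS

namespace LDS
namespace Execution

variable {P : Params} {F W : Type*} [Zero F] [LinearOrder W] {S : System P F W} {R : Type*}
  (E : Execution S R)

/-! ### The phases of a read -/

theorem reader_busy_step {n : ℕ} {r : R} (h : ((E.config n).reader r).phase ≠ .idle) :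
    (E.config (n + 1)).reader r = (E.config n).reader r ∨
    ∃ m j msg out, E.event n = .deliver m ⟨.edge j, .reader r, msg⟩ ∧
      RTrans S ((E.config n).reader r) j msg ((E.config (n + 1)).reader r) out ∧
      E.sent n = packets (.reader r) out := by
  rcases E.reader_step n r with h' | ⟨h', -⟩ | h'
  · exact Or.inl h'.1
  · exact absurd (E.invokeRead_ok _ _ h').2 h
  · exact Or.inr h'

theorem reader_ops_const {m n : ℕ} (hmn : m ≤ n) {r : R}
    (h : ∀ l, m ≤ l → l < n → ((E.config l).reader r).phase ≠ .idle) :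
    ((E.config n).reader r).ops = ((E.config m).reader r).ops := by
  induction n, hmn using Nat.le_induction with
  | base => rfl
  | succ n hmn ih =>
    rw [← ih fun l hl hl' => h l hl (by omega)]
    rcases E.reader_busy_step (h n hmn (Nat.lt_succ_self n)) with h' | ⟨_, j, msg, out, -, htr, -⟩
    · rw [h']
    · generalize (E.config (n + 1)).reader r = b' at htr ⊢
      cases htr <;> rfl

/-- Each phase ends in the step that fulfils its condition; `0 < P.k` handles the empty sets at the
start of a phase. -/
theorem reader_inv (hk : 0 < P.k) (r : R) (n : ℕ) :
    match ((E.config n).reader r).phase with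
    | .idle => True
    | .getCommTag resp => {j' | ∃ t', (j', t') ∈ resp}.ncard < P.f₁ + P.k
    | .getData _ resp => ¬ (P.f₁ + P.k ≤ {j' | ∃ y, (j', y) ∈ resp}.ncard ∧
        (availableTags resp).Nonempty)
    | .putTag _ _ acks => acks.ncard < P.f₁ + P.k := by
  induction n with
  | zero =>
    rw [E.config_zero]
    trivial
  | succ n ih =>
    rcases E.reader_step n r with ⟨h, -⟩ | ⟨-, h, -⟩ | ⟨m, j, msg, out, -, htr, -⟩
    · rwa [h]
    · rw [h]
      simp
      omega
    · generalize (E.config (n + 1)).reader r = b' at htr ⊢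
      cases htr
      case skip => exact ih
      case tagMore _ _ _ h => exact not_le.1 h
      case tagDone =>
        simp
        omega
      case dataMore _ _ _ _ h => exact h
      case dataDone =>
        simp
        omega
      case ackMore _ _ _ _ h => exact not_le.1 h
      case ackDone => trivial

theorem getCommTag_mono {m n : ℕ} (hmn : m ≤ n) {r : R}
    (h : ∀ l, m ≤ l → l ≤ n → ∃ resp, ((E.config l).reader r).phase = .getCommTag resp)
    {resp : Set (Fin P.n₁ × Tag W)} (hm : ((E.config m).reader r).phase = .getCommTag resp) :
    ∃ resp', ((E.config n).reader r).phase = .getCommTag resp' ∧ resp ⊆ resp' := by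
  induction n, hmn using Nat.le_induction with
  | base => exact ⟨resp, hm, subset_rfl⟩
  | succ n hmn ih =>
    obtain ⟨resp', h1, h2⟩ := ih fun l hl hl' => h l hl (by omega)
    obtain ⟨resp'', hn⟩ := h (n + 1) (by omega) le_rfl
    rcases E.reader_busy_step (n := n) (r := r) (by rw [h1]; simp) with
      h' | ⟨m', j, msg, out, hev, htr, -⟩
    · rw [h']
      exact ⟨resp', h1, h2⟩
    · generalize (E.config (n + 1)).reader r = b' at htr hn ⊢
      cases htr
      case skip => exact ⟨resp', h1, h2⟩
      case tagMore resp0 t hph _ =>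
        rw [h1] at hph
        cases hph
        exact ⟨_, rfl, h2.trans (Set.subset_insert _ _)⟩
      all_goals cases hn

theorem getData_mono {m n : ℕ} (hmn : m ≤ n) {r : R}
    (h : ∀ l, m ≤ l → l ≤ n → ∃ treq resp, ((E.config l).reader r).phase = .getData treq resp)
    {treq : Tag W} {resp : Set (Fin P.n₁ × DataResp P F W)}
    (hm : ((E.config m).reader r).phase = .getData treq resp) :
    ∃ resp', ((E.config n).reader r).phase = .getData treq resp' ∧ resp ⊆ resp' := by
  induction n, hmn using Nat.le_induction with
  | base => exact ⟨resp, hm, subset_rfl⟩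
  | succ n hmn ih =>
    obtain ⟨resp', h1, h2⟩ := ih fun l hl hl' => h l hl (by omega)
    obtain ⟨treq', resp'', hn⟩ := h (n + 1) (by omega) le_rfl
    rcases E.reader_busy_step (n := n) (r := r) (by rw [h1]; simp) with
      h' | ⟨m', j, msg, out, hev, htr, -⟩
    · rw [h']
      exact ⟨resp', h1, h2⟩
    · generalize (E.config (n + 1)).reader r = b' at htr hn ⊢
      cases htr
      case skip => exact ⟨resp', h1, h2⟩
      case dataMore treq0 resp0 x hph _ =>
        rw [h1] at hph
        cases hph
        exact ⟨_, rfl, h2.trans (Set.subset_insert _ _)⟩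
      case tagMore _ _ hph _ => rw [h1] at hph; cases hph
      case tagDone _ _ _ hph _ _ => rw [h1] at hph; cases hph
      all_goals cases hn

theorem putTag_mono {m n : ℕ} (hmn : m ≤ n) {r : R}
    (h : ∀ l, m ≤ l → l ≤ n → ((E.config l).reader r).phase ≠ .idle) {t : Tag W}
    {v : Value P F} {acks : Set (Fin P.n₁)}
    (hm : ((E.config m).reader r).phase = .putTag t v acks) :
    ∃ acks', ((E.config n).reader r).phase = .putTag t v acks' ∧ acks ⊆ acks' := by
  induction n, hmn using Nat.le_induction with
  | base => exact ⟨acks, hm, subset_rfl⟩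
  | succ n hmn ih =>
    obtain ⟨acks', h1, h2⟩ := ih fun l hl hl' => h l hl (by omega)
    have hn := h (n + 1) (by omega) le_rfl
    rcases E.reader_busy_step (n := n) (r := r) (by rw [h1]; simp) with
      h' | ⟨m', j, msg, out, hev, htr, -⟩
    · rw [h']
      exact ⟨acks', h1, h2⟩
    · generalize (E.config (n + 1)).reader r = b' at htr hn ⊢
      cases htr
      case skip => exact ⟨acks', h1, h2⟩
      case ackMore t0 v0 acks0 hph _ =>
        rw [h1] at hph
        cases hph
        exact ⟨_, rfl, h2.trans (Set.subset_insert _ _)⟩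
      case ackDone => exact absurd rfl hn
      case tagMore _ _ hph _ => rw [h1] at hph; cases hph
      case tagDone _ _ _ hph _ _ => rw [h1] at hph; cases hph
      case dataMore _ _ _ hph _ => rw [h1] at hph; cases hph
      case dataDone _ _ _ _ _ hph _ _ => rw [h1] at hph; cases hph

theorem mem_commTagResp_of_deliver {n m : ℕ} {r : R} {s : Fin P.n₁} {t : Tag W}
    {resp resp' : Set (Fin P.n₁ × Tag W)}
    (hph : ((E.config n).reader r).phase = .getCommTag resp)
    (hph' : ((E.config (n + 1)).reader r).phase = .getCommTag resp')
    (h : E.event n =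
      .deliver m ⟨.edge s, .reader r, .commTagResp ((E.config n).reader r).ops t⟩) :
    (s, t) ∈ resp' := by
  have h' := E.reader_deliver h
  simp only [RState.recv, hph, if_true] at h'
  split_ifs at h'
  · rw [h'] at hph'
    cases hph'
  · rw [h'] at hph'
    cases hph'
    exact Set.mem_insert _ _

theorem mem_dataResp_of_deliver {n m : ℕ} {r : R} {s : Fin P.n₁} {x : DataResp P F W}
    {treq treq' : Tag W} {resp resp' : Set (Fin P.n₁ × DataResp P F W)}
    (hph : ((E.config n).reader r).phase = .getData treq resp)
    (hph' : ((E.config (n + 1)).reader r).phase = .getData treq' resp')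
    (h : E.event n =
      .deliver m ⟨.edge s, .reader r, respMsg ((E.config n).reader r).ops x⟩) :
    (s, x) ∈ resp' := by
  have h' := E.reader_deliver h
  have h'' : ((E.config n).reader r).recv S s
      (respMsg ((E.config n).reader r).ops x : Msg P F W R) =
      ((E.config n).reader r).recvData S s ((E.config n).reader r).ops x := by
    cases x <;> rfl
  rw [h''] at h'
  simp only [RState.recvData, hph, if_true] at h'
  split_ifs at h'
  · rw [h'] at hph'
    cases hph'
  · rw [h'] at hph'
    cases hph'
    exact Set.mem_insert _ _

theorem mem_readAcks_of_deliver {n m : ℕ} {r : R} {s : Fin P.n₁} {t t' : Tag W}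
    {v v' : Value P F} {acks acks' : Set (Fin P.n₁)}
    (hph : ((E.config n).reader r).phase = .putTag t v acks)
    (hph' : ((E.config (n + 1)).reader r).phase = .putTag t' v' acks')
    (h : E.event n = .deliver m ⟨.edge s, .reader r, .ackRead ((E.config n).reader r).ops⟩) :
    s ∈ acks' := by
  have h' := E.reader_deliver h
  simp only [RState.recv, hph, if_true] at h'
  split_ifs at h'
  · rw [h'] at hph'
    cases hph'
  · rw [h'] at hph'
    cases hph'
    exact Set.mem_insert _ _

theorem queryData_sent {n q : ℕ} {r : R} {dst : Proc P W R} {treq : Tag W}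
    (h : ⟨.reader r, dst, .queryData q treq⟩ ∈ E.sent n) :
    ((E.config n).reader r).ops = q ∧ (∃ resp, ((E.config n).reader r).phase = .getCommTag resp) ∧
      ((E.config (n + 1)).reader r).phase = .getData treq ∅ := by
  rcases E.reader_step n r with ⟨-, h'⟩ | ⟨-, h', hs⟩ | ⟨m, j, msg, out, hev, h', hs⟩
  · exact absurd rfl (h' _ h)
  · rw [hs] at h
    obtain ⟨-, j, hj⟩ := h
    cases hj
  · rw [hs] at h
    have h := h.2
    generalize (E.config (n + 1)).reader r = b' at h' ⊢
    cases h'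
    case tagDone resp t treq' hph _ _ _ =>
      obtain ⟨j', hj⟩ := h
      cases hj
      exact ⟨rfl, ⟨_, hph⟩, rfl⟩
    case dataDone =>
      obtain ⟨j', hj⟩ := h
      cases hj
    all_goals exact absurd h id

theorem putTag_sent {n q : ℕ} {r : R} {dst : Proc P W R} {t : Tag W}
    (h : ⟨.reader r, dst, .putTag q t⟩ ∈ E.sent n) :
    ((E.config n).reader r).ops = q ∧
      (∃ treq resp, ((E.config n).reader r).phase = .getData treq resp) ∧
      ∃ v, ((E.config (n + 1)).reader r).phase = .putTag t v ∅ := by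
  rcases E.reader_step n r with ⟨-, h'⟩ | ⟨-, h', hs⟩ | ⟨m, j, msg, out, hev, h', hs⟩
  · exact absurd rfl (h' _ h)
  · rw [hs] at h
    obtain ⟨-, j, hj⟩ := h
    cases hj
  · rw [hs] at h
    have h := h.2
    generalize (E.config (n + 1)).reader r = b' at h' ⊢
    cases h'
    case dataDone treq resp x t' v hph _ _ _ =>
      obtain ⟨j', hj⟩ := h
      cases hj
      exact ⟨rfl, ⟨_, _, hph⟩, v, rfl⟩
    case tagDone =>
      obtain ⟨j', hj⟩ := h
      cases hj
    all_goals exact absurd h id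

/-- Operation `q` of reader `r` requests data for `treq` in step `G`, and is still collecting the
responses just before step `J`. -/
structure GetData (r : R) (q G J : ℕ) (treq : Tag W) : Prop where
  lt : G < J
  sent : ∀ s : Fin P.n₁, ⟨.reader r, .edge s, .queryData q treq⟩ ∈ E.sent G
  unique : ∀ n ≤ J, ∀ dst treq', ⟨.reader r, dst, .queryData q treq'⟩ ∈ E.sent n →
    n = G ∧ treq' = treq
  no_putTag : ∀ n < J, ∀ dst t, ⟨.reader r, dst, .putTag q t⟩ ∉ E.sent n
  phase : ∀ n, G < n → n ≤ J → ∃ treq resp, ((E.config n).reader r).phase = .getData treq resp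
  ops : ∀ n, G < n → n ≤ J → ((E.config n).reader r).ops = q
  not_crash : ∀ n ≤ J, E.event n ≠ .crash (.reader r)

variable {E}

/-- The read is cut at `G` and `J`, the steps that send the data requests and the put-tags. The rest
of `GetData` holds because `ops` equals `q` only from the invocation on: requests and put-tags
numbered `q` cannot come from an earlier operation. -/
theorem SuccessfulRead.phases {i j : ℕ} {r : R} {t : Tag W} {v : Value P F}
    (h : E.SuccessfulRead i j r t v) :
    ∃ q G J treq t', i < G ∧ G < J ∧ J < j ∧ E.GetData r q G J treq ∧
      (∀ n, i < n → n ≤ j → ((E.config n).reader r).ops = q) ∧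
      (∀ n, i < n → n ≤ G → ∃ resp, ((E.config n).reader r).phase = .getCommTag resp) ∧
      (∀ s : Fin P.n₁, ⟨.reader r, .edge s, .queryCommTag q⟩ ∈ E.sent i) ∧
      (∀ s : Fin P.n₁, ⟨.reader r, .edge s, .putTag q t'⟩ ∈ E.sent J) ∧
      (∀ n, J < n → n ≤ j → ∃ t v acks, ((E.config n).reader r).phase = .putTag t v acks) ∧
      ∀ n ≤ j, E.event n ≠ .crash (.reader r) := by
  obtain ⟨hev, hij, hbusy, ⟨acks, hacks⟩, hidle⟩ := h
  have h1 : (E.config (i + 1)).reader r = ⟨((E.config i).reader r).ops + 1, .getCommTag ∅⟩ := by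
    rw [E.config_succ, hev]
    simp [act, RState.invoke]
  have hops : ∀ n, i < n → n ≤ j →
      ((E.config n).reader r).ops = ((E.config i).reader r).ops + 1 := by
    intro n hn hn'
    rw [E.reader_ops_const (show i + 1 ≤ n from hn)
      (fun l hl hl' => hbusy l (by omega) (by omega)), h1]
  have hcr : ∀ n ≤ j, E.event n ≠ .crash (.reader r) := by
    intro n hn
    rcases E.reader_busy_step (n := j) (r := r) (by rw [hacks]; simp) with
      h' | ⟨m', j', msg, out, hev, htr, hs⟩
    · rw [h', hacks] at hidle
      cases hidle
    · exact E.not_crash_of_deliver hev hn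
  obtain ⟨G, hiG, hGj, hallG, hG⟩ := exists_last
    (p := fun n => ∃ resp, ((E.config n).reader r).phase = .getCommTag resp)
    (show i + 1 ≤ j from hij) ⟨∅, by rw [h1]⟩ (by rw [hacks]; simp)
  obtain ⟨resp, hresp⟩ := hallG G hiG le_rfl
  have hGb := hbusy (G + 1) (by omega) hGj
  obtain ⟨treq, hsentG, hphG⟩ : ∃ treq, (∀ s : Fin P.n₁, ⟨.reader r, .edge s,
      .queryData ((E.config G).reader r).ops treq⟩ ∈ E.sent G) ∧
      ((E.config (G + 1)).reader r).phase = .getData treq ∅ := by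
    rcases E.reader_busy_step (n := G) (r := r) (by rw [hresp]; simp) with
      h' | ⟨m', j, msg, out, hev, htr, hs⟩
    · exact absurd ⟨resp, by rw [h', hresp]⟩ hG
    · rw [hs]
      generalize (E.config (G + 1)).reader r = b' at htr hG ⊢
      cases htr
      case skip => exact absurd ⟨resp, hresp⟩ hG
      case tagMore => exact absurd ⟨_, rfl⟩ hG
      case tagDone => exact ⟨_, fun s => ⟨rfl, s, rfl⟩, rfl⟩
      case dataMore _ _ _ hph _ => rw [hresp] at hph; cases hph
      case dataDone _ _ _ _ _ hph _ _ => rw [hresp] at hph; cases hph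
      case ackMore _ _ _ hph _ => rw [hresp] at hph; cases hph
      case ackDone _ _ _ hph _ => rw [hresp] at hph; cases hph
  obtain ⟨J, hGJ, hJj, hallJ, hJ⟩ := exists_last
    (p := fun n => ∃ treq resp, ((E.config n).reader r).phase = .getData treq resp)
    (show G + 1 ≤ j from hGj) ⟨treq, ∅, hphG⟩ (by rw [hacks]; simp)
  obtain ⟨treq', resp', hresp'⟩ := hallJ J hGJ le_rfl
  have hJb := hbusy (J + 1) (by omega) hJj
  obtain ⟨t', v', hsentJ, hphJ⟩ : ∃ t' v', (∀ s : Fin P.n₁, ⟨.reader r, .edge s,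
      .putTag ((E.config J).reader r).ops t'⟩ ∈ E.sent J) ∧
      ((E.config (J + 1)).reader r).phase = .putTag t' v' ∅ := by
    rcases E.reader_busy_step (n := J) (r := r) (by rw [hresp']; simp) with
      h' | ⟨m', j, msg, out, hev, htr, hs⟩
    · exact absurd ⟨treq', resp', by rw [h', hresp']⟩ hJ
    · rw [hs]
      generalize (E.config (J + 1)).reader r = b' at htr hJ ⊢
      cases htr
      case skip => exact absurd ⟨treq', resp', hresp'⟩ hJ
      case dataMore => exact absurd ⟨_, _, rfl⟩ hJ
      case dataDone => exact ⟨_, _, fun s => ⟨rfl, s, rfl⟩, rfl⟩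
      case tagMore _ _ hph _ => rw [hresp'] at hph; cases hph
      case tagDone _ _ _ hph _ _ => rw [hresp'] at hph; cases hph
      case ackMore _ _ _ hph _ => rw [hresp'] at hph; cases hph
      case ackDone _ _ _ hph _ => rw [hresp'] at hph; cases hph
  rw [hops G (by omega) (by omega)] at hsentG
  rw [hops J (by omega) (by omega)] at hsentJ
  have hlow : ∀ n ≤ i, ((E.config n).reader r).ops ≠ ((E.config i).reader r).ops + 1 := by
    intro n hn
    have := E.reader_ops_mono r hn
    simp only at this
    omega
  refine ⟨((E.config i).reader r).ops + 1, G, J, treq, t', hiG, hGJ, hJj, ?_, hops,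
    fun n hn hn' => hallG n hn hn', ?_, hsentJ, ?_, hcr⟩
  · refine ⟨hGJ, hsentG, ?_, ?_, fun n hn hn' => hallJ n hn hn',
      fun n hn hn' => hops n (by omega) (by omega), fun n hn => hcr n (by omega)⟩
    · intro n hn dst treq1 h
      obtain ⟨hq, ⟨resp1, hph⟩, hph'⟩ := E.queryData_sent h
      have hni : i < n := by
        by_contra hni
        exact hlow n (not_lt.1 hni) hq
      have hnG : n = G := by
        rcases lt_trichotomy n G with hlt | rfl | hlt
        · obtain ⟨_, h'⟩ := hallG (n + 1) (by omega) hlt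
          rw [hph'] at h'
          cases h'
        · rfl
        · obtain ⟨_, _, h'⟩ := hallJ n hlt hn
          rw [hph] at h'
          cases h'
      subst hnG
      rw [hphG] at hph'
      cases hph'
      exact ⟨rfl, rfl⟩
    · intro n hn dst t1 h
      obtain ⟨hq, ⟨treq1, resp1, hph⟩, v1, hph'⟩ := E.putTag_sent h
      have hni : i < n := by
        by_contra hni
        exact hlow n (not_lt.1 hni) hq
      rcases le_or_gt n G with hle | hlt
      · obtain ⟨_, h'⟩ := hallG n hni hle
        rw [hph] at h'
        cases h'
      · obtain ⟨_, _, h'⟩ := hallJ (n + 1) (by omega) hn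
        rw [hph'] at h'
        cases h'
  · intro s
    unfold Execution.sent
    rw [hev]
    exact ⟨rfl, s, rfl⟩
  · intro n hn hn'
    obtain ⟨acks', h', -⟩ := E.putTag_mono (show J + 1 ≤ n from hn)
      (fun l hl hl' => hbusy l (by omega) (by omega)) hphJ
    exact ⟨_, _, _, h'⟩

/-! ### Round trips in the first and the last phase of a read. -/

variable {τ₀ τ₁ τ₂ : ℝ}

theorem BoundedLatency.getCommTag_le (hτ : E.BoundedLatency τ₀ τ₁ τ₂) (hE : E.FewCrashes)
    (hk : 0 < P.k) {i G q : ℕ} {r : R} (hiG : i < G)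
    (hcr : ∀ n ≤ G, E.event n ≠ .crash (.reader r))
    (hsent : ∀ s : Fin P.n₁, ⟨.reader r, .edge s, .queryCommTag q⟩ ∈ E.sent i)
    (hops : ∀ n, i < n → n ≤ G → ((E.config n).reader r).ops = q)
    (hG : ∀ n, i < n → n ≤ G → ∃ resp, ((E.config n).reader r).phase = .getCommTag resp) :
    E.time G ≤ E.time i + 2 * τ₁ := by
  by_contra! hlt
  obtain ⟨resp, hresp⟩ := hG G hiG le_rfl
  have hmem : E.liveEdges ⊆ {j' | ∃ t', (j', t') ∈ resp} := by
    intro s hs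
    obtain ⟨a, hia, hta, ha⟩ := hτ.delivered_of_live (hsent s) hs
    have hr : ⟨.edge s, .reader r, .commTagResp q ((E.config a).edge s).tc⟩ ∈ E.sent a := by
      rw [E.sent_deliver_edge ha]
      exact ⟨rfl, rfl⟩
    simp only [linkBound] at hta
    obtain ⟨b, hab, hbG, -, hb⟩ := hτ.delivered (j := G) hr (fun n hn => hcr n hn.le)
      (by simp only [linkBound]; linarith)
    obtain ⟨resp1, hr1⟩ := hG b (by omega) hbG.le
    obtain ⟨resp2, hr2⟩ := hG (b + 1) (by omega) hbG
    rw [← hops b (by omega) hbG.le] at hb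
    have hmem := E.mem_commTagResp_of_deliver hr1 hr2 hb
    obtain ⟨resp3, hr3, hsub⟩ := E.getCommTag_mono (show b + 1 ≤ G from hbG)
      (fun l hl hl' => hG l (by omega) (by omega)) hr2
    rw [hresp] at hr3
    cases hr3
    exact ⟨_, hsub hmem⟩
  have h2 := Set.ncard_le_ncard hmem (Set.toFinite _)
  have h3 := E.reader_inv hk r G
  rw [hresp] at h3
  simp only at h3
  have h4 := hE.edges
  have h5 : P.n₁ = 2 * P.f₁ + P.k := rfl
  omega

/-- Every branch of the put-tag handler acknowledges at once, so one round trip to the live servers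
completes a quorum. -/
theorem BoundedLatency.putTag_le (hτ : E.BoundedLatency τ₀ τ₁ τ₂) (hE : E.FewCrashes)
    (hk : 0 < P.k) {J j q : ℕ} {r : R} {t : Tag W} (hJj : J < j)
    (hcr : ∀ n ≤ j, E.event n ≠ .crash (.reader r))
    (hsent : ∀ s : Fin P.n₁, ⟨.reader r, .edge s, .putTag q t⟩ ∈ E.sent J)
    (hops : ∀ n, J < n → n ≤ j → ((E.config n).reader r).ops = q)
    (hj : ∀ n, J < n → n ≤ j → ∃ t v acks, ((E.config n).reader r).phase = .putTag t v acks) :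
    E.time j ≤ E.time J + 2 * τ₁ := by
  by_contra! hlt
  obtain ⟨t0, v0, acks, hacks⟩ := hj j hJj le_rfl
  have hmem : E.liveEdges ⊆ acks := by
    intro s hs
    obtain ⟨a, hia, hta, ha⟩ := hτ.delivered_of_live (hsent s) hs
    have hr : ⟨.edge s, .reader r, .ackRead q⟩ ∈ E.sent a := by
      rw [E.sent_deliver_edge ha]
      refine ⟨rfl, ?_⟩
      simp only [EdgeState.recv, EdgeState.putTagResp]
      split_ifs
      · exact Or.inr rfl
      · exact Or.inr rfl
      · exact rfl
    simp only [linkBound] at hta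
    obtain ⟨b, hab, hbG, -, hb⟩ := hτ.delivered (j := j) hr (fun n hn => hcr n hn.le)
      (by simp only [linkBound]; linarith)
    obtain ⟨_, _, _, hr1⟩ := hj b (by omega) hbG.le
    obtain ⟨_, _, _, hr2⟩ := hj (b + 1) (by omega) hbG
    rw [← hops b (by omega) hbG.le] at hb
    have hmem := E.mem_readAcks_of_deliver hr1 hr2 hb
    obtain ⟨resp3, hr3, hsub⟩ := E.putTag_mono (show b + 1 ≤ j from hbG)
      (fun l hl hl' => by
        obtain ⟨_, _, _, h⟩ := hj l (by omega) hl'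
        rw [h]; simp) hr2
    rw [hacks] at hr3
    cases hr3
    exact hsub hmem
  have h2 := Set.ncard_le_ncard hmem (Set.toFinite _)
  have h3 := E.reader_inv hk r j
  rw [hacks] at h3
  simp only at h3
  have h4 := hE.edges
  have h5 : P.n₁ = 2 * P.f₁ + P.k := rfl
  omega

/-- A response that is sent early enough is among those collected. -/
theorem GetData.mem_resp {r : R} {q G J : ℕ} {treq : Tag W} (h : E.GetData r q G J treq)
    (hτ : E.BoundedLatency τ₀ τ₁ τ₂) {treq' : Tag W} {resp : Set (Fin P.n₁ × DataResp P F W)}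
    (hresp : ((E.config J).reader r).phase = .getData treq' resp) {s : Fin P.n₁}
    {x : DataResp P F W} {c : ℕ} (hGc : G < c)
    (hsent : ⟨.edge s, .reader r, respMsg q x⟩ ∈ E.sent c)
    (hc : E.time c + τ₁ < E.time J) : (s, x) ∈ resp := by
  obtain ⟨b, hcb, hbJ, -, hb⟩ := hτ.delivered (j := J) hsent
    (fun n hn => h.not_crash n hn.le) hc
  obtain ⟨_, _, hr1⟩ := h.phase b (by omega) hbJ.le
  obtain ⟨_, _, hr2⟩ := h.phase (b + 1) (by omega) hbJ
  rw [← h.ops b (by omega) hbJ.le] at hb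
  have hmem := E.mem_dataResp_of_deliver hr1 hr2 hb
  obtain ⟨resp3, hr3, hsub⟩ := E.getData_mono (show b + 1 ≤ J from hbJ)
    (fun l hl hl' => h.phase l (by omega) (by omega)) hr2
  rw [hresp] at hr3
  cases hr3
  exact hsub hmem

end Execution
end LDS

namespace LDS
namespace Execution

variable {P : Params} {F W : Type*} [Zero F] [LinearOrder W] {S : System P F W} {R : Type*}
  (E : Execution S R)

/-! ### Regeneration from the second layer -/

theorem queryCodeElem_sent {n q : ℕ} {s : Fin P.n₁} {dst : Proc P W R} {r : R}
    (h : ⟨.edge s, dst, .queryCodeElem r q⟩ ∈ E.sent n) :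
    ∃ g treq, E.event n = .deliver g ⟨.reader r, .edge s, .queryData q treq⟩ := by
  obtain ⟨m, src, msg, out, hev, htr, ho⟩ := E.sent_edge h
  generalize (E.config (n + 1)).edge s = e' at htr
  cases htr
  case queryDataRegister r' q' treq _ _ =>
    obtain ⟨i, hi⟩ := ho
    cases hi
    exact ⟨m, treq, hev⟩
  all_goals simp [ackWriter, serve, writeToL2] at ho

theorem helperElem_origin {n m q : ℕ} {i : Fin P.n₂} {s : Fin P.n₁} {r : R} {t : Tag W}
    {h : Helper P F} (hev : E.event n = .deliver m ⟨.back i, .edge s, .helperElem r q t h⟩) :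
    m < n ∧ t = ((E.config m).back i).t ∧
      h = S.code.helper (Fin.natAdd P.n₁ i) (Fin.castAdd P.n₂ s) ((E.config m).back i).c ∧
      ∃ l < m, E.event m = .deliver l ⟨.edge s, .back i, .queryCodeElem r q⟩ ∧
        ∃ g treq, E.event l = .deliver g ⟨.reader r, .edge s, .queryData q treq⟩ := by
  obtain ⟨hmn, hp⟩ := E.mem_sent_of_deliver hev
  obtain ⟨l, j, msg, out, hev', htr, ho⟩ := E.sent_back hp
  obtain ⟨hlm, hp'⟩ := E.mem_sent_of_deliver hev'
  generalize (E.config (m + 1)).back i = b' at htr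
  cases htr
  case query r' q' =>
    cases ho
    exact ⟨hmn, rfl, rfl, l, hlm, hev', E.queryCodeElem_sent hp'⟩
  case skip => exact absurd ho id
  all_goals cases ho

variable {E}

theorem GetData.helper_origin {r : R} {q G J : ℕ} {treq : Tag W} (hG : E.GetData r q G J treq)
    {n m : ℕ} {i : Fin P.n₂} {s : Fin P.n₁} {t : Tag W} {h : Helper P F}
    (hev : E.event n = .deliver m ⟨.back i, .edge s, .helperElem r q t h⟩) (hn : n ≤ J) :
    ∃ l < m, E.event m = .deliver l ⟨.edge s, .back i, .queryCodeElem r q⟩ ∧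
      E.event l = .deliver G ⟨.reader r, .edge s, .queryData q treq⟩ := by
  obtain ⟨hmn, -, -, l, hl, h1, g, treq', h2⟩ := E.helperElem_origin hev
  obtain ⟨hgl, hp⟩ := E.mem_sent_of_deliver h2
  obtain ⟨rfl, rfl⟩ := hG.unique g (by omega) _ _ hp
  exact ⟨l, hl, h1, h2⟩

/-- Up to step `J` the read has issued one request to `s`. Along the chain of request, helper query
and reply every packet is delivered once, so the two replies coincide. -/
theorem GetData.helper_unique {r : R} {q G J : ℕ} {treq : Tag W} (hG : E.GetData r q G J treq)
    {n n' m m' : ℕ} {i : Fin P.n₂} {s : Fin P.n₁} {t t' : Tag W} {h h' : Helper P F}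
    (hev : E.event n = .deliver m ⟨.back i, .edge s, .helperElem r q t h⟩) (hn : n ≤ J)
    (hev' : E.event n' = .deliver m' ⟨.back i, .edge s, .helperElem r q t' h'⟩) (hn' : n' ≤ J) :
    n = n' := by
  obtain ⟨l, -, h1, h2⟩ := hG.helper_origin hev hn
  obtain ⟨l', -, h1', h2'⟩ := hG.helper_origin hev' hn'
  obtain rfl := E.deliver_once _ _ _ _ h2 h2'
  obtain rfl := E.deliver_once _ _ _ _ h1 h1'
  obtain ⟨-, rfl, rfl, -⟩ := E.helperElem_origin hev
  obtain ⟨-, rfl, rfl, -⟩ := E.helperElem_origin hev'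
  exact E.deliver_once _ _ _ _ hev hev'

variable (E)

/-- The second-layer servers whose helper data for a read have reached server `s`. -/
def repliedBacks (s : Fin P.n₁) (r : R) (q : ℕ) (n : ℕ) : Set (Fin P.n₂) :=
  {i | ∃ n' < n, ∃ m t h, E.event n' = .deliver m ⟨.back i, .edge s, .helperElem r q t h⟩}

theorem repliedBacks_succ {s : Fin P.n₁} {r : R} {q n m : ℕ} {i : Fin P.n₂} {t : Tag W}
    {h : Helper P F} (hev : E.event n = .deliver m ⟨.back i, .edge s, .helperElem r q t h⟩) :
    E.repliedBacks s r q (n + 1) = insert i (E.repliedBacks s r q n) := by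
  ext i'
  constructor
  · rintro ⟨n', hn', m', t', h', hev'⟩
    rcases Nat.lt_succ_iff_lt_or_eq.1 hn' with hn' | rfl
    · exact Or.inr ⟨n', hn', m', t', h', hev'⟩
    · rw [hev] at hev'
      cases hev'
      exact Or.inl rfl
  · rintro (rfl | ⟨n', hn', h'⟩)
    · exact ⟨n, Nat.lt_succ_self n, m, t, h, hev⟩
    · exact ⟨n', hn'.trans (Nat.lt_succ_self n), h'⟩

variable {E}

theorem GetData.readCounter_eq {r : R} {q G J : ℕ} {treq : Tag W}
    (hG : E.GetData r q G J treq) (s : Fin P.n₁) (n : ℕ) (hn : n ≤ J) :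
    ((E.config n).edge s).readCounter (r, q) = (E.repliedBacks s r q n).ncard := by
  classical
  induction n with
  | zero => simp [E.config_zero, initConfig, repliedBacks]
  | succ n ih =>
    specialize ih (by omega)
    by_cases hev : ∃ m i t h, E.event n = .deliver m ⟨.back i, .edge s, .helperElem r q t h⟩
    · obtain ⟨m, i, t, h, hev⟩ := hev
      have h2 : i ∉ E.repliedBacks s r q n := by
        rintro ⟨n', hn', m', t', h', hev'⟩
        exact absurd (hG.helper_unique hev' (by omega) hev (by omega)) hn'.ne
      rw [E.repliedBacks_succ hev, Set.ncard_insert_of_notMem h2 (Set.toFinite _), ← ih,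
        E.edge_deliver hev]
      simp only [EdgeState.recv, EdgeState.helperElemRecv]
      split_ifs <;> simp
    · have h1 : E.repliedBacks s r q (n + 1) = E.repliedBacks s r q n := by
        ext i'
        constructor
        · rintro ⟨n', hn', h⟩
          rcases Nat.lt_succ_iff_lt_or_eq.1 hn' with hn' | rfl
          · exact ⟨n', hn', h⟩
          · obtain ⟨m, t, h, h'⟩ := h
            exact absurd ⟨m, i', t, h, h'⟩ hev
        · rintro ⟨n', hn', h⟩
          exact ⟨n', hn'.trans (Nat.lt_succ_self n), h⟩
      rw [h1, ← ih]
      rcases E.edge_step n s with ⟨h', -⟩ | ⟨m, src, msg, out, hev', htr, -⟩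
      · rw [h']
      · generalize (E.config (n + 1)).edge s = e' at htr ⊢
        cases htr <;> try rfl
        all_goals
          rename_i i r' q' t h _
          have hne : (r, q) ≠ (r', q') := by
            intro heq
            cases heq
            exact hev ⟨m, i, t, h, hev'⟩
          simp only [Function.update_of_ne hne]

variable (E) in
-- The set `K` is emptied when the counter reaches `n₂ - f₂`, so it is a faithful record only below
-- that threshold.
theorem mem_helpers_iff (s : Fin P.n₁) (r : R) (q : ℕ) (n : ℕ)
    (hc : ((E.config n).edge s).readCounter (r, q) < P.n₂ - P.f₂) (i : Fin P.n₂) (t : Tag W)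
    (h : Helper P F) : (i, t, h) ∈ ((E.config n).edge s).K (r, q) ↔
      ∃ n' < n, ∃ m, E.event n' = .deliver m ⟨.back i, .edge s, .helperElem r q t h⟩ := by
  classical
  induction n with
  | zero =>
    rw [E.config_zero]
    simp [initConfig]
  | succ n ih =>
    by_cases hev : ∃ m i t h, E.event n = .deliver m ⟨.back i, .edge s, .helperElem r q t h⟩
    · obtain ⟨m, i', t', h', hev⟩ := hev
      rw [E.edge_deliver hev] at hc ⊢
      simp only [EdgeState.recv, EdgeState.helperElemRecv, Function.update_self] at hc ⊢
      split_ifs at hc ⊢ with hcc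
      · simp only [Function.update_self] at hc
        omega
      · simp only [Function.update_self] at hc ⊢
        rw [Set.mem_insert_iff, ih (by omega)]
        constructor
        · rintro (heq | ⟨n', hn', hx⟩)
          · cases heq
            exact ⟨n, Nat.lt_succ_self n, m, hev⟩
          · exact ⟨n', hn'.trans (Nat.lt_succ_self n), hx⟩
        · rintro ⟨n', hn', m', hx⟩
          rcases Nat.lt_succ_iff_lt_or_eq.1 hn' with hn' | rfl
          · exact Or.inr ⟨n', hn', m', hx⟩
          · rw [hev] at hx
            cases hx
            exact Or.inl rfl
    · have h1 : (∃ n' < n + 1, ∃ m, E.event n' =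
            .deliver m ⟨.back i, .edge s, .helperElem r q t h⟩) ↔
          ∃ n' < n, ∃ m, E.event n' =
            .deliver m ⟨.back i, .edge s, .helperElem r q t h⟩ := by
        constructor
        · rintro ⟨n', hn', m, hx⟩
          rcases Nat.lt_succ_iff_lt_or_eq.1 hn' with hn' | rfl
          · exact ⟨n', hn', m, hx⟩
          · exact absurd ⟨m, _, _, _, hx⟩ hev
        · rintro ⟨n', hn', hx⟩
          exact ⟨n', hn'.trans (Nat.lt_succ_self n), hx⟩
      rw [h1]
      rcases E.edge_step n s with ⟨h', -⟩ | ⟨m, src, msg, out, hev', htr, -⟩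
      · rw [h'] at hc ⊢
        exact ih hc
      · generalize (E.config (n + 1)).edge s = e' at htr hc ⊢
        cases htr <;> try exact ih hc
        all_goals
          rename_i i' r' q' t' h' _
          have hne : (r, q) ≠ (r', q') := by
            intro heq
            cases heq
            exact hev ⟨m, i', t', h', hev'⟩
          simp only [Function.update_of_ne hne] at hc ⊢
          exact ih hc

variable (E)

/-- The refused branches are recorded in the second alternative. They later show that the value of
the committed tag had already been moved to the second layer. -/
theorem queryData_cases {A G q : ℕ} {r : R} {s : Fin P.n₁} {treq : Tag W}
    (h : E.event A = .deliver G ⟨.reader r, .edge s, .queryData q treq⟩) :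
    (∃ t v, ⟨.edge s, .reader r, .dataValue q t v⟩ ∈ E.sent A) ∨
    ((r, q, treq) ∈ ((E.config (A + 1)).edge s).Γ ∧
      (∀ i, ⟨.edge s, .back i, .queryCodeElem r q⟩ ∈ E.sent A) ∧
      (∀ v, (treq, some v) ∉ ((E.config A).edge s).L) ∧
      (treq < ((E.config A).edge s).tc →
        ∀ v, (((E.config A).edge s).tc, some v) ∉ ((E.config A).edge s).L)) := by
  rw [E.sent_deliver_edge h, E.edge_deliver h]
  simp only [EdgeState.recv, EdgeState.getDataResp]
  split_ifs with h1 h2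
  · obtain ⟨v, hv⟩ := h1
    exact Or.inl ⟨treq, v, rfl, v, hv, rfl⟩
  · obtain ⟨h2, v, hv⟩ := h2
    exact Or.inl ⟨_, v, rfl, v, hv, rfl⟩
  · refine Or.inr ⟨Or.inl rfl, fun i => ⟨rfl, i, rfl⟩, not_exists.1 h1, fun h v hv => ?_⟩
    exact h2 ⟨h, v, hv⟩

theorem helper_response {ρ m q : ℕ} {i : Fin P.n₂} {s : Fin P.n₁} {r : R} {t treq : Tag W}
    {h : Helper P F} (hev : E.event ρ = .deliver m ⟨.back i, .edge s, .helperElem r q t h⟩)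
    (hc : ((E.config ρ).edge s).readCounter (r, q) + 1 = P.n₂ - P.f₂)
    (hΓ : (r, q, treq) ∈ ((E.config ρ).edge s).Γ) :
    (∃ x, ⟨.edge s, .reader r, respMsg q x⟩ ∈ E.sent ρ) ∧
      ∀ t', IsGreatest (regenerableTags (insert (i, t, h) (((E.config ρ).edge s).K (r, q)))) t' →
        treq ≤ t' → ∃ c, ⟨.edge s, .reader r, .dataCoded q t' c⟩ ∈ E.sent ρ := by
  rw [E.sent_deliver_edge hev]
  simp only [EdgeState.recv, EdgeState.helperElemRecv, Function.update_self]
  rw [if_pos hc]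
  refine ⟨?_, fun t' h1 h2 => ⟨_, rfl, treq, hΓ, Or.inl ⟨t', h1, h2, rfl⟩⟩⟩
  by_cases hex : ∃ t', IsGreatest (regenerableTags
      (insert (i, t, h) (((E.config ρ).edge s).K (r, q)))) t' ∧ treq ≤ t'
  · obtain ⟨t', h1, h2⟩ := hex
    exact ⟨.coded t' _, rfl, treq, hΓ, Or.inl ⟨t', h1, h2, rfl⟩⟩
  · exact ⟨.fail, rfl, treq, hΓ, Or.inr ⟨hex, rfl⟩⟩

variable {E} {τ₀ τ₁ τ₂ : ℝ}

/-- At least `n₂ - f₂` second-layer servers live and reply within `2τ₂`. Step `ρ` is the one whose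
reply brings the number of distinct repliers to `n₂ - f₂`. -/
theorem GetData.exists_regenerate {r : R} {q G J : ℕ} {treq : Tag W}
    (hG : E.GetData r q G J treq) (hτ : E.BoundedLatency τ₀ τ₁ τ₂) (hP : P.Valid)
    (hE : E.FewCrashes) (h₂ : 0 ≤ τ₂) {s : Fin P.n₁} (hs : s ∈ E.liveEdges) {A : ℕ}
    (hA : E.event A = .deliver G ⟨.reader r, .edge s, .queryData q treq⟩)
    (hq : ∀ i, ⟨.edge s, .back i, .queryCodeElem r q⟩ ∈ E.sent A)
    (hJ : E.time A + 2 * τ₂ < E.time J) :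
    ∃ ρ, A < ρ ∧ ρ < J ∧ E.time ρ ≤ E.time A + 2 * τ₂ ∧ ∃ m i t h,
      E.event ρ = .deliver m ⟨.back i, .edge s, .helperElem r q t h⟩ ∧
      ((E.config ρ).edge s).readCounter (r, q) + 1 = P.n₂ - P.f₂ := by
  classical
  have hf := hP.f₂_lt
  have hreply : ∀ i ∈ E.liveBacks, ∃ n, E.time n ≤ E.time A + 2 * τ₂ ∧
      i ∈ E.repliedBacks s r q (n + 1) := by
    intro i hi
    obtain ⟨b, -, htb, hb⟩ := hτ.delivered_of_live (hq i) hi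
    have hb' : ∃ t h, ⟨.back i, .edge s, .helperElem r q t h⟩ ∈ E.sent b := by
      rw [E.sent_deliver_back hb]
      exact ⟨_, _, rfl, rfl⟩
    obtain ⟨t, h, hb'⟩ := hb'
    obtain ⟨n, -, htn, hn⟩ := hτ.delivered_of_live hb' hs
    simp only [linkBound] at htb htn
    exact ⟨n, by linarith, n, Nat.lt_succ_self n, b, t, h, hn⟩
  obtain ⟨n, -, htn, hall⟩ := E.exists_common E.liveBacks
    (p := fun i n => i ∈ E.repliedBacks s r q (n + 1))
    (fun o m n hmn => fun ⟨a, ha, h⟩ => ⟨a, by omega, h⟩) (n₀ := A)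
    (T := E.time A + 2 * τ₂) (by linarith) hreply
  have hnJ : n < J := by
    by_contra h
    exact absurd (E.time_mono (not_lt.1 h)) (not_le.2 (htn.trans_lt hJ))
  have hcard : P.n₂ - P.f₂ ≤ (E.repliedBacks s r q (n + 1)).ncard := by
    have h1 : E.liveBacks.ncard ≤ (E.repliedBacks s r q (n + 1)).ncard :=
      Set.ncard_le_ncard hall (Set.toFinite _)
    have := hE.backs
    omega
  obtain ⟨ρ, -, hρn, hρ, hρ'⟩ := exists_last
    (p := fun n => (E.repliedBacks s r q n).ncard < P.n₂ - P.f₂) (Nat.zero_le (n + 1))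
    (by
      have : E.repliedBacks s r q 0 = ∅ := by
        ext i
        simp [repliedBacks]
      rw [this, Set.ncard_empty]
      omega) (not_lt.2 hcard)
  specialize hρ ρ (Nat.zero_le ρ) le_rfl
  have hev : ∃ m i t h, E.event ρ = .deliver m ⟨.back i, .edge s, .helperElem r q t h⟩ := by
    by_contra hne
    refine hρ' (lt_of_le_of_lt (Set.ncard_le_ncard ?_ (Set.toFinite _)) hρ)
    rintro i ⟨n', hn', m, t, h, hev⟩
    rcases Nat.lt_succ_iff_lt_or_eq.1 hn' with hn' | rfl
    · exact ⟨n', hn', m, t, h, hev⟩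
    · exact absurd ⟨m, i, t, h, hev⟩ hne
  obtain ⟨m, i, t, h, hev⟩ := hev
  have hAρ : A < ρ := by
    obtain ⟨l, hl, h1, h2⟩ := hG.helper_origin hev (by omega)
    obtain rfl := E.deliver_once _ _ _ _ hA h2
    have := (E.mem_sent_of_deliver hev).1
    omega
  refine ⟨ρ, hAρ, by omega, (E.time_mono (Nat.lt_succ_iff.1 hρn)).trans htn, m, i, t, h, hev, ?_⟩
  rw [hG.readCounter_eq s ρ (by omega)]
  rw [E.repliedBacks_succ hev] at hρ'
  have := Set.ncard_insert_le i (E.repliedBacks s r q ρ)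
  omega

theorem GetData.served_or_outstanding {r : R} {q G J : ℕ} {treq : Tag W}
    (hG : E.GetData r q G J treq) {s : Fin P.n₁} {A n : ℕ} (hAn : A < n) (hn : n ≤ J)
    (hA : E.event A = .deliver G ⟨.reader r, .edge s, .queryData q treq⟩) :
    (r, q, treq) ∈ ((E.config n).edge s).Γ ∨
      ∃ c, A ≤ c ∧ c < n ∧ ∃ t v, ⟨.edge s, .reader r, .dataValue q t v⟩ ∈ E.sent c := by
  rcases E.queryData_cases hA with h | ⟨hΓ, -⟩
  · exact Or.inr ⟨A, le_rfl, hAn, h⟩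
  · rcases E.outstanding_or_served (show A + 1 ≤ n from hAn) hΓ
      (fun l hl m t' h => by
        obtain ⟨hml, hp⟩ := E.mem_sent_of_deliver h
        exact hG.no_putTag m (by omega) _ _ hp) with h | ⟨c, h1, h2, h3⟩
    · exact Or.inl h
    · exact Or.inr ⟨c, by omega, h2, h3⟩

/-- At the regenerating step the read is either still outstanding and gets an answer, possibly `(⊥,
⊥)`, or it has been removed by a commit that sent it a value. -/
theorem GetData.exists_response {r : R} {q G J : ℕ} {treq : Tag W}
    (hG : E.GetData r q G J treq) (hτ : E.BoundedLatency τ₀ τ₁ τ₂) (hP : P.Valid)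
    (hE : E.FewCrashes) (h₂ : 0 ≤ τ₂) {s : Fin P.n₁} (hs : s ∈ E.liveEdges) {A : ℕ}
    (hA : E.event A = .deliver G ⟨.reader r, .edge s, .queryData q treq⟩)
    (hJ : E.time A + 2 * τ₂ < E.time J) :
    ∃ c, A ≤ c ∧ E.time c ≤ E.time A + 2 * τ₂ ∧
      ∃ x, ⟨.edge s, .reader r, respMsg q x⟩ ∈ E.sent c := by
  rcases E.queryData_cases hA with ⟨t, v, h⟩ | ⟨-, hq, -⟩
  · exact ⟨A, le_rfl, by linarith, .value t v, h⟩
  · obtain ⟨ρ, hAρ, hρJ, htρ, m, i, t, h, hev, hc⟩ :=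
      hG.exists_regenerate hτ hP hE h₂ hs hA hq hJ
    rcases hG.served_or_outstanding hAρ hρJ.le hA with hΓ | ⟨c, h1, h2, t', v', h3⟩
    · exact ⟨ρ, hAρ.le, htρ, (E.helper_response hev hc hΓ).1⟩
    · exact ⟨c, h1, (E.time_mono h2.le).trans htρ, .value t' v', h3⟩

/-- If enough second-layer servers hold the highest tag when a read is registered, then the read
gets a coded element for this tag, or a value. -/
theorem GetData.exists_coded {r : R} {q G J : ℕ} {treq : Tag W}
    (hG : E.GetData r q G J treq) (hτ : E.BoundedLatency τ₀ τ₁ τ₂) (hP : P.Valid)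
    (hE : E.FewCrashes) (h₂ : 0 ≤ τ₂) {s : Fin P.n₁} (hs : s ∈ E.liveEdges) {A : ℕ}
    (hA : E.event A = .deliver G ⟨.reader r, .edge s, .queryData q treq⟩)
    (hq : ∀ i, ⟨.edge s, .back i, .queryCodeElem r q⟩ ∈ E.sent A)
    (hJ : E.time A + 2 * τ₂ < E.time J) {t : Tag W} (ht : treq ≤ t)
    (hmax : ∀ m < J, E.time m ≤ E.time A + τ₂ → ∀ i, ((E.config m).back i).t ≤ t)
    {I : Set (Fin P.n₂)} (hI : P.n₂ - P.f₂ ≤ I.ncard)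
    (hIt : ∀ i ∈ I, t ≤ ((E.config A).back i).t) :
    ∃ c, A ≤ c ∧ E.time c ≤ E.time A + 2 * τ₂ ∧
      ((∃ t v, ⟨.edge s, .reader r, .dataValue q t v⟩ ∈ E.sent c) ∨
        ∃ x, ⟨.edge s, .reader r, .dataCoded q t x⟩ ∈ E.sent c) := by
  have hd : 0 < P.d := by
    have h1 := hP.k_le_d
    have h2 := hP.f₁_lt
    simp only [Params.n₁] at h2
    omega
  obtain ⟨ρ, hAρ, hρJ, htρ, m, i, t₁, h, hev, hc⟩ :=
    hG.exists_regenerate hτ hP hE h₂ hs hA hq hJ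
  rcases hG.served_or_outstanding hAρ hρJ.le hA with hΓ | ⟨c, h1, h2, h3⟩
  swap
  · exact ⟨c, h1, (E.time_mono h2.le).trans htρ, Or.inl h3⟩
  refine ⟨ρ, hAρ.le, htρ, Or.inr ((E.helper_response hev hc hΓ).2 t ?_ ht)⟩
  -- The reply that triggers regeneration is not yet in `K`; inserting it gives exactly the replies
  -- delivered up to `ρ`.
  have hK : ∀ i' t' h', (i', t', h') ∈ insert (i, t₁, h) (((E.config ρ).edge s).K (r, q)) ↔
      ∃ n' ≤ ρ, ∃ m, E.event n' = .deliver m ⟨.back i', .edge s, .helperElem r q t' h'⟩ := by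
    intro i' t' h'
    rw [Set.mem_insert_iff, E.mem_helpers_iff s r q ρ (by omega)]
    constructor
    · rintro (heq | ⟨n', hn', hx⟩)
      · cases heq
        exact ⟨ρ, le_rfl, m, hev⟩
      · exact ⟨n', hn'.le, hx⟩
    · rintro ⟨n', hn', m', hx⟩
      rcases hn'.lt_or_eq with hn' | rfl
      · exact Or.inr ⟨n', hn', m', hx⟩
      · rw [hev] at hx
        cases hx
        exact Or.inl rfl
  -- Every reply is computed after `A` and by time `A + τ₂`, so its tag lies between the tag stored
  -- at `A` and `t`.
  have hle : ∀ i' t' h', (i', t', h') ∈ insert (i, t₁, h) (((E.config ρ).edge s).K (r, q)) →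
      t' ≤ t ∧ ((E.config A).back i').t ≤ t' := by
    intro i' t' h' hx
    obtain ⟨n', hn', m', hx⟩ := (hK _ _ _).1 hx
    obtain ⟨l, hlm, h1, h2⟩ := hG.helper_origin hx (by omega)
    obtain rfl := E.deliver_once _ _ _ _ hA h2
    obtain ⟨hmn, rfl, -, -⟩ := E.helperElem_origin hx
    refine ⟨hmax m' (by omega) ?_ i', E.back_mono i' hlm.le⟩
    exact hτ.deliver_le h1
  refine ⟨?_, ?_⟩
  · have hcard := hG.readCounter_eq s ρ hρJ.le
    have hni : i ∉ E.repliedBacks s r q ρ := by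
      rintro ⟨n', hn', m', t', h', hev'⟩
      exact absurd (hG.helper_unique hev' (by omega) hev (by omega)) hn'.ne
    have hcard' := Set.ncard_insert_of_notMem hni (Set.toFinite _)
    rw [← E.repliedBacks_succ hev] at hcard'
    -- Both sets have at least `n₂ - f₂` members, so they share `n₂ - 2f₂ = d` servers, and these
    -- replied with exactly `t`.
    have hsub : I ∩ E.repliedBacks s r q (ρ + 1) ⊆
        {i' | ∃ h', (i', t, h') ∈ insert (i, t₁, h) (((E.config ρ).edge s).K (r, q))} := by
      rintro i' ⟨hi', n', hn', m', t', h', hev'⟩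
      have hx := (hK i' t' h').2 ⟨n', Nat.lt_succ_iff.1 hn', m', hev'⟩
      obtain ⟨h1, h2⟩ := hle _ _ _ hx
      obtain rfl := le_antisymm h1 ((hIt i' hi').trans h2)
      exact ⟨h', hx⟩
    have h1 := Set.ncard_le_ncard hsub (Set.toFinite _)
    have h2 := Set.ncard_union_add_ncard_inter I (E.repliedBacks s r q (ρ + 1))
      (Set.toFinite _) (Set.toFinite _)
    have h3 := Set.ncard_le_ncard (Set.subset_univ (I ∪ E.repliedBacks s r q (ρ + 1)))
      (Set.toFinite _)
    rw [Set.ncard_univ, Nat.card_eq_fintype_card, Fintype.card_fin] at h3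
    have h4 : P.n₂ = 2 * P.f₂ + P.d := rfl
    show P.d ≤ _
    omega
  · intro t' ht'
    have hne : {i' | ∃ h', (i', t', h') ∈
        insert (i, t₁, h) (((E.config ρ).edge s).K (r, q))}.Nonempty := by
      rw [← Set.ncard_pos (Set.toFinite _)]
      exact hd.trans_le ht'
    obtain ⟨i', h', hx⟩ := hne
    exact (hle _ _ _ hx).1

/-- A tag that is committed at step `X` for the first time reaches `k` live servers, which held
its value, within `2 τ₀`. -/
theorem BoundedLatency.spread (hτ : E.BoundedLatency τ₀ τ₁ τ₂) (hP : P.Valid)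
    (hE : E.FewCrashes) (h₀ : 0 ≤ τ₀) {X : ℕ} {t : Tag W}
    (hX : ∀ s, ((E.config X).edge s).tc < t) {s₁ : Fin P.n₁}
    (hs₁ : ((E.config (X + 1)).edge s₁).tc = t) :
    ∃ D ⊆ E.liveEdges, P.k ≤ D.ncard ∧ ∀ s ∈ D,
      (∃ n, X ≤ n ∧ E.time n ≤ E.time X + 2 * τ₀ ∧ t ≤ ((E.config (n + 1)).edge s).tc) ∧
      ∃ a ≤ X, ∃ v, (t, some v) ∈ ((E.config (a + 1)).edge s).L := by
  have hO := E.first_commit hP hX hs₁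
  set O := {o | (o, t) ∈ ((E.config (X + 1)).edge s₁).seen} with hOdef
  -- Two sets of size at least `f₁ + k` among `2f₁ + k` servers meet in at least `k`.
  refine ⟨O ∩ E.liveEdges, Set.inter_subset_right, ?_, ?_⟩
  · have h2 := Set.ncard_union_add_ncard_inter O E.liveEdges (Set.toFinite _) (Set.toFinite _)
    have h3 := Set.ncard_le_ncard (Set.subset_univ (O ∪ E.liveEdges)) (Set.toFinite _)
    rw [Set.ncard_univ, Nat.card_eq_fintype_card, Fintype.card_fin] at h3
    have h4 := hE.edges
    have h5 : P.n₁ = 2 * P.f₁ + P.k := rfl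
    omega
  · rintro s ⟨hsO, hs⟩
    constructor
    -- All origins in `O` received the value by step `X`, so their broadcasts reach `s` within
    -- `2τ₀`. As `s` is itself in `O`, its own broadcast is among them.
    · obtain ⟨n, hXn, htn, hall⟩ := E.exists_common O
        (p := fun o n => (o, t) ∈ ((E.config (n + 1)).edge s).seen)
        (fun o m n hmn h => E.seen_mono s (Nat.succ_le_succ hmn) h)
        (n₀ := X) (T := E.time X + 2 * τ₀) (by linarith) (by
          intro o ho
          obtain ⟨a, ha, hput⟩ := E.exists_recvPut_of_seen ho
          obtain ⟨c, htc, hc⟩ := hτ.broadcast hE hput s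
          have := E.time_mono (Nat.lt_succ_iff.1 ha)
          exact ⟨c, by linarith, hc.resolve_left (hs c)⟩)
      refine ⟨n, hXn, htn, (E.committed_of_seen (hall s hsO) ?_).1⟩
      exact hO.trans (Set.ncard_le_ncard hall (Set.toFinite _))
    · obtain ⟨a, ha, l, w, v, hput⟩ := E.exists_recvPut_of_seen hsO
      refine ⟨a, Nat.lt_succ_iff.1 ha, v, ?_⟩
      have hlt : ((E.config a).edge s).tc < t :=
        lt_of_le_of_lt (E.tc_mono s (Nat.lt_succ_iff.1 ha)) (hX s)
      rw [E.edge_deliver hput]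
      simp only [EdgeState.recv, EdgeState.putDataResp, if_pos hlt]
      exact Or.inl rfl

/-- Let `Y` be the step in which the committed tag of `s` reaches or passes `t`. The value of `t`
arrived before, and it cannot have been cleared, since second-layer acknowledgments of `t`
presuppose its commit at `s`. So that step serves the read, unless the read has been served already.
-/
theorem GetData.served_of_commit {r : R} {q G J : ℕ} {treq : Tag W}
    (hG : E.GetData r q G J treq) (hP : P.Valid) {s : Fin P.n₁} {A X a n : ℕ} {t : Tag W}
    {v : Value P F} (hA : E.event A = .deliver G ⟨.reader r, .edge s, .queryData q treq⟩)
    (ht : treq ≤ t) (hAlt : ((E.config A).edge s).tc < t) (hAn : A ≤ n) (hnJ : n < J)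
    (hXlt : ((E.config X).edge s).tc < t)
    (hn : t ≤ ((E.config (n + 1)).edge s).tc) (haX : a ≤ X)
    (hv : (t, some v) ∈ ((E.config (a + 1)).edge s).L) :
    ∃ c, A ≤ c ∧ c ≤ n ∧ ∃ t v, ⟨.edge s, .reader r, .dataValue q t v⟩ ∈ E.sent c := by
  obtain ⟨Y, hAY, hYn, hY, hY'⟩ := exists_last (p := fun n => ((E.config n).edge s).tc < t)
    (show A ≤ n + 1 by omega) hAlt (not_lt.2 hn)
  specialize hY Y hAY le_rfl
  rw [not_lt] at hY'
  -- Handling a data request leaves the committed tag unchanged.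
  have hAY' : A ≠ Y := by
    rintro rfl
    have h' := E.edge_deliver hA
    have htc : ((E.config (A + 1)).edge s).tc = ((E.config A).edge s).tc := by
      rw [h']
      simp only [EdgeState.recv, EdgeState.getDataResp]
      split_ifs <;> rfl
    rw [htc] at hY'
    exact absurd hY (not_lt.2 hY')
  have haY : a ≤ Y := by
    by_contra h
    have h1 : ((E.config (Y + 1)).edge s).tc ≤ ((E.config X).edge s).tc :=
      E.tc_mono s (by omega)
    exact absurd hXlt (not_lt.2 (hY'.trans h1))
  have hvY : (t, some v) ∈ ((E.config Y).edge s).L := by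
    rcases haY.lt_or_eq with haY | rfl
    · rcases E.some_or_writeCounter (show a + 1 ≤ Y from haY) hv hY.le with h | h
      · exact h
      · have hk : 0 < P.k := by have := hP.f₁_lt; simp only [Params.n₁] at this; omega
        have hf := hP.f₂_lt
        rw [E.writeCounter_eq hk] at h
        have hne : (E.ackedBacks s t Y).Nonempty := by
          rw [← Set.ncard_pos (Set.toFinite _)]
          omega
        obtain ⟨i, n', hn', m, hack⟩ := hne
        have h1 : ((E.config n').edge s).tc ≤ ((E.config Y).edge s).tc := E.tc_mono s hn'.le
        exact absurd hY (not_lt.2 ((E.le_tc_of_ackCodeElem hack).trans h1))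
    · exact E.some_of_commit hY hY' hv
  rcases hG.served_or_outstanding (lt_of_le_of_ne hAY hAY') (by omega) hA with
    hΓ | ⟨c, h1, h2, h3⟩
  · refine ⟨Y, hAY, by omega, E.serves_of_commit hY hY' hvY hΓ ht fun m t' h => ?_⟩
    obtain ⟨hml, hp⟩ := E.mem_sent_of_deliver h
    exact hG.no_putTag m (by omega) _ _ hp
  · exact ⟨c, h1, by omega, h3⟩

/-- If the phase lasted longer, all live servers would have responded, so availability of a tag must
be what fails. Assuming that no value arrived before `J`, `k` live servers turn out to have sent
coded elements for one tag. -/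
theorem BoundedLatency.getData_le (hτ : E.BoundedLatency τ₀ τ₁ τ₂) (hP : P.Valid)
    (hE : E.FewCrashes) (h₀ : 0 ≤ τ₀) (h₁ : 0 ≤ τ₁) (h₂ : 0 ≤ τ₂) {r : R} {q G J : ℕ}
    {treq : Tag W} (hG : E.GetData r q G J treq) :
    E.time J ≤ E.time G + (2 * τ₁ + max (2 * τ₂) (2 * τ₀ + τ₂)) := by
  by_contra! hlt
  have hk : 0 < P.k := by have := hP.f₁_lt; simp only [Params.n₁] at this; omega
  have hf := hP.f₂_lt
  have hn₁ : P.n₁ = 2 * P.f₁ + P.k := rfl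
  have hm1 := le_max_left (2 * τ₂) (2 * τ₀ + τ₂)
  have hm2 := le_max_right (2 * τ₂) (2 * τ₀ + τ₂)
  obtain ⟨treq', resp, hresp⟩ := hG.phase J hG.lt le_rfl
  have hinv := E.reader_inv hk r J
  rw [hresp] at hinv
  refine hinv ?_
  have hreg : ∀ s ∈ E.liveEdges, ∃ A, G < A ∧ A < J ∧ E.time A ≤ E.time G + τ₁ ∧
      E.event A = .deliver G ⟨.reader r, .edge s, .queryData q treq⟩ := by
    intro s hs
    exact hτ.delivered (hG.sent s) (fun n _ => hs n) (by simp only [linkBound]; linarith)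
  refine ⟨?_, ?_⟩
  · have hmem : E.liveEdges ⊆ {j' | ∃ y, (j', y) ∈ resp} := by
      intro s hs
      obtain ⟨A, hGA, hAJ, htA, hA⟩ := hreg s hs
      obtain ⟨c, hAc, htc, x, hx⟩ := hG.exists_response hτ hP hE h₂ hs hA (by linarith)
      exact ⟨x, hG.mem_resp hτ hresp (by omega) hx (by linarith)⟩
    have h1 := Set.ncard_le_ncard hmem (Set.toFinite _)
    have h2 := hE.edges
    omega
  by_contra hav
  -- A value sent early enough would make its tag available.
  have hnv : ∀ s c t v, G < c → ⟨.edge s, .reader r, .dataValue q t v⟩ ∈ E.sent c →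
      E.time J ≤ E.time c + τ₁ := by
    intro s c t v hGc hsent
    by_contra hc
    rw [not_le] at hc
    exact hav ⟨t, Or.inl ⟨s, v, hG.mem_resp hτ hresp (x := .value t v) hGc hsent hc⟩⟩
  -- Helper data for requests registered by `τ₁` after `G` are computed by `τ₁ + τ₂` after `G`; `N`
  -- is the last step before `J` within that time.
  obtain ⟨N, ⟨hNJ, htN⟩, hN⟩ : ∃ N, (N < J ∧ E.time N ≤ E.time G + (τ₁ + τ₂)) ∧
      ∀ n, n < J → E.time n ≤ E.time G + (τ₁ + τ₂) → n ≤ N := by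
    have hfin : {n | n < J ∧ E.time n ≤ E.time G + (τ₁ + τ₂)}.Finite :=
      (Set.finite_lt_nat J).subset fun n hn => hn.1
    obtain ⟨N, hN, hmax⟩ := hfin.exists_maximal ⟨G, hG.lt, by linarith⟩
    exact ⟨N, hN, fun n h1 h2 => (le_total n N).elim id fun h => hmax ⟨h1, h2⟩ h⟩
  have hGN : G ≤ N := hN G hG.lt (by linarith)
  obtain ⟨s₀, hs₀⟩ : ∃ s₀, ∀ s, ((E.config (N + 1)).edge s).tc ≤
      ((E.config (N + 1)).edge s₀).tc := by
    have : Nonempty (Fin P.n₁) := ⟨⟨0, by omega⟩⟩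
    exact Finite.exists_max fun s => ((E.config (N + 1)).edge s).tc
  set t := ((E.config (N + 1)).edge s₀).tc with ht
  have hsome : ∀ n ≤ N + 1, ∀ t', E.SomeCommitted n t' → t' ≤ t := by
    intro n hn t' h
    obtain ⟨s, hs⟩ := h.mono hn
    exact hs.trans (hs₀ s)
  have htreq : treq ≤ t :=
    hsome (N + 1) le_rfl _ ((E.bounded_tags hP (N + 1)).1 G (by omega) _
      (hG.sent ⟨0, by omega⟩) _ rfl)
  have hback : ∀ n ≤ N, ∀ i, ((E.config n).back i).t ≤ t := fun n hn i =>
    hsome n (by omega) _ ((E.bounded_tags hP n).2.1 i)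
  have hclaim : ∃ D ⊆ E.liveEdges, P.k ≤ D.ncard ∧ ∀ s ∈ D, ∀ A, G < A →
      E.time A ≤ E.time G + τ₁ →
      E.event A = .deliver G ⟨.reader r, .edge s, .queryData q treq⟩ →
      (∀ v, (treq, some v) ∉ ((E.config A).edge s).L) →
      (treq < ((E.config A).edge s).tc →
        ∀ v, (((E.config A).edge s).tc, some v) ∉ ((E.config A).edge s).L) → A < J →
      ∃ I : Set (Fin P.n₂), P.n₂ - P.f₂ ≤ I.ncard ∧ ∀ i ∈ I, t ≤ ((E.config A).back i).t := by
    have ht0 : S.t₀ ≤ t := (E.edge_inv (N + 1) s₀).init_le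
    rcases ht0.eq_or_lt with ht0 | ht0
    -- The initial tag is never newly committed, but every second-layer server stores at least this
    -- tag from the start.
    · refine ⟨E.liveEdges, subset_rfl, by have := hE.edges; omega, ?_⟩
      intro s _ A _ _ _ _ _ _
      refine ⟨Set.univ, ?_, fun i _ => ?_⟩
      · rw [Set.ncard_univ, Nat.card_eq_fintype_card, Fintype.card_fin]
        omega
      · rw [← ht0]
        have : ((E.config 0).back i).t ≤ ((E.config A).back i).t := E.back_mono i (Nat.zero_le A)
        rw [E.config_zero] at this
        exact this
    -- `X` is the step in which `t` is committed for the first time anywhere.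
    · obtain ⟨X, -, hXN, hX, hX'⟩ := exists_last
        (p := fun n => ∀ s, ((E.config n).edge s).tc < t) (Nat.zero_le (N + 1))
        (by rw [E.config_zero]; exact fun _ => ht0) (fun h => absurd (h s₀) (lt_irrefl _))
      specialize hX X (Nat.zero_le X) le_rfl
      push Not at hX'
      obtain ⟨s₁, hs₁⟩ := hX'
      have hs₁' : ((E.config (X + 1)).edge s₁).tc = t :=
        le_antisymm ((E.tc_mono s₁ (show X + 1 ≤ N + 1 by omega)).trans (hs₀ s₁)) hs₁
      have htX : E.time X ≤ E.time N := E.time_mono (Nat.lt_succ_iff.1 hXN)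
      obtain ⟨D, hD, hDk, hDs⟩ := hτ.spread hP hE h₀ hX hs₁'
      refine ⟨D, hD, hDk, ?_⟩
      intro s hs A hGA htA hA hL hL' hAJ
      obtain ⟨⟨n, hXn, htn, hn⟩, a, haX, v, hv⟩ := hDs s hs
      have hAN : A ≤ N := hN A hAJ (by linarith)
      rcases lt_or_ge ((E.config A).edge s).tc t with hAlt | hAge
      -- Here `s` crosses `t` only after the request, by `τ₁ + τ₂ + 2τ₀` after `G`. The value it
      -- then sends reaches the reader before `J`, contradicting `hnv`. This is the source of the
      -- term `2τ₀ + τ₂`.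
      · have hAn : A ≤ n := by
          by_contra h
          have : ((E.config (n + 1)).edge s).tc ≤ ((E.config A).edge s).tc :=
            E.tc_mono s (by omega)
          exact absurd hAlt (not_lt.2 (hn.trans this))
        have hnJ : n < J := by
          by_contra h
          have := E.time_mono (not_lt.1 h)
          linarith
        obtain ⟨c, hAc, hcn, t', v', hc⟩ := hG.served_of_commit hP hA htreq hAlt hAn hnJ
          (hX s) hn haX hv
        have h3 := hnv s c t' v' (by omega) hc
        have h4 := E.time_mono hcn
        linarith
      · have hAeq : ((E.config A).edge s).tc = t :=
          le_antisymm (hsome A (by omega) _ ⟨s, le_rfl⟩) hAge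
        have haA : a + 1 ≤ A := by
          by_contra h
          have : ((E.config A).edge s).tc ≤ ((E.config X).edge s).tc :=
            E.tc_mono s (by omega)
          exact absurd (hX s) (not_lt.2 (hAge.trans this))
        -- With the value of `t` at hand, the request would have been answered at once, whether
        -- `treq = t` or `treq < t`. So the value has been cleared, and the servers that
        -- acknowledged it form the set `I`.
        have hnot : (t, some v) ∉ ((E.config A).edge s).L := by
          rcases htreq.eq_or_lt with h | h
          · rw [← h]
            exact hL v
          · rw [← hAeq] at h ⊢
            exact hL' h v
        have hwc := (E.some_or_writeCounter haA hv hAeq.le).resolve_left hnot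
        rw [E.writeCounter_eq hk] at hwc
        refine ⟨_, hwc, ?_⟩
        rintro i ⟨n', hn', m, hack⟩
        exact (E.ackCodeElem_origin hack).1.trans (E.back_mono i hn'.le)
  obtain ⟨D, hD, hDk, hDs⟩ := hclaim
  -- All servers in `D` send coded elements for the same tag `t`, and there are at least `k` of
  -- them.
  refine hav ⟨t, Or.inr (hDk.trans (Set.ncard_le_ncard ?_ (Set.toFinite _)))⟩
  intro s hs
  obtain ⟨A, hGA, hAJ, htA, hA⟩ := hreg s (hD hs)
  rcases E.queryData_cases hA with ⟨t', v', h⟩ | ⟨-, hq, hL, hL'⟩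
  · have := hnv s A t' v' hGA h
    linarith
  obtain ⟨I, hI, hIt⟩ := hDs s hs A hGA htA hA hL hL' hAJ
  obtain ⟨c, hAc, htc, ⟨t', v', h⟩ | ⟨x, hx⟩⟩ := hG.exists_coded hτ hP hE h₂ (hD hs) hA hq
    (by linarith) htreq (fun m hm htm i => hback m (hN m hm (by linarith)) i) hI hIt
  · have := hnv s c t' v' (by omega) h
    linarith
  · exact ⟨x, hG.mem_resp hτ hresp (x := .coded t x) (by omega) hx (by linarith)⟩

theorem BoundedLatency.read_le (hτ : E.BoundedLatency τ₀ τ₁ τ₂) (hP : P.Valid)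
    (hE : E.FewCrashes) (h₀ : 0 ≤ τ₀) (h₁ : 0 ≤ τ₁) (h₂ : 0 ≤ τ₂) {i j : ℕ} {r : R}
    {t : Tag W} {v : Value P F} (h : E.SuccessfulRead i j r t v) :
    E.time j - E.time i ≤ max (6 * τ₁ + 2 * τ₂) (6 * τ₁ + 2 * τ₀ + τ₂) := by
  have hk : 0 < P.k := by have := hP.f₁_lt; simp only [Params.n₁] at this; omega
  obtain ⟨q, G, J, treq, t', hiG, hGJ, hJj, hG, hops, hget, hsenti, hsentJ, hput, hcr⟩ := h.phases
  have h1 := hτ.getCommTag_le hE hk hiG (fun n hn => hcr n (by omega)) hsenti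
    (fun n hn hn' => hops n hn (by omega)) hget
  have h2 := hτ.getData_le hP hE h₀ h₁ h₂ hG
  have h3 := hτ.putTag_le hE hk hJj hcr hsentJ (fun n hn hn' => hops n (by omega) hn') hput
  have h4 : 6 * τ₁ + max (2 * τ₂) (2 * τ₀ + τ₂) ≤
      max (6 * τ₁ + 2 * τ₂) (6 * τ₁ + 2 * τ₀ + τ₂) := by
    rw [← max_add_add_left, add_assoc]
  linarith

end Execution
end LDS

theorem lemma13 {F W R : Type*} [Field F] [Finite F] [LinearOrder W]
    (P : LDS.Params) (hP : P.Valid) (S : LDS.System P F W) (E : LDS.Execution S R)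
    (hE : E.FewCrashes) (τ₀ τ₁ τ₂ : ℝ) (h₀ : 0 ≤ τ₀) (h₁ : 0 ≤ τ₁) (h₂ : 0 ≤ τ₂)
    (hτ : E.BoundedLatency τ₀ τ₁ τ₂) :
    (∀ (i j : ℕ) (w : W) (v : LDS.Value P F) (t : LDS.Tag W), E.SuccessfulWrite i j w v t →
      E.time j - E.time i ≤ 4 * τ₁ + 2 * τ₀ ∧
      ∃ e, E.ExtendedWrite i j e w v t ∧
        max (E.time j) (E.time e) - E.time i ≤
          max (3 * τ₁ + 2 * τ₀ + 2 * τ₂) (4 * τ₁ + 2 * τ₀)) ∧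
    (∀ (i j : ℕ) (r : R) (t : LDS.Tag W) (v : LDS.Value P F), E.SuccessfulRead i j r t v →
      E.time j - E.time i ≤ max (6 * τ₁ + 2 * τ₂) (6 * τ₁ + 2 * τ₀ + τ₂)) :=
  ⟨fun _ _ _ _ _ h => hτ.write_le hP hE h₀ h₁ h₂ h, fun _ _ _ _ _ h => hτ.read_le hP hE h₀ h₁ h₂ h⟩
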